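/- Conventions. All vector spaces are complex and algebras need not be unital or commutative. A subset $S$ of a vector space $V$ is circled if $\lambda S\subseteq S$ for $|\lambda|\le1$ and $\bigcap_{t>1}tS=S$; a disk is a nonempty convex circled set $T$, and $V_T$ is its linear span with the gauge semi-norm of $T$. A complete convex bornological vector space is a vector space with a bornology for which addition and scalar multiplication are bounded, convex hulls of bounded sets are bounded, and every bounded set is contained in a bounded disk $T$ for which $V_T$ is a Banach space; a complete convex bornological algebra is, in addition, an associative algebra with bounded multiplication. For a bounded subset $S$ of such an algebra $B$, the spectral radius $\rho(S;B)\in[0,\infty]$ is the infimum of the $r>0$ for which $\bigcup_{n\ge1}(r^{-1}S)^n$ is bounded ($\infty$ if there is no such $r$); $B$ is locally multiplicative if $\rho(S;B)<\infty$ for all bounded $S\subseteq B$. A subset $X$ of a bornological vector space $V$ is locally dense if for every circled bounded $S\subseteq V$ there is a circled bounded $T\subseteq V$ such that every $v\in S$ admits a sequence $(x_n)$ in $X\cap T$ and a null sequence of scalars $\epsilon_n>0$ with $v\in T$ and $x_n-v\in\epsilon_nT$ for all $n$. A bounded homomorphism $f\colon A\to B$ between locally multiplicative complete convex bornological algebras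 is isoradial if $f(A)$ is locally dense in $B$ and $\rho(S;A)=\rho(f(S);B)$ for all bounded $S\subseteq A$; if $f$ is also injective, $A$ is called an isoradial subalgebra of $B$. Let $M$ be a (finite-dimensional, Hausdorff, second countable) smooth manifold with one-point compactification $M^+=M\cup\{\infty\}$, and let $A$ be a locally multiplicative complete convex bornological algebra. The algebra $\mathcal C_0(M,A)$, with pointwise multiplication, consists of the functions $f\colon M\to A$ whose extension to $M^+$ by $f(\infty)=0$ satisfies $f(x)-f(y)\in w(x,y)\,T$ for all $x,y\in M^+$, for some circled bounded $T\subseteq A$ and some continuous $w\colon M^+\times M^+\to[0,\infty)$ that vanishes on the diagonal; a subset of it is bounded if the same $(T,w)$ can be used for all its elements. The algebra $\mathcal D(M,A)$ consists of the compactly supported functions $M\to A$ that are smooth as functions into $A_T$ for some bounded disk $T\subseteq A$; a subset of it is bounded if all its elements are supported in a common compact set and, for a common $T$, they are smooth as functions into $A_T$ with all derivatives in charts uniformly bounded in $A_T$ on compact subsets of the chart domains. Theorem. (a) $\mathcal D(M,A)$ and $\mathcal C_0(M,A)$ are locally multiplicative complete convex bornological algebras, $\mathcal D(M,A)\subseteq\mathcal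 C_0(M,A)$, and $\mathcal D(M,A)$ is an isoradial subalgebra of $\mathcal C_0(M,A)$. (b) Let $B$ be $\mathcal C_0(M,A)$ or $\mathcal D(M,A)$, let $S\subseteq B$ be bounded, and put $S_x:=\{f(x)\mid f\in S\}$ for $x\in M$. The function $x\mapsto\rho(S_x;A)$ on $M$ is upper semicontinuous and vanishes at infinity, and $\rho(S;B)=\sup_{x\in M}\rho(S_x;A)$ (with $\sup\emptyset=0$). If $M\ne\emptyset$ then the supremum is a maximum. -/

import Mathlib

open Set Filter Topology
open scoped Pointwise Manifold ContDiff NNReal ENNReal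

noncomputable section

namespace BornAlg

/-! ### Disks and bornological vector spaces

Bornologies are Mathlib's `Bornology`; `Bornology.IsBounded S` says that `S` belongs to the
bornology. Real scalars act on complex vector spaces by restriction. -/

section Spaces

variable (V : Type*) [AddCommGroup V] [Module ℂ V]

/-- A circled subset: `λ S ⊆ S` for `|λ| ≤ 1`, and `⋂_{t > 1} t S = S`. -/
def IsCircled {V : Type*} [AddCommGroup V] [Module ℂ V] (S : Set V) : Prop :=
  Balanced ℂ S ∧ ⋂ t ∈ Ioi (1 : ℝ), t • S = S

/-- A (nonempty) disk `T`, that is, an absolutely convex subset with `⋂_{t > 1} t T = T`, whose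
gauge is a norm on the linear span of `T`. In a separated bornological vector space the last
condition holds for every bounded disk. -/
structure Disk where
  carrier : Set V
  zero_mem : (0 : V) ∈ carrier
  balanced : Balanced ℂ carrier
  convex : Convex ℝ carrier
  closed : ⋂ t ∈ Ioi (1 : ℝ), t • carrier = carrier
  norming : ∀ x : V, (∀ t : ℝ, 0 < t → x ∈ t • carrier) → x = 0

variable {V}

namespace Disk

/-- The linear span `V_T` of the disk `T`; below it gets the norm with closed unit ball `T`. -/
def Space (T : Disk V) : Type _ := Submodule.span ℂ T.carrier

instance (T : Disk V) : AddCommGroup T.Space :=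
  inferInstanceAs (AddCommGroup (Submodule.span ℂ T.carrier))

instance (T : Disk V) : Module ℂ T.Space :=
  inferInstanceAs (Module ℂ (Submodule.span ℂ T.carrier))

/-- The inclusion `V_T → V`. -/
def incl (T : Disk V) : T.Space →ₗ[ℂ] V := (Submodule.span ℂ T.carrier).subtype

variable (T : Disk V)

theorem incl_injective : Function.Injective T.incl := Subtype.val_injective

theorem incl_real_smul (r : ℝ) (x : T.Space) : T.incl (r • x) = r • T.incl x :=
  T.incl.map_smul (r : ℂ) x

theorem smul_subset {a b : ℝ} (ha : 0 ≤ a) (hab : a ≤ b) : a • T.carrier ⊆ b • T.carrier := by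
  have h := T.balanced.smul_mono (a := (a : ℂ)) (b := (b : ℂ))
    (by simpa [abs_of_nonneg ha, abs_of_nonneg (ha.trans hab)] using hab)
  exact h

theorem add_mem {a b : ℝ} (ha : 0 ≤ a) (hb : 0 ≤ b) {x y : V} (hx : x ∈ a • T.carrier)
    (hy : y ∈ b • T.carrier) : x + y ∈ (a + b) • T.carrier := by
  rw [T.convex.add_smul ha hb]
  exact Set.add_mem_add hx hy

theorem complex_smul_mem (c : ℂ) {r : ℝ} {x : V} (hx : x ∈ r • T.carrier) :
    c • x ∈ (‖c‖ * r) • T.carrier := by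
  obtain ⟨t, ht, rfl⟩ := hx
  have h : c • t ∈ ‖c‖ • T.carrier := by
    have h2 := T.balanced.smul_mono (a := c) (b := ((‖c‖ : ℝ) : ℂ)) (by simp)
    exact h2 (Set.smul_mem_smul_set ht)
  obtain ⟨u, hu, hu2⟩ := h
  refine ⟨u, hu, ?_⟩
  simp only at hu2 ⊢
  rw [mul_comm, mul_smul, hu2, smul_comm]

theorem mem_smul_of_mem_span {x : V} (hx : x ∈ Submodule.span ℂ T.carrier) :
    ∃ r : ℝ, 0 < r ∧ x ∈ r • T.carrier := by
  induction hx using Submodule.span_induction with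
  | mem x h => exact ⟨1, one_pos, by simpa using h⟩
  | zero => exact ⟨1, one_pos, by simpa using T.zero_mem⟩
  | add x y _ _ hx hy =>
    obtain ⟨r, hr, hx⟩ := hx
    obtain ⟨s, hs, hy⟩ := hy
    exact ⟨r + s, by positivity, T.add_mem hr.le hs.le hx hy⟩
  | smul c x _ hx =>
    obtain ⟨r, hr, hx⟩ := hx
    refine ⟨‖c‖ * r + 1, by positivity, ?_⟩
    exact T.smul_subset (by positivity) (by linarith) (T.complex_smul_mem c hx)

theorem absorbent : Absorbent ℝ (T.incl ⁻¹' T.carrier) := by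
  rw [absorbent_iff_inv_smul]
  intro x
  obtain ⟨r, hr, hx⟩ := T.mem_smul_of_mem_span x.2
  filter_upwards [eventually_cobounded_le_norm r] with c hc
  have hc0 : c ≠ 0 := by rintro rfl; simp at hc; linarith
  have h1 : T.incl x ∈ c • T.carrier := by
    have h2 := T.balanced.smul_mono (a := (r : ℂ)) (b := (c : ℂ))
      (by simpa [abs_of_pos hr] using hc)
    exact h2 hx
  rw [Set.mem_preimage, incl_real_smul]
  exact (Set.mem_smul_set_iff_inv_smul_mem₀ hc0 _ _).1 h1

/-- The gauge seminorm of `T` on its linear span. -/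
def seminorm : Seminorm ℂ T.Space :=
  gaugeSeminorm (s := T.incl ⁻¹' T.carrier)
    (fun c hc => by
      rintro _ ⟨x, hx, rfl⟩
      change T.incl (c • x) ∈ T.carrier
      rw [map_smul]
      exact T.balanced c hc (Set.smul_mem_smul_set hx))
    (fun x hx y hy a b ha hb hab => by
      change T.incl (a • x + b • y) ∈ T.carrier
      rw [map_add, incl_real_smul, incl_real_smul]
      exact T.convex hx hy ha hb hab)
    T.absorbent

theorem mem_of_seminorm_lt {x : T.Space} {r : ℝ} (h : T.seminorm x < r) :
    T.incl x ∈ r • T.carrier := by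
  obtain ⟨b, hb0, hbr, y, hy, rfl⟩ := exists_lt_of_gauge_lt T.absorbent h
  change T.incl (b • y) ∈ r • T.carrier
  rw [incl_real_smul]
  exact T.smul_subset hb0.le hbr.le (Set.smul_mem_smul_set hy)

instance : NormedAddCommGroup T.Space :=
  AddGroupNorm.toNormedAddCommGroup
    { toFun := T.seminorm
      map_zero' := map_zero _
      add_le' := map_add_le_add _
      neg' := map_neg_eq_map _
      eq_zero_of_map_eq_zero' := fun x hx => T.incl_injective (by
        rw [map_zero]
        exact T.norming _ fun t ht => T.mem_of_seminorm_lt (hx.trans_lt ht)) }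

theorem norm_eq (x : T.Space) : ‖x‖ = gauge (T.incl ⁻¹' T.carrier) x := rfl

instance : NormedSpace ℂ T.Space where
  norm_smul_le c x := (map_smul_eq_mul T.seminorm c x).le

theorem norm_le_of_mem {x : T.Space} {r : ℝ} (hr : 0 ≤ r) (h : T.incl x ∈ r • T.carrier) :
    ‖x‖ ≤ r := by
  rcases hr.eq_or_lt with rfl | hr
  · rw [Set.zero_smul_set ⟨0, T.zero_mem⟩, Set.mem_zero] at h
    rw [T.incl_injective (h.trans (map_zero _).symm), norm_zero]
  · refine gauge_le_of_mem hr.le ?_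
    rw [Set.mem_smul_set_iff_inv_smul_mem₀ hr.ne'] at h ⊢
    rwa [Set.mem_preimage, incl_real_smul]

/-- The set `T` is the closed unit ball of `V_T`. -/
theorem mem_norm_smul (x : T.Space) : T.incl x ∈ ‖x‖ • T.carrier := by
  rcases (norm_nonneg x).eq_or_lt with h | h
  · rw [← h, Set.zero_smul_set ⟨0, T.zero_mem⟩, Set.mem_zero, norm_eq_zero.1 h.symm, map_zero]
  · rw [Set.mem_smul_set_iff_inv_smul_mem₀ h.ne', ← T.closed]
    simp only [mem_iInter, mem_Ioi]
    intro t ht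
    have h2 : T.incl x ∈ (‖x‖ * t) • T.carrier := T.mem_of_seminorm_lt (by
      change ‖x‖ < _
      nlinarith)
    rw [mul_smul, Set.mem_smul_set_iff_inv_smul_mem₀ h.ne'] at h2
    exact h2

theorem isCircled : IsCircled T.carrier := ⟨T.balanced, T.closed⟩

/-- The inclusion `V_T → V_U` for `T ⊆ U`. -/
def inclusion {T U : Disk V} (h : T.carrier ⊆ U.carrier) : T.Space →L[ℝ] U.Space :=
  LinearMap.mkContinuous
    { toFun := fun x => (⟨T.incl x, Submodule.span_mono h x.2⟩ : Submodule.span ℂ U.carrier)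
      map_add' := fun _ _ => rfl
      map_smul' := fun _ _ => rfl } 1
    (fun x => by
      rw [one_mul]
      exact U.norm_le_of_mem (norm_nonneg _) (Set.smul_set_mono h (T.mem_norm_smul x)))

theorem incl_inclusion {T U : Disk V} (h : T.carrier ⊆ U.carrier) (x : T.Space) :
    U.incl (inclusion h x) = T.incl x := rfl

end Disk

/-- Complete convex bornological vector spaces: addition and scalar multiplication are bounded,
convex hulls of bounded subsets are bounded, and every bounded subset is contained in a complete
bounded disk, that is, a bounded disk `T` for which `V_T` is a Banach space. -/
class IsCompleteConvex (V : Type*) [AddCommGroup V] [Module ℂ V] [Bornology V] : Prop where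
  isBounded_add : ∀ S T : Set V, Bornology.IsBounded S → Bornology.IsBounded T →
    Bornology.IsBounded (S + T)
  isBounded_smul : ∀ (r : ℝ) (S : Set V), Bornology.IsBounded S →
    Bornology.IsBounded (Metric.closedBall (0 : ℂ) r • S)
  isBounded_convexHull : ∀ S : Set V, Bornology.IsBounded S →
    Bornology.IsBounded (convexHull ℝ S)
  exists_complete_disk : ∀ S : Set V, Bornology.IsBounded S →
    ∃ T : Disk V, Bornology.IsBounded T.carrier ∧ S ⊆ T.carrier ∧ CompleteSpace T.Space

/-- A sequence `x` is `T`-convergent to `y`: all `x n` and `y` lie in `T`, and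
`x n - y ∈ ε n • T` for some null sequence `ε` of positive scalars. -/
def ConvergesIn (T : Set V) (x : ℕ → V) (y : V) : Prop :=
  (∀ n, x n ∈ T) ∧ y ∈ T ∧
    ∃ ε : ℕ → ℝ, (∀ n, 0 < ε n) ∧ Tendsto ε atTop (𝓝 0) ∧ ∀ n, x n - y ∈ ε n • T

/-- Locally dense subsets: for every circled bounded `S` there is a circled bounded `T` such that
every point of `S` is the limit of a `T`-convergent sequence with entries in `X ∩ T`. -/
def IsLocallyDense [Bornology V] (X : Set V) : Prop :=
  ∀ S : Set V, Bornology.IsBounded S → IsCircled S →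
    ∃ T : Set V, Bornology.IsBounded T ∧ IsCircled T ∧
      ∀ v ∈ S, ∃ x : ℕ → V, (∀ n, x n ∈ X ∩ T) ∧ ConvergesIn T x v

end Spaces

/-! ### Bornological algebras, spectral radius, isoradial homomorphisms -/

section Algebras

/-- Complete convex bornological algebras (not necessarily unital or commutative): the space is
complete and convex, and the multiplication is bounded. -/
class IsCompleteConvexAlgebra (A : Type*) [NonUnitalRing A] [Module ℂ A] [Bornology A] : Prop
    extends IsCompleteConvex A where
  isBounded_mul : ∀ S T : Set A, Bornology.IsBounded S → Bornology.IsBounded T →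
    Bornology.IsBounded (S * T)

variable {A : Type*} [NonUnitalRing A] [Module ℂ A] [Bornology A]

/-- `setPow S n` is the set `S ^ (n + 1)` of products of `n + 1` elements of `S`. -/
def setPow {A : Type*} [NonUnitalRing A] (S : Set A) : ℕ → Set A
  | 0 => S
  | n + 1 => setPow S n * S

/-- The spectral radius of `S`: the infimum of the `r > 0` for which
`⋃_{n ≥ 1} (r⁻¹ S) ^ n` is bounded, and `∞` if there is no such `r`. -/
def spectralRadius (S : Set A) : ℝ≥0∞ :=
  sInf {ρ | ∃ r : ℝ, 0 < r ∧ Bornology.IsBounded (⋃ n, setPow (r⁻¹ • S) n) ∧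
    ρ = ENNReal.ofReal r}

/-- Every bounded subset has finite spectral radius. -/
def IsLocallyMultiplicative (A : Type*) [NonUnitalRing A] [Module ℂ A] [Bornology A] : Prop :=
  ∀ S : Set A, Bornology.IsBounded S → spectralRadius S < ⊤

/-- Isoradial homomorphisms: bounded homomorphisms between locally multiplicative complete convex
bornological algebras with locally dense range that preserve spectral radii of bounded subsets. -/
structure IsIsoradial {A B : Type*} [NonUnitalRing A] [Module ℂ A] [Bornology A]
    [NonUnitalRing B] [Module ℂ B] [Bornology B] (f : A →ₙₐ[ℂ] B) : Prop where
  source_complete : IsCompleteConvexAlgebra A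
  source_locallyMultiplicative : IsLocallyMultiplicative A
  target_complete : IsCompleteConvexAlgebra B
  target_locallyMultiplicative : IsLocallyMultiplicative B
  bounded : ∀ S : Set A, Bornology.IsBounded S → Bornology.IsBounded (f '' S)
  locallyDense : IsLocallyDense (range f)
  spectralRadius_eq : ∀ S : Set A, Bornology.IsBounded S →
    spectralRadius S = spectralRadius (f '' S)

theorem exists_disk [IsCompleteConvexAlgebra A] {S : Set A} (h : Bornology.IsBounded S) :
    ∃ T : Disk A, Bornology.IsBounded T.carrier ∧ S ⊆ T.carrier := by
  obtain ⟨T, h1, h2, -⟩ := IsCompleteConvex.exists_complete_disk S h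
  exact ⟨T, h1, h2⟩

theorem mul_mem_smul {A : Type*} [NonUnitalRing A] [Module ℂ A] [IsScalarTower ℂ A A]
    [SMulCommClass ℂ A A] {T T' U : Set A} (h : T * T' ⊆ U) {a b : ℝ} {x y : A} (hx : x ∈ a • T)
    (hy : y ∈ b • T') : x * y ∈ (a * b) • U := by
  obtain ⟨t, ht, rfl⟩ := hx
  obtain ⟨t', ht', rfl⟩ := hy
  exact ⟨t * t', h (Set.mul_mem_mul ht ht'), (smul_mul_smul_comm a t b t').symm⟩

end Algebras

/-! ### Continuous functions vanishing at infinity -/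

section Continuous

variable {X A : Type*} [TopologicalSpace X] [NonUnitalRing A] [Module ℂ A] [Bornology A]

/-- Uniformly continuous sets of functions on a compact (metrizable) space `X` with base point
`ξ`, with values in `A`: there are a circled bounded set `T` and a continuity estimator `w` with
`f x - f y ∈ w (x, y) • T` and `f ξ ∈ T` for all functions `f` in the set. As `X` is compact, a
function `w` on `X × X` is a continuity estimator for any metric defining the topology if and only
if it is continuous and vanishes on the diagonal. -/
def IsUniformlyContinuousSet (ξ : X) (S : Set (X → A)) : Prop :=
  ∃ T : Set A, Bornology.IsBounded T ∧ IsCircled T ∧ ∃ w : C(X × X, ℝ≥0), (∀ x, w (x, x) = 0) ∧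
    ∀ f ∈ S, f ξ ∈ T ∧ ∀ x y, f x - f y ∈ (w (x, y) : ℝ) • T

theorem isUniformlyContinuousSet_disk [IsCompleteConvexAlgebra A] {ξ : X} {S : Set (X → A)}
    (h : IsUniformlyContinuousSet ξ S) {B : Set A} (hB : Bornology.IsBounded B) :
    ∃ T : Disk A, Bornology.IsBounded T.carrier ∧ B ⊆ T.carrier ∧
      ∃ w : C(X × X, ℝ≥0), (∀ x, w (x, x) = 0) ∧
        ∀ f ∈ S, f ξ ∈ T.carrier ∧ ∀ x y, f x - f y ∈ (w (x, y) : ℝ) • T.carrier := by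
  obtain ⟨T, hT, -, w, hw, h⟩ := h
  obtain ⟨U, hU, hTU⟩ := exists_disk (hT.union hB)
  exact ⟨U, hU, subset_union_right.trans hTU, w, hw, fun f hf =>
    ⟨hTU (Or.inl (h f hf).1), fun x y =>
      Set.smul_set_mono (subset_union_left.trans hTU) ((h f hf).2 x y)⟩⟩

variable (M A : Type*) [TopologicalSpace M] [NonUnitalRing A] [Module ℂ A] [Bornology A]

/-- The extension of `f : M → A` by `0` at infinity. -/
def extendZero {M A : Type*} [Zero A] (f : M → A) (x : OnePoint M) : A := x.elim 0 f

variable {M A} in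
/-- Bounded subsets of `C₀(M, A)`: uniformly continuous sets of functions on the one-point
compactification of `M` that vanish at infinity. -/
def IsBoundedCZero (S : Set (M → A)) : Prop :=
  IsUniformlyContinuousSet (OnePoint.infty : OnePoint M) (extendZero '' S)

variable {M A}

theorem IsBoundedCZero.subset {S S' : Set (M → A)} (h : IsBoundedCZero S') (hS : S ⊆ S') :
    IsBoundedCZero S := by
  obtain ⟨T, hT, hT', w, hw, h⟩ := h
  exact ⟨T, hT, hT', w, hw, fun f hf => h f (image_mono hS hf)⟩

theorem isBoundedCZero_of_disk {S : Set (M → A)} (T : Disk A) (hT : Bornology.IsBounded T.carrier)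
    (w : C(OnePoint M × OnePoint M, ℝ≥0)) (hw : ∀ x, w (x, x) = 0)
    (h : ∀ f ∈ S, ∀ x y, extendZero f x - extendZero f y ∈ (w (x, y) : ℝ) • T.carrier) :
    IsBoundedCZero S := by
  refine ⟨T.carrier, hT, T.isCircled, w, hw, ?_⟩
  rintro _ ⟨f, hf, rfl⟩
  exact ⟨T.zero_mem, h f hf⟩

variable [IsCompleteConvexAlgebra A]

theorem IsBoundedCZero.disk {S : Set (M → A)} (h : IsBoundedCZero S) {B : Set A}
    (hB : Bornology.IsBounded B) :
    ∃ T : Disk A, Bornology.IsBounded T.carrier ∧ B ⊆ T.carrier ∧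
      ∃ w : C(OnePoint M × OnePoint M, ℝ≥0), (∀ x, w (x, x) = 0) ∧
        ∀ f ∈ S, ∀ x y, extendZero f x - extendZero f y ∈ (w (x, y) : ℝ) • T.carrier := by
  obtain ⟨T, hT, hBT, w, hw, h⟩ := isUniformlyContinuousSet_disk h hB
  exact ⟨T, hT, hBT, w, hw, fun f hf => (h _ (mem_image_of_mem _ hf)).2⟩

theorem IsBoundedCZero.union {S S' : Set (M → A)} (h : IsBoundedCZero S)
    (h' : IsBoundedCZero S') : IsBoundedCZero (S ∪ S') := by
  obtain ⟨T, hT, -, w, hw, h⟩ := h.disk (Bornology.isBounded_empty)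
  obtain ⟨T', hT', hTT', w', hw', h'⟩ := h'.disk hT
  refine isBoundedCZero_of_disk T' hT' (w + w') (fun x => by simp [hw, hw']) ?_
  rintro f (hf | hf) x y
  · exact T'.smul_subset (by simp) (by simp) (Set.smul_set_mono hTT' (h f hf x y))
  · exact T'.smul_subset (by simp) (by simp) (h' f hf x y)

theorem IsBoundedCZero.zero : IsBoundedCZero {(0 : M → A)} := by
  obtain ⟨T, hT, -⟩ := exists_disk (A := A) Bornology.isBounded_empty
  refine isBoundedCZero_of_disk T hT 0 (fun x => rfl) ?_
  rintro _ rfl x y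
  have h : ∀ x : OnePoint M, extendZero (0 : M → A) x = 0 := fun x => by
    induction x using OnePoint.rec <;> rfl
  rw [h, h, sub_zero]
  exact ⟨0, T.zero_mem, smul_zero _⟩

theorem IsBoundedCZero.add {f g : M → A} (hf : IsBoundedCZero {f}) (hg : IsBoundedCZero {g}) :
    IsBoundedCZero {f + g} := by
  obtain ⟨T, hT, -, w, hw, h⟩ := hf.disk (Bornology.isBounded_empty)
  obtain ⟨T', hT', hTT', w', hw', h'⟩ := hg.disk hT
  refine isBoundedCZero_of_disk T' hT' (w + w') (fun x => by simp [hw, hw']) ?_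
  rintro _ rfl x y
  have e : ∀ x : OnePoint M, extendZero (f + g) x = extendZero f x + extendZero g x := fun x => by
    induction x using OnePoint.rec
    · exact (add_zero _).symm
    · rfl
  rw [e, e, add_sub_add_comm]
  exact T'.add_mem (by simp) (by simp) (Set.smul_set_mono hTT' (h f rfl x y)) (h' g rfl x y)

theorem IsBoundedCZero.smul (c : ℂ) {f : M → A} (hf : IsBoundedCZero {f}) :
    IsBoundedCZero {c • f} := by
  obtain ⟨T, hT, -, w, hw, h⟩ := hf.disk (Bornology.isBounded_empty)
  refine isBoundedCZero_of_disk T hT (ContinuousMap.const _ ‖c‖₊ * w) (fun x => by simp [hw]) ?_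
  rintro _ rfl x y
  have e : ∀ x : OnePoint M, extendZero (c • f) x = c • extendZero f x := fun x => by
    induction x using OnePoint.rec
    · exact (smul_zero _).symm
    · rfl
  rw [e, e, ← smul_sub]
  exact T.complex_smul_mem c (h f rfl x y)

variable [IsScalarTower ℂ A A] [SMulCommClass ℂ A A]

theorem IsBoundedCZero.mul {f g : M → A} (hf : IsBoundedCZero {f}) (hg : IsBoundedCZero {g}) :
    IsBoundedCZero {f * g} := by
  obtain ⟨T, hT, -, w, hw, h⟩ := hf.disk (Bornology.isBounded_empty)
  obtain ⟨T', hT', -, w', hw', h'⟩ := hg.disk (Bornology.isBounded_empty)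
  obtain ⟨U, hU, hTU⟩ := exists_disk (IsCompleteConvexAlgebra.isBounded_mul _ _ hT hT')
  obtain ⟨c, hc⟩ := (isCompact_range w.continuous).bddAbove
  obtain ⟨c', hc'⟩ := (isCompact_range w'.continuous).bddAbove
  refine isBoundedCZero_of_disk U hU
    (w * ContinuousMap.const _ c' + ContinuousMap.const _ c * w') (fun x => by simp [hw, hw']) ?_
  rintro _ rfl x y
  have e : ∀ x : OnePoint M, extendZero (f * g) x = extendZero f x * extendZero g x := fun x => by
    induction x using OnePoint.rec
    · exact (mul_zero _).symm
    · rfl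
  have hfy : extendZero f y ∈ (c : ℝ) • T.carrier := by
    have := h f rfl y OnePoint.infty
    rw [show extendZero f OnePoint.infty = 0 from rfl, sub_zero] at this
    exact T.smul_subset (by simp) (by exact_mod_cast hc (mem_range_self _)) this
  have hgx : extendZero g x ∈ (c' : ℝ) • T'.carrier := by
    have := h' g rfl x OnePoint.infty
    rw [show extendZero g OnePoint.infty = 0 from rfl, sub_zero] at this
    exact T'.smul_subset (by simp) (by exact_mod_cast hc' (mem_range_self _)) this
  rw [e, e, show extendZero f x * extendZero g x - extendZero f y * extendZero g y =
    (extendZero f x - extendZero f y) * extendZero g x +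
      extendZero f y * (extendZero g x - extendZero g y) by
    rw [sub_mul, mul_sub]; abel]
  rw [show (((w * ContinuousMap.const _ c' + ContinuousMap.const _ c * w' :
    C(OnePoint M × OnePoint M, ℝ≥0)) (x, y) : ℝ≥0) : ℝ) =
    w (x, y) * c' + c * w' (x, y) by simp]
  exact U.add_mem (by positivity) (by positivity) (mul_mem_smul hTU (h f rfl x y) hgx)
    (mul_mem_smul hTU hfy (h' g rfl x y))

variable (M A)

/-- The subalgebra of functions `f : M → A` whose extension by `0` to the one-point
compactification of `M` is continuous. -/
def cZeroSubalgebra : NonUnitalSubalgebra ℂ (M → A) where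
  carrier := {f | IsBoundedCZero {f}}
  zero_mem' := .zero
  add_mem' hf hg := .add hf hg
  mul_mem' hf hg := .mul hf hg
  smul_mem' c _ hf := .smul c hf

/-- The algebra `C₀(M, A)`. -/
def CZero : Type _ := cZeroSubalgebra M A

instance : NonUnitalRing (CZero M A) := inferInstanceAs (NonUnitalRing (cZeroSubalgebra M A))

instance : Module ℂ (CZero M A) := inferInstanceAs (Module ℂ (cZeroSubalgebra M A))

instance : CoeFun (CZero M A) (fun _ => M → A) := ⟨Subtype.val⟩

/-- The bornology of uniform continuity on `C₀(M, A)`. -/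
instance : Bornology (CZero M A) :=
  Bornology.ofBounded {S | IsBoundedCZero ((fun f : CZero M A => (f : M → A)) '' S)}
    (IsBoundedCZero.zero.subset (by simp))
    (fun _ h _ hS => IsBoundedCZero.subset h (image_mono hS))
    (fun S h S' h' => by
      rw [mem_ofPred_eq, image_union]
      exact h.union h')
    (fun f => by
      rw [mem_ofPred_eq, image_singleton]
      exact f.2)

theorem CZero.isBounded_iff (S : Set (CZero M A)) : Bornology.IsBounded S ↔
    IsBoundedCZero ((fun f : CZero M A => (f : M → A)) '' S) :=
  Bornology.isBounded_ofBounded_iff _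

end Continuous

/-! ### Smooth functions with compact support -/

section Smooth

variable {E : Type*} [NormedAddCommGroup E] [NormedSpace ℝ E]
  {M : Type*} [TopologicalSpace M] [ChartedSpace E M]

variable (E) in
/-- Bounded subsets of the space of smooth functions on `M` with values in a normed space `F`:
all derivatives in charts are uniformly bounded on compact subsets of the chart domains. -/
def IsBoundedSmooth {F : Type*} [NormedAddCommGroup F] [NormedSpace ℝ F] (G : Set (M → F)) : Prop :=
  (∀ g ∈ G, ContMDiff 𝓘(ℝ, E) 𝓘(ℝ, F) ∞ g) ∧
    ∀ e ∈ atlas E M, ∀ L : Set M, IsCompact L → L ⊆ e.source → ∀ k : ℕ, ∃ C : ℝ,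
      ∀ g ∈ G, ∀ x ∈ L, ‖iteratedFDeriv ℝ k (g ∘ e.symm) (e x)‖ ≤ C

theorem contDiffAt_of_mem_atlas [IsManifold 𝓘(ℝ, E) ∞ M] {F : Type*} [NormedAddCommGroup F]
    [NormedSpace ℝ F] {g : M → F} (hg : ContMDiff 𝓘(ℝ, E) 𝓘(ℝ, F) ∞ g)
    {e : OpenPartialHomeomorph M E} (he : e ∈ atlas E M) {y : E} (hy : y ∈ e.target) :
    ContDiffAt ℝ ∞ (g ∘ e.symm) y := by
  have h := contMDiffAt_symm_of_mem_maximalAtlas (I := 𝓘(ℝ, E)) (n := ∞)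
    (IsManifold.subset_maximalAtlas he) hy
  exact contMDiffAt_iff_contDiffAt.1 ((hg (e.symm y)).comp y h)

theorem isBoundedSmooth_singleton [IsManifold 𝓘(ℝ, E) ∞ M] {F : Type*} [NormedAddCommGroup F]
    [NormedSpace ℝ F] {g : M → F} (hg : ContMDiff 𝓘(ℝ, E) 𝓘(ℝ, F) ∞ g) :
    IsBoundedSmooth E {g} := by
  refine ⟨by simpa using hg, fun e he L hL hLe k => ?_⟩
  have h : ContinuousOn (fun x => iteratedFDeriv ℝ k (g ∘ e.symm) (e x)) L := by
    intro x hx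
    have h1 : ContinuousAt (iteratedFDeriv ℝ k (g ∘ e.symm)) (e x) :=
      ((contDiffAt_of_mem_atlas hg he (e.map_source (hLe hx))).iteratedFDeriv_right
        (m := 0) (by simpa using (by exact_mod_cast le_top))).continuousAt
    exact (ContinuousAt.comp (f := e) h1 (e.continuousAt (hLe hx))).continuousWithinAt
  obtain ⟨C, hC⟩ := hL.exists_bound_of_continuousOn h
  exact ⟨C, by simpa using hC⟩

theorem IsBoundedSmooth.comp [IsManifold 𝓘(ℝ, E) ∞ M] {F F' : Type*} [NormedAddCommGroup F]
    [NormedSpace ℝ F] [NormedAddCommGroup F'] [NormedSpace ℝ F'] {G : Set (M → F)}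
    (h : IsBoundedSmooth E G) (f : F →L[ℝ] F') : IsBoundedSmooth E ((fun g => f ∘ g) '' G) := by
  refine ⟨?_, fun e he L hL hLe k => ?_⟩
  · rintro _ ⟨g, hg, rfl⟩
    exact f.contMDiff.comp (h.1 g hg)
  · obtain ⟨C, hC⟩ := h.2 e he L hL hLe k
    refine ⟨‖f‖ * C, ?_⟩
    rintro _ ⟨g, hg, rfl⟩ x hx
    refine (f.norm_iteratedFDeriv_comp_left (n := k)
      (contDiffAt_of_mem_atlas (h.1 g hg) he (e.map_source (hLe hx)))
      (by exact_mod_cast le_top)).trans ?_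
    exact mul_le_mul_of_nonneg_left (hC g hg x hx) (norm_nonneg _)

theorem IsBoundedSmooth.union {F : Type*} [NormedAddCommGroup F]
    [NormedSpace ℝ F] {G G' : Set (M → F)}
    (h : IsBoundedSmooth E G) (h' : IsBoundedSmooth E G') : IsBoundedSmooth E (G ∪ G') := by
  refine ⟨fun g hg => hg.elim (h.1 g) (h'.1 g), fun e he L hL hLe k => ?_⟩
  obtain ⟨C, hC⟩ := h.2 e he L hL hLe k
  obtain ⟨C', hC'⟩ := h'.2 e he L hL hLe k
  refine ⟨max C C', ?_⟩
  rintro g (hg | hg) x hx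
  · exact (hC g hg x hx).trans (le_max_left _ _)
  · exact (hC' g hg x hx).trans (le_max_right _ _)

variable {A : Type*} [NonUnitalRing A] [Module ℂ A] [Bornology A]

variable (E) in
/-- A smooth function `M → A` with compact support: it is a smooth function into the normed space
`A_T` for some bounded disk `T`, and vanishes outside some compact subset. -/
def IsSmoothCompact (f : M → A) : Prop :=
  ∃ K : Set M, IsCompact K ∧ ∃ T : Disk A, Bornology.IsBounded T.carrier ∧
    ∃ g : M → T.Space, ContMDiff 𝓘(ℝ, E) 𝓘(ℝ, T.Space) ∞ g ∧ (∀ x, T.incl (g x) = f x) ∧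
      ∀ x ∉ K, f x = 0

variable (E) in
/-- Bounded subsets of `D(M, A)`: for some compact `K` and some bounded disk `T`, all functions in
the set are supported in `K`, and the set comes from a bounded set of smooth functions into the
normed space `A_T`. -/
def IsBoundedSmoothCompact (S : Set (M → A)) : Prop :=
  ∃ K : Set M, IsCompact K ∧ ∃ T : Disk A, Bornology.IsBounded T.carrier ∧
    ∃ G : Set (M → T.Space), IsBoundedSmooth E G ∧ S = (fun g x => T.incl (g x)) '' G ∧
      ∀ f ∈ S, ∀ x ∉ K, f x = 0

theorem IsBoundedSmoothCompact.subset {S S' : Set (M → A)} (h : IsBoundedSmoothCompact E S')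
    (hS : S ⊆ S') : IsBoundedSmoothCompact E S := by
  obtain ⟨K, hK, T, hT, G, hG, rfl, h⟩ := h
  refine ⟨K, hK, T, hT, G ∩ (fun g x => T.incl (g x)) ⁻¹' S,
    ⟨fun g hg => hG.1 g hg.1, fun e he L hL hLe k => ?_⟩, ?_, fun f hf => h f (hS hf)⟩
  · obtain ⟨C, hC⟩ := hG.2 e he L hL hLe k
    exact ⟨C, fun g hg => hC g hg.1⟩
  · rw [image_inter_preimage, inter_eq_right.2 hS]

theorem isBoundedSmoothCompact_singleton [IsManifold 𝓘(ℝ, E) ∞ M] {f : M → A}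
    (h : IsSmoothCompact E f) : IsBoundedSmoothCompact E {f} := by
  obtain ⟨K, hK, T, hT, g, hg, hgf, hf⟩ := h
  refine ⟨K, hK, T, hT, {g}, isBoundedSmooth_singleton hg, ?_, by simpa using hf⟩
  rw [image_singleton]
  exact congrArg _ (funext fun x => (hgf x).symm)

theorem IsSmoothCompact.smul (c : ℂ) {f : M → A} (h : IsSmoothCompact E f) :
    IsSmoothCompact E (c • f) := by
  obtain ⟨K, hK, T, hT, g, hg, hgf, hf⟩ := h
  exact ⟨K, hK, T, hT, fun x => c • g x,
    ((ContinuousLinearMap.restrictScalars ℝ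
      (c • ContinuousLinearMap.id ℂ T.Space)).contMDiff).comp hg,
    fun x => by rw [map_smul, hgf]; rfl, fun x hx => by rw [Pi.smul_apply, hf x hx, smul_zero]⟩

variable [IsCompleteConvexAlgebra A]

theorem IsBoundedSmoothCompact.union [IsManifold 𝓘(ℝ, E) ∞ M] {S S' : Set (M → A)}
    (h : IsBoundedSmoothCompact E S) (h' : IsBoundedSmoothCompact E S') :
    IsBoundedSmoothCompact E (S ∪ S') := by
  obtain ⟨K, hK, T, hT, G, hG, rfl, h⟩ := h
  obtain ⟨K', hK', T', hT', G', hG', rfl, h'⟩ := h'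
  obtain ⟨U, hU, hTU⟩ := exists_disk (hT.union hT')
  refine ⟨K ∪ K', hK.union hK', U, hU, _,
    (hG.comp (Disk.inclusion (subset_union_left.trans hTU))).union
      (hG'.comp (Disk.inclusion (subset_union_right.trans hTU))), ?_, ?_⟩
  · rw [image_union, image_image, image_image]
    rfl
  · rintro f (hf | hf) x hx
    · exact h f hf x fun hx' => hx (Or.inl hx')
    · exact h' f hf x fun hx' => hx (Or.inr hx')

theorem IsSmoothCompact.zero : IsSmoothCompact E (0 : M → A) := by
  obtain ⟨T, hT, -⟩ := exists_disk (A := A) Bornology.isBounded_empty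
  exact ⟨∅, isCompact_empty, T, hT, fun _ => 0, contMDiff_const, fun x => map_zero _,
    fun x _ => rfl⟩

theorem IsSmoothCompact.add {f f' : M → A} (h : IsSmoothCompact E f) (h' : IsSmoothCompact E f') :
    IsSmoothCompact E (f + f') := by
  obtain ⟨K, hK, T, hT, g, hg, hgf, hf⟩ := h
  obtain ⟨K', hK', T', hT', g', hg', hgf', hf'⟩ := h'
  obtain ⟨U, hU, hTU⟩ := exists_disk (hT.union hT')
  refine ⟨K ∪ K', hK.union hK', U, hU,
    fun x => Disk.inclusion (subset_union_left.trans hTU) (g x) +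
      Disk.inclusion (subset_union_right.trans hTU) (g' x),
    ((Disk.inclusion _).contMDiff.comp hg).add ((Disk.inclusion _).contMDiff.comp hg'),
    fun x => ?_, fun x hx => ?_⟩
  · rw [map_add, Disk.incl_inclusion, Disk.incl_inclusion, hgf, hgf']
    rfl
  · rw [Pi.add_apply, hf x fun hx' => hx (Or.inl hx'), hf' x fun hx' => hx (Or.inr hx'), add_zero]

variable [IsScalarTower ℂ A A] [SMulCommClass ℂ A A]

/-- The multiplication `A_T × A_T' → A_U` for `T * T' ⊆ U`. -/
def Disk.mulMap {A : Type*} [NonUnitalRing A] [Module ℂ A] [IsScalarTower ℂ A A]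
    [SMulCommClass ℂ A A] {T T' U : Disk A} (h : T.carrier * T'.carrier ⊆ U.carrier) :
    T.Space →L[ℝ] T'.Space →L[ℝ] U.Space :=
  have hmem (x : T.Space) (y : T'.Space) :
      T.incl x * T'.incl y ∈ Submodule.span ℂ U.carrier := by
    obtain ⟨u, hu, hu'⟩ := mul_mem_smul h (T.mem_norm_smul x) (T'.mem_norm_smul y)
    rw [← hu']
    exact Submodule.smul_mem _ ((‖x‖ * ‖y‖ : ℝ) : ℂ) (Submodule.subset_span hu)
  LinearMap.mkContinuous₂
    (LinearMap.mk₂ ℝ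
      (fun x y => ((⟨T.incl x * T'.incl y, hmem x y⟩ : Submodule.span ℂ U.carrier) : U.Space))
      (fun x x' y => U.incl_injective (add_mul (T.incl x) (T.incl x') (T'.incl y)))
      (fun c x y => U.incl_injective (smul_mul_assoc (c : ℂ) (T.incl x) (T'.incl y)))
      (fun x y y' => U.incl_injective (mul_add (T.incl x) (T'.incl y) (T'.incl y')))
      (fun c x y => U.incl_injective (mul_smul_comm (c : ℂ) (T.incl x) (T'.incl y)))) 1
    (fun x y => by
      rw [one_mul]
      exact U.norm_le_of_mem (by positivity)
        (mul_mem_smul h (T.mem_norm_smul x) (T'.mem_norm_smul y)))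

theorem Disk.incl_mulMap {A : Type*} [NonUnitalRing A] [Module ℂ A] [IsScalarTower ℂ A A]
    [SMulCommClass ℂ A A] {T T' U : Disk A} (h : T.carrier * T'.carrier ⊆ U.carrier)
    (x : T.Space) (y : T'.Space) : U.incl (Disk.mulMap h x y) = T.incl x * T'.incl y := rfl

theorem IsSmoothCompact.mul {f f' : M → A} (h : IsSmoothCompact E f) (h' : IsSmoothCompact E f') :
    IsSmoothCompact E (f * f') := by
  obtain ⟨K, hK, T, hT, g, hg, hgf, hf⟩ := h
  obtain ⟨K', hK', T', hT', g', hg', hgf', hf'⟩ := h'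
  obtain ⟨U, hU, hTU⟩ := exists_disk (IsCompleteConvexAlgebra.isBounded_mul _ _ hT hT')
  refine ⟨K, hK, U, hU, fun x => Disk.mulMap hTU (g x) (g' x),
    ((Disk.mulMap hTU).contMDiff.comp hg).clm_apply hg', fun x => ?_, fun x hx => ?_⟩
  · rw [Disk.incl_mulMap, hgf, hgf']
    rfl
  · rw [Pi.mul_apply, hf x hx, zero_mul]

variable (E M A)

/-- The subalgebra of smooth functions `M → A` with compact support. -/
def smoothCompactSubalgebra : NonUnitalSubalgebra ℂ (M → A) where
  carrier := {f | IsSmoothCompact E f}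
  zero_mem' := .zero
  add_mem' hf hg := .add hf hg
  mul_mem' hf hg := .mul hf hg
  smul_mem' c _ hf := .smul c hf

/-- The algebra `D(M, A)`. -/
def SmoothCompact : Type _ := smoothCompactSubalgebra E M A

instance : NonUnitalRing (SmoothCompact E M A) :=
  inferInstanceAs (NonUnitalRing (smoothCompactSubalgebra E M A))

instance : Module ℂ (SmoothCompact E M A) :=
  inferInstanceAs (Module ℂ (smoothCompactSubalgebra E M A))

instance : CoeFun (SmoothCompact E M A) (fun _ => M → A) := ⟨Subtype.val⟩

variable [IsManifold 𝓘(ℝ, E) ∞ M]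

/-- The bornology of `D(M, A)`, the direct union of the spaces of smooth functions supported in a
compact subset with values in `A_T` for a bounded disk `T`. -/
instance : Bornology (SmoothCompact E M A) :=
  Bornology.ofBounded
    {S | IsBoundedSmoothCompact E ((fun f : SmoothCompact E M A => (f : M → A)) '' S)}
    ((isBoundedSmoothCompact_singleton (IsSmoothCompact.zero (A := A))).subset (by simp))
    (fun _ h _ hS => IsBoundedSmoothCompact.subset h (image_mono hS))
    (fun S h S' h' => by
      rw [mem_ofPred_eq, image_union]
      exact h.union h')
    (fun f => by
      rw [mem_ofPred_eq, image_singleton]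
      exact isBoundedSmoothCompact_singleton f.2)

theorem SmoothCompact.isBounded_iff (S : Set (SmoothCompact E M A)) : Bornology.IsBounded S ↔
    IsBoundedSmoothCompact E ((fun f : SmoothCompact E M A => (f : M → A)) '' S) :=
  Bornology.isBounded_ofBounded_iff _

end Smooth

end BornAlg
end

/-! The proof rests on a perturbation principle, `IsLocallyMultiplicative.exists_perturbation`. If
`ρ(S) < r` and `T` is bounded, then for small `δ` all of `S + δT` lies in `qV` with `q < r` and `V`
a bounded disk closed under multiplication. To see this, normalise `S` so that its powers stay in a
bounded set `U`. A word in `S` and `T` then splits into blocks with one letter from `T` each. These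
blocks form a bounded set, and local multiplicativity makes its powers bounded after rescaling.

On the compact space `M⁺`, a continuity estimator says exactly that nearby values differ by small
multiples of a bounded set. Hence `x ↦ ρ(S_x)` is upper semicontinuous on `M⁺`. Its value at
infinity is `0`, so upper semicontinuity there is decay at infinity, and compactness yields a
maximum.

For the formula for `ρ(S; B)`, evaluation homomorphisms give one inequality. For the other, scale so
that `ρ(S_x) < 1` for all `x`. Finitely many neighbourhoods cover `M⁺`, so one multiplicatively
closed disk `V` and one power of `S` exist such that all values of that power lie in `V/2`
(`IsLocallyMultiplicative.exists_setPow_subset`). This smallness beats the Leibniz rule. In `C₀`,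
the functions with values in `V/2` and estimator `b·w` are closed under products, because `b/2 + b/2
= b`. In `D`, the weighted jet norms `∑ λ^j/j! ‖D^j f‖` are submultiplicative, and for small `λ`
they are at most `1` on that power of `S`. So the powers of a power of `S` are bounded, and
therefore so are all powers of `S`.

Both algebras thus have the same formula for the spectral radius, which is the equality of radii
required for isoradiality. Local density comes from smooth partitions of unity
(`exists_smooth_approximation`). The approximants converge uniformly and share an estimator, and the
geometric mean of these two bounds gives bornological convergence. -/

noncomputable section

namespace BornAlg

/-! ### Disks, hulls and a criterion for completeness -/

section Spaces

variable {V : Type*} [AddCommGroup V] [Module ℂ V]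

theorem mem_real_smul_iff {Y : Set V} {t : ℝ} (ht : t ≠ 0) {x : V} :
    x ∈ t • Y ↔ t⁻¹ • x ∈ Y :=
  Set.mem_smul_set_iff_inv_smul_mem₀ ht _ _

theorem map_real_smul {W : Type*} [AddCommGroup W] [Module ℂ W] (f : V →ₗ[ℂ] W) (r : ℝ) (x : V) :
    f (r • x) = r • f x :=
  f.map_smul (r : ℂ) x

theorem _root_.Balanced.real_smul_mem {Y : Set V} (hY : Balanced ℂ Y) {t : ℝ} (ht0 : 0 ≤ t)
    (ht : t ≤ 1) {x : V} (hx : x ∈ Y) : t • x ∈ Y :=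
  hY (t : ℂ) (by simpa [abs_of_nonneg ht0] using ht) (Set.smul_mem_smul_set hx)

theorem _root_.Balanced.iInter_smul_eq {Y : Set V} (hY : Balanced ℂ Y)
    (h : ∀ x, (∀ t : ℝ, 1 < t → x ∈ t • Y) → x ∈ Y) : ⋂ t ∈ Ioi (1 : ℝ), t • Y = Y := by
  refine Subset.antisymm (fun x hx => h x fun t ht => ?_) fun x hx => ?_
  · exact mem_iInter₂.1 hx t ht
  · refine mem_iInter₂.2 fun t ht => ?_
    have ht0 : 0 < t := one_pos.trans ht
    rw [mem_real_smul_iff ht0.ne']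
    exact hY.real_smul_mem (by positivity) (inv_le_one_of_one_le₀ (le_of_lt ht)) hx

/-- Nonempty absolutely convex sets `Y` with `⋂_{t > 1} t Y ⊆ Y`. -/
structure IsClosedAbsConvex (Y : Set V) : Prop where
  zero_mem : (0 : V) ∈ Y
  balanced : Balanced ℂ Y
  convex : Convex ℝ Y
  closed : ∀ x, (∀ t : ℝ, 1 < t → x ∈ t • Y) → x ∈ Y

theorem Disk.isClosedAbsConvex (T : Disk V) : IsClosedAbsConvex T.carrier where
  zero_mem := T.zero_mem
  balanced := T.balanced
  convex := T.convex
  closed x hx := by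
    rw [← T.closed]
    exact mem_iInter₂.2 hx

/-- The smallest closed absolutely convex set that contains `X`. -/
def diskHull (X : Set V) : Set V := ⋂₀ {Y | X ⊆ Y ∧ IsClosedAbsConvex Y}

theorem subset_diskHull (X : Set V) : X ⊆ diskHull X := subset_sInter fun _ h => h.1

theorem diskHull_subset {X Y : Set V} (h : X ⊆ Y) (hY : IsClosedAbsConvex Y) : diskHull X ⊆ Y :=
  sInter_subset_of_mem ⟨h, hY⟩

theorem isClosedAbsConvex_diskHull (X : Set V) : IsClosedAbsConvex (diskHull X) where
  zero_mem := mem_sInter.2 fun _ h => h.2.zero_mem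
  balanced := by
    rintro c hc _ ⟨x, hx, rfl⟩
    exact mem_sInter.2 fun Y h => h.2.balanced c hc (Set.smul_mem_smul_set (mem_sInter.1 hx Y h))
  convex := convex_sInter fun _ h => h.2.convex
  closed x hx := mem_sInter.2 fun Y h => h.2.closed x fun t ht =>
    Set.smul_set_mono (sInter_subset_of_mem h) (hx t ht)

/-- A closed absolutely convex subset of a disk, as a disk. -/
def Disk.ofSubset {Y : Set V} (hY : IsClosedAbsConvex Y) (T : Disk V) (h : Y ⊆ T.carrier) :
    Disk V where
  carrier := Y
  zero_mem := hY.zero_mem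
  balanced := hY.balanced
  convex := hY.convex
  closed := hY.balanced.iInter_smul_eq hY.closed
  norming x hx := T.norming x fun t ht => Set.smul_set_mono h (hx t ht)

section Seminorms

variable {P I : Type*} [AddCommGroup P] [Module ℂ P] (j : P →ₗ[ℂ] V)
  (hj : Function.Injective j) (p : I → Seminorm ℂ P) (C : I → ℝ)

theorem seminorm_real_smul (q : Seminorm ℂ P) {r : ℝ} (hr : 0 ≤ r) (x : P) :
    q (r • x) = r * q x := by
  have h := map_smul_eq_mul q (r : ℂ) x
  rwa [Complex.norm_real, Real.norm_of_nonneg hr] at h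

theorem mem_smul_image_seminorm_le (hj : Function.Injective j) {r : ℝ} (hr : 0 < r) {x : P} :
    j x ∈ r • (j '' {x | ∀ i, p i x ≤ C i}) ↔ ∀ i, p i x ≤ r * C i := by
  rw [mem_real_smul_iff hr.ne', ← map_real_smul, hj.mem_set_image]
  refine forall_congr' fun i => ?_
  rw [seminorm_real_smul _ (inv_pos.2 hr).le, inv_mul_le_iff₀ hr]

/-- The disk of all `j x` with `p i x ≤ C i` for all `i`. -/
def Disk.ofSeminorms (hC : ∀ i, 0 ≤ C i) (hp : ∀ x, (∀ i, p i x = 0) → x = 0) : Disk V where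
  carrier := j '' {x | ∀ i, p i x ≤ C i}
  zero_mem := ⟨0, fun i => by simpa using hC i, map_zero j⟩
  balanced := by
    rintro c hc _ ⟨_, ⟨x, hx, rfl⟩, rfl⟩
    refine ⟨c • x, fun i => ?_, map_smul j c x⟩
    rw [map_smul_eq_mul]
    exact (mul_le_of_le_one_left (apply_nonneg _ _) hc).trans (hx i)
  convex := by
    rintro _ ⟨x, hx, rfl⟩ _ ⟨y, hy, rfl⟩ a b ha hb hab
    refine ⟨a • x + b • y, fun i => ?_, by rw [map_add, map_real_smul, map_real_smul]⟩
    refine (map_add_le_add _ _ _).trans ?_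
    rw [seminorm_real_smul _ ha, seminorm_real_smul _ hb]
    calc a * p i x + b * p i y ≤ a * C i + b * C i :=
          add_le_add (mul_le_mul_of_nonneg_left (hx i) ha) (mul_le_mul_of_nonneg_left (hy i) hb)
      _ = C i := by rw [← add_mul, hab, one_mul]
  closed := by
    refine Balanced.iInter_smul_eq ?_ fun v hv => ?_
    · rintro c hc _ ⟨_, ⟨x, hx, rfl⟩, rfl⟩
      refine ⟨c • x, fun i => ?_, map_smul j c x⟩
      rw [map_smul_eq_mul]
      exact (mul_le_of_le_one_left (apply_nonneg _ _) hc).trans (hx i)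
    · obtain ⟨_, ⟨x, -, rfl⟩, hxv⟩ := hv 2 one_lt_two
      simp only [← map_real_smul] at hxv
      subst hxv
      refine mem_image_of_mem _ fun i => ?_
      refine le_of_forall_gt_imp_ge_of_dense fun a ha => ?_
      -- The scaling factor `a / C i` needs `C i ≠ 0`. If `C i = 0`, the factor `2` alone already
      -- forces `p i x ≤ 0`.
      rcases (hC i).eq_or_lt with h0 | h0
      · have := (mem_smul_image_seminorm_le j p C hj two_pos).1 (hv 2 one_lt_two) i
        rw [← h0, mul_zero] at this
        exact this.trans (h0 ▸ ha.le)
      · have := (mem_smul_image_seminorm_le j p C hj (div_pos (h0.trans ha) h0)).1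
          (hv (a / C i) ((one_lt_div h0).2 ha)) i
        rwa [div_mul_cancel₀ _ h0.ne'] at this
  norming := by
    intro v hv
    obtain ⟨_, ⟨x, -, rfl⟩, rfl⟩ := hv 1 one_pos
    simp only [one_smul] at hv ⊢
    rw [hp x fun i => ?_, map_zero]
    refine le_antisymm (le_of_forall_gt_imp_ge_of_dense fun a ha => ?_) (apply_nonneg _ _)
    have h := fun t ht => (mem_smul_image_seminorm_le j p C hj (r := t) ht).1 (hv t ht) i
    -- The summand `1` keeps the denominator positive when `C i = 0`.
    have h1 : 0 < C i + 1 := by linarith [hC i]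
    refine (h (a / (C i + 1)) (by positivity)).trans ?_
    rw [div_mul_eq_mul_div, div_le_iff₀ h1]
    nlinarith [hC i]

/-- Only sequences with geometrically small differences need a limit, and the gauge of the disk
turns this into the same decay for all seminorms at once. In the applications the limit is a
pointwise limit of functions, and the bounds on differences pass to it. -/
theorem Disk.completeSpace_ofSeminorms (hC : ∀ i, 0 ≤ C i) (hp : ∀ x, (∀ i, p i x = 0) → x = 0)
    (hlim : ∀ x : ℕ → P, (∀ n m, n ≤ m → ∀ i, p i (x n - x m) ≤ (1 / 2) ^ n * C i) →
      ∃ y, ∀ n i, p i (x n - y) ≤ (1 / 2) ^ n * C i) :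
    CompleteSpace (Disk.ofSeminorms j hj p C hC hp).Space := by
  set D := Disk.ofSeminorms j hj p C hC hp with hD
  refine Metric.complete_of_convergent_controlled_sequences (fun n => (1 / 2) ^ n)
    (fun n => by positivity) fun u hu => ?_
  have hrange : ∀ v : D.Space, ∃ x : P, j x = D.incl v := fun v => by
    have h : Submodule.span ℂ D.carrier ≤ LinearMap.range j := by
      rw [Submodule.span_le]
      rintro _ ⟨x, -, rfl⟩
      exact ⟨x, rfl⟩
    exact h v.2
  choose x hx using fun n => hrange (u n)
  obtain ⟨y, hy⟩ := hlim x fun n m hnm => by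
    refine (mem_smul_image_seminorm_le j p C hj (by positivity)).1 ?_
    rw [map_sub, hx, hx, ← map_sub]
    refine D.smul_subset (norm_nonneg _) ?_ (D.mem_norm_smul _)
    rw [← dist_eq_norm]
    exact (hu n n m le_rfl hnm).le
  have hmem : ∀ n, j (x n - y) ∈ ((1 / 2 : ℝ) ^ n) • D.carrier := fun n =>
    (mem_smul_image_seminorm_le j p C hj (by positivity)).2 (hy n)
  -- The bound for `n = 0` puts `x 0 - y` in the disk itself, so the limit does not leave its span.
  have hspan : j y ∈ Submodule.span ℂ D.carrier := by
    have h0 := hmem 0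
    rw [pow_zero, one_smul, map_sub] at h0
    have h1 := Submodule.sub_mem _ (u 0).2 (Submodule.subset_span h0)
    have h2 : (u 0).1 = j (x 0) := (hx 0).symm
    rwa [h2, sub_sub_cancel] at h1
  let v : D.Space := (⟨j y, hspan⟩ : Submodule.span ℂ D.carrier)
  refine ⟨v, tendsto_iff_norm_sub_tendsto_zero.2 ?_⟩
  refine squeeze_zero (fun _ => norm_nonneg _) (fun n => D.norm_le_of_mem (by positivity) ?_)
    (tendsto_pow_atTop_nhds_zero_of_lt_one (by norm_num) (by norm_num : (1 / 2 : ℝ) < 1))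
  rw [map_sub, ← hx, show D.incl v = j y from rfl, ← map_sub]
  exact hmem n

end Seminorms

variable [Bornology V]

/-- Around a bounded set there is a bounded disk `T`; sums then lie in `2T`, scalar multiples in a
dilate of `T`, and convex hulls in `T`. So only dilates of disks remain to be checked. -/
theorem IsCompleteConvex.of_exists_complete_disk
    (hsmul : ∀ (r : ℝ) (T : Disk V), 0 < r → Bornology.IsBounded T.carrier →
      Bornology.IsBounded (r • T.carrier))
    (hdisk : ∀ S : Set V, Bornology.IsBounded S →
      ∃ T : Disk V, Bornology.IsBounded T.carrier ∧ S ⊆ T.carrier ∧ CompleteSpace T.Space) :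
    IsCompleteConvex V where
  isBounded_add S S' hS hS' := by
    obtain ⟨T, hT, hST, -⟩ := hdisk _ (hS.union hS')
    refine (hsmul 2 T two_pos hT).subset ?_
    rintro _ ⟨x, hx, y, hy, rfl⟩
    rw [← one_add_one_eq_two]
    refine T.add_mem zero_le_one zero_le_one ?_ ?_
    · simpa using hST (Or.inl hx)
    · simpa using hST (Or.inr hy)
  isBounded_smul r S hS := by
    obtain ⟨T, hT, hST, -⟩ := hdisk _ hS
    -- A strictly positive factor is required, while `r` may be zero or negative.
    refine (hsmul (|r| + 1) T (by positivity) hT).subset ?_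
    rintro _ ⟨c, hc, x, hx, rfl⟩
    have hc' : ‖c‖ ≤ r := by simpa using hc
    have h := T.complex_smul_mem c (r := 1) (by simpa using hST hx)
    exact T.smul_subset (by positivity) (by linarith [le_abs_self r]) h
  isBounded_convexHull S hS := by
    obtain ⟨T, hT, hST, -⟩ := hdisk _ hS
    exact hT.subset (convexHull_min hST T.convex)
  exists_complete_disk := hdisk

theorem isBounded_real_smul [IsCompleteConvex V] (r : ℝ) {S : Set V}
    (hS : Bornology.IsBounded S) : Bornology.IsBounded (r • S) := by
  refine (IsCompleteConvex.isBounded_smul |r| S hS).subset ?_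
  rintro _ ⟨x, hx, rfl⟩
  exact ⟨(r : ℂ), by simp, x, hx, rfl⟩

/-- The disk generated by a bounded subset. -/
theorem exists_disk_eq_diskHull [IsCompleteConvex V] {X : Set V} (hX : Bornology.IsBounded X) :
    ∃ T : Disk V, Bornology.IsBounded T.carrier ∧ T.carrier = diskHull X := by
  obtain ⟨T, hT, hXT, -⟩ := IsCompleteConvex.exists_complete_disk X hX
  have h := diskHull_subset hXT T.isClosedAbsConvex
  exact ⟨Disk.ofSubset (isClosedAbsConvex_diskHull X) T h, hT.subset h, rfl⟩

end Spaces

end BornAlg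

namespace BornAlg

/-! ### Powers of subsets -/

section SetPow

variable {A : Type*} [NonUnitalRing A]

theorem setPow_mono {S T : Set A} (h : S ⊆ T) (n : ℕ) : setPow S n ⊆ setPow T n := by
  induction n with
  | zero => exact h
  | succ n ih => exact Set.mul_subset_mul ih h

/-- `setPow S n` has `n + 1` factors, whence the extra `1` in the index. -/
theorem setPow_mul_setPow (S : Set A) (n m : ℕ) :
    setPow S n * setPow S m = setPow S (n + m + 1) := by
  induction m with
  | zero => rfl
  | succ m ih =>
    change setPow S n * (setPow S m * S) = setPow S (n + m + 1) * S
    rw [← ih, mul_assoc]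

theorem iUnion_setPow_mul_subset (S : Set A) :
    (⋃ n, setPow S n) * (⋃ n, setPow S n) ⊆ ⋃ n, setPow S n := by
  rintro _ ⟨x, hx, y, hy, rfl⟩
  obtain ⟨n, hx⟩ := mem_iUnion.1 hx
  obtain ⟨m, hy⟩ := mem_iUnion.1 hy
  refine mem_iUnion.2 ⟨n + m + 1, ?_⟩
  rw [← setPow_mul_setPow]
  exact Set.mul_mem_mul hx hy

theorem setPow_subset_of_mul_subset {S Y : Set A} (hS : S ⊆ Y) (hY : Y * Y ⊆ Y) (n : ℕ) :
    setPow S n ⊆ Y := by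
  induction n with
  | zero => exact hS
  | succ n ih => exact (Set.mul_subset_mul ih hS).trans hY

theorem subset_iUnion_setPow (S : Set A) : S ⊆ ⋃ n, setPow S n := subset_iUnion (setPow S) 0

/-- Every power of `S` is a power of `S ^ (m + 1)` times one of finitely many powers of `S`. -/
theorem iUnion_setPow_subset (S : Set A) (m : ℕ) :
    ⋃ n, setPow S n ⊆ (⋃ n ∈ Finset.range (m + 1), setPow S n) ∪
      ((⋃ n, setPow (setPow S m) n) ∪
        (⋃ n, setPow (setPow S m) n) * ⋃ n ∈ Finset.range (m + 1), setPow S n) := by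
  have key : ∀ q, setPow (setPow S m) q = setPow S ((m + 1) * q + m) := by
    intro q
    induction q with
    | zero => simp [setPow]
    | succ q ih =>
      change setPow (setPow S m) q * setPow S m = _
      rw [ih, setPow_mul_setPow]
      congr 1
      ring
  refine iUnion_subset fun n => ?_
  -- Division with remainder of the number `n + 1` of factors by the block length `m + 1`. The three
  -- cases are: no full block, full blocks only, and full blocks followed by a shorter word.
  obtain ⟨q, r, hr, hn⟩ : ∃ q r, r < m + 1 ∧ n + 1 = (m + 1) * q + r :=
    ⟨(n + 1) / (m + 1), (n + 1) % (m + 1), Nat.mod_lt _ (by omega), (Nat.div_add_mod _ _).symm⟩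
  rcases q with _ | q
  · refine subset_union_of_subset_left ?_ _
    exact subset_biUnion_of_mem (u := fun n => setPow S n)
      (show n ∈ (Finset.range (m + 1) : Finset ℕ) from Finset.mem_range.2 (by omega))
  · refine subset_union_of_subset_right ?_ _
    rcases r with _ | r
    · refine subset_union_of_subset_left ?_ _
      have : n = (m + 1) * q + m := by rw [Nat.mul_succ] at hn; omega
      rw [this, ← key]
      exact subset_iUnion (setPow (setPow S m)) q
    · refine subset_union_of_subset_right ?_ _
      have : n = (m + 1) * q + m + r + 1 := by rw [Nat.mul_succ] at hn; omega
      rw [this, ← setPow_mul_setPow, ← key]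
      exact Set.mul_subset_mul (subset_iUnion (setPow (setPow S m)) q)
        (subset_biUnion_of_mem (u := fun n => setPow S n)
          (show r ∈ (Finset.range (m + 1) : Finset ℕ) from Finset.mem_range.2 (by omega)))

theorem image_setPow {B F : Type*} [NonUnitalRing B] [FunLike F A B] [MulHomClass F A B] (f : F)
    (S : Set A) (n : ℕ) : f '' setPow S n = setPow (f '' S) n := by
  induction n with
  | zero => rfl
  | succ n ih =>
    change f '' (setPow S n * S) = setPow (f '' S) n * (f '' S)
    rw [← ih, Set.image_mul]

variable [Module ℂ A] [IsScalarTower ℂ A A] [SMulCommClass ℂ A A]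

theorem smul_set_mul_smul_set (a b : ℝ) (S T : Set A) : (a • S) * (b • T) = (a * b) • (S * T) := by
  refine Subset.antisymm ?_ ?_
  · rintro _ ⟨_, hx, _, hy, rfl⟩
    exact mul_mem_smul Subset.rfl hx hy
  · rintro _ ⟨_, ⟨x, hx, y, hy, rfl⟩, rfl⟩
    refine ⟨a • x, Set.smul_mem_smul_set hx, b • y, Set.smul_mem_smul_set hy, ?_⟩
    exact smul_mul_smul_comm a x b y

theorem setPow_smul (a : ℝ) (S : Set A) (n : ℕ) : setPow (a • S) n = a ^ (n + 1) • setPow S n := by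
  induction n with
  | zero => simp [setPow]
  | succ n ih =>
    change setPow (a • S) n * (a • S) = a ^ (n + 1 + 1) • (setPow S n * S)
    rw [ih, smul_set_mul_smul_set, ← pow_succ]

theorem Disk.setPow_subset_smul (V : Disk A) (hV : V.carrier * V.carrier ⊆ V.carrier) {S : Set A}
    {q : ℝ} (hS : S ⊆ q • V.carrier) (n : ℕ) : setPow S n ⊆ q ^ (n + 1) • V.carrier := by
  refine (setPow_mono hS n).trans ?_
  rw [setPow_smul]
  exact Set.smul_set_mono (setPow_subset_of_mul_subset Subset.rfl hV n)

end SetPow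

theorem image_real_smul_set {B C : Type*} [NonUnitalRing B] [Module ℂ B] [NonUnitalRing C]
    [Module ℂ C] (f : B →ₙₐ[ℂ] C) (r : ℝ) (S : Set B) : f '' (r • S) = r • f '' S := by
  rw [← image_smul, ← image_smul, image_image, image_image]
  exact image_congr fun x _ => f.map_smul (r : ℂ) x

/-! ### Spectral radius, multiplicatively closed disks and perturbation -/

section SpectralRadius

variable {A : Type*} [NonUnitalRing A] [Module ℂ A] [Bornology A]

theorem spectralRadius_le {S : Set A} {r : ℝ} (hr : 0 < r)
    (h : Bornology.IsBounded (⋃ n, setPow (r⁻¹ • S) n)) :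
    spectralRadius S ≤ ENNReal.ofReal r :=
  sInf_le ⟨r, hr, h, rfl⟩

theorem exists_of_spectralRadius_lt {S : Set A} {ρ : ℝ≥0∞} (h : spectralRadius S < ρ) :
    ∃ r : ℝ, 0 < r ∧ ENNReal.ofReal r < ρ ∧
      Bornology.IsBounded (⋃ n, setPow (r⁻¹ • S) n) := by
  obtain ⟨_, ⟨r, hr, hb, rfl⟩, hlt⟩ := sInf_lt_iff.1 h
  exact ⟨r, hr, hlt, hb⟩

theorem spectralRadius_image_le {B : Type*} [NonUnitalRing B] [Module ℂ B]
    [Bornology B] (f : A →ₙₐ[ℂ] B)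
    (hf : ∀ S : Set A, Bornology.IsBounded S → Bornology.IsBounded (f '' S)) (S : Set A) :
    spectralRadius (f '' S) ≤ spectralRadius S := by
  refine le_of_forall_gt fun ρ hρ => ?_
  obtain ⟨r, hr, hlt, hb⟩ := exists_of_spectralRadius_lt hρ
  refine (spectralRadius_le hr ?_).trans_lt hlt
  have h := hf _ hb
  rw [image_iUnion] at h
  convert h using 3 with n
  rw [image_setPow]
  rw [image_real_smul_set]

/-- After division by `q` the set lies in `V`, and so do all its powers since `V` is closed under
products. -/
theorem Disk.spectralRadius_le (V : Disk A) (hVb : Bornology.IsBounded V.carrier)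
    (hV : V.carrier * V.carrier ⊆ V.carrier) {S : Set A}
    {q : ℝ} (hq : 0 < q) (hS : S ⊆ q • V.carrier) : spectralRadius S ≤ ENNReal.ofReal q := by
  refine BornAlg.spectralRadius_le hq (hVb.subset (iUnion_subset fun n => ?_))
  refine setPow_subset_of_mul_subset ?_ hV n
  rintro _ ⟨x, hx, rfl⟩
  exact (mem_real_smul_iff hq.ne').1 (hS hx)

theorem isBounded_setPow [IsCompleteConvexAlgebra A] {S : Set A} (hS : Bornology.IsBounded S) (n : ℕ) :
    Bornology.IsBounded (setPow S n) := by
  induction n with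
  | zero => exact hS
  | succ n ih => exact IsCompleteConvexAlgebra.isBounded_mul _ _ ih hS

/-- Long products are cut into blocks of `m + 1` factors with a remainder from finitely many bounded
powers. This permits replacing `S` by a power whose values are small. -/
theorem isBounded_iUnion_setPow_of_setPow [IsCompleteConvexAlgebra A] {S : Set A}
    (hS : Bornology.IsBounded S) (m : ℕ) (h : Bornology.IsBounded (⋃ n, setPow (setPow S m) n)) :
    Bornology.IsBounded (⋃ n, setPow S n) := by
  have h1 : Bornology.IsBounded (⋃ n ∈ Finset.range (m + 1), setPow S n) :=
    (Bornology.isBounded_biUnion_finset _).2 fun n _ => isBounded_setPow hS n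
  exact (h1.union (h.union (IsCompleteConvexAlgebra.isBounded_mul _ _ h h1))).subset
    (iUnion_setPow_subset S m)

variable [IsScalarTower ℂ A A] [SMulCommClass ℂ A A] [IsCompleteConvexAlgebra A]

/-- A subset whose powers are uniformly bounded is contained in a multiplicatively closed bounded
disk. -/
theorem exists_multiplicative_disk {S : Set A} (hS : Bornology.IsBounded (⋃ n, setPow S n)) :
    ∃ V : Disk A, Bornology.IsBounded V.carrier ∧ V.carrier * V.carrier ⊆ V.carrier ∧
      S ⊆ V.carrier := by
  obtain ⟨V, hV, hVX⟩ := exists_disk_eq_diskHull hS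
  refine ⟨V, hV, ?_, ((subset_iUnion_setPow S).trans (subset_diskHull _)).trans hVX.ge⟩
  -- The hull is treated one factor at a time. For a fixed word `y`, the `x` with `x * y` in the
  -- hull form a closed absolutely convex set containing all words, hence the hull. Afterwards `x`
  -- in the hull is fixed and `y` varies in the same way.
  have hright : ∀ y ∈ ⋃ n, setPow S n, ∀ x ∈ V.carrier, x * y ∈ V.carrier := by
    intro y hy
    rw [hVX]
    refine diskHull_subset (Y := {x | x * y ∈ diskHull (⋃ n, setPow S n)}) (fun x hx => ?_) ?_
    · exact subset_diskHull _ (iUnion_setPow_mul_subset S (Set.mul_mem_mul hx hy))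
    · have h := isClosedAbsConvex_diskHull (⋃ n, setPow S n)
      refine ⟨by simpa using h.zero_mem, ?_, ?_, fun x hx => h.closed _ fun t ht => ?_⟩
      · rintro c hc _ ⟨x, hx, rfl⟩
        simp only [mem_ofPred_eq, smul_mul_assoc]
        exact h.balanced c hc (Set.smul_mem_smul_set hx)
      · intro x hx x' hx' a b ha hb hab
        have := h.convex hx hx' ha hb hab
        simp only [mem_ofPred_eq, add_mul]
        convert this using 2
        · exact smul_mul_assoc (a : ℂ) x y
        · exact smul_mul_assoc (b : ℂ) x' y
      · obtain ⟨z, hz, hzx⟩ := hx t ht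
        refine ⟨z * y, hz, ?_⟩
        simp only at hzx ⊢
        rw [← hzx]
        exact (smul_mul_assoc (t : ℂ) z y).symm
  rintro _ ⟨x, hx, y, hy, rfl⟩
  rw [hVX] at hy
  refine diskHull_subset (Y := {y | x * y ∈ V.carrier}) (fun y hy => hright y hy x hx) ?_ hy
  have h := V.isClosedAbsConvex
  refine ⟨by simpa using h.zero_mem, ?_, ?_, fun y hy => h.closed _ fun t ht => ?_⟩
  · rintro c hc _ ⟨y, hy, rfl⟩
    simp only [mem_ofPred_eq, mul_smul_comm]
    exact h.balanced c hc (Set.smul_mem_smul_set hy)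
  · intro y hy y' hy' a b ha hb hab
    have := h.convex hy hy' ha hb hab
    simp only [mem_ofPred_eq, mul_add]
    convert this using 2
    · exact mul_smul_comm (a : ℂ) x y
    · exact mul_smul_comm (b : ℂ) x y'
  · obtain ⟨z, hz, hzx⟩ := hy t ht
    refine ⟨x * z, hz, ?_⟩
    simp only at hzx ⊢
    rw [← hzx]
    exact (mul_smul_comm (t : ℂ) x z).symm

/-- In a locally multiplicative algebra, every bounded subset is absorbed by a multiplicatively
closed bounded disk. -/
theorem IsLocallyMultiplicative.exists_multiplicative_disk (hA : IsLocallyMultiplicative A)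
    {S : Set A} (hS : Bornology.IsBounded S) :
    ∃ V : Disk A, Bornology.IsBounded V.carrier ∧ V.carrier * V.carrier ⊆ V.carrier ∧
      ∃ c : ℝ, 0 < c ∧ S ⊆ c • V.carrier := by
  obtain ⟨r, hr, -, hb⟩ := exists_of_spectralRadius_lt (hA S hS)
  obtain ⟨V, hV, hVV, hSV⟩ := BornAlg.exists_multiplicative_disk hb
  refine ⟨V, hV, hVV, r, hr, fun x hx => ?_⟩
  rw [mem_real_smul_iff hr.ne']
  exact hSV (Set.smul_mem_smul_set hx)

/-- The spectral radius is stable under small perturbations. -/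
theorem IsLocallyMultiplicative.exists_perturbation (hA : IsLocallyMultiplicative A)
    {S T : Set A} (hT : Bornology.IsBounded T) {r : ℝ} (hr : 0 < r)
    (hS : spectralRadius S < ENNReal.ofReal r) :
    ∃ V : Disk A, Bornology.IsBounded V.carrier ∧ V.carrier * V.carrier ⊆ V.carrier ∧
      ∃ q : ℝ, 0 < q ∧ q < r ∧ ∃ ε : ℝ, 0 < ε ∧ ∀ x ∈ S, ∀ δ : ℝ, 0 ≤ δ → δ ≤ ε → ∀ y ∈ δ • T,
        x + y ∈ q • V.carrier := by
  obtain ⟨r', hr', hlt, hb⟩ := exists_of_spectralRadius_lt hS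
  rw [ENNReal.ofReal_lt_ofReal_iff hr] at hlt
  -- `P` is `S` normalised by some `r' < r`, so the set `U` of all words in `P` is bounded.
  set P := r'⁻¹ • S with hP
  set U := ⋃ n, setPow P n with hU
  have hPU : P ⊆ U := subset_iUnion_setPow P
  have hUU : U * P ⊆ U :=
    (Set.mul_subset_mul Subset.rfl hPU).trans (iUnion_setPow_mul_subset P)
  -- Words with one letter from `T` and, optionally, words in `P` on either side. `W` is bounded and
  -- stable under right multiplication by `P`; local multiplicativity gives a `c` for which the
  -- powers of `c⁻¹ • W` stay in a bounded set `W'`.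
  set W := T ∪ U * T ∪ T * U ∪ U * T * U with hW
  have hmul := IsCompleteConvexAlgebra.isBounded_mul (A := A)
  have hWb : Bornology.IsBounded W :=
    ((hT.union (hmul _ _ hb hT)).union (hmul _ _ hT hb)).union (hmul _ _ (hmul _ _ hb hT) hb)
  have hWP : W * P ⊆ W := by
    rw [hW, Set.union_mul, Set.union_mul, Set.union_mul]
    refine union_subset (union_subset (union_subset ?_ ?_) ?_) ?_
    · exact (Set.mul_subset_mul Subset.rfl hPU).trans fun x hx => Or.inl (Or.inr hx)
    · exact (Set.mul_subset_mul Subset.rfl hPU).trans fun x hx => Or.inr hx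
    · rw [mul_assoc]
      exact (Set.mul_subset_mul Subset.rfl hUU).trans fun x hx => Or.inl (Or.inr hx)
    · rw [mul_assoc]
      exact (Set.mul_subset_mul Subset.rfl hUU).trans fun x hx => Or.inr hx
  obtain ⟨c, hc, -, hcb⟩ := exists_of_spectralRadius_lt (hA W hWb)
  set W' := ⋃ n, setPow (c⁻¹ • W) n with hW'
  have hcW : (c⁻¹ • W) * P ⊆ c⁻¹ • W := by
    have := smul_set_mul_smul_set c⁻¹ 1 W P
    rw [one_smul, mul_one] at this
    rw [this]
    exact Set.smul_set_mono hWP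
  have hWP' : W' * P ⊆ W' := by
    rw [hW', Set.iUnion_mul]
    refine iUnion_mono fun n => ?_
    cases n with
    | zero => exact hcW
    | succ n =>
      change setPow (c⁻¹ • W) n * (c⁻¹ • W) * P ⊆ setPow (c⁻¹ • W) n * (c⁻¹ • W)
      rw [mul_assoc]
      exact Set.mul_subset_mul Subset.rfl hcW
  have hUT : U * (c⁻¹ • T) ⊆ W' := by
    have := smul_set_mul_smul_set 1 c⁻¹ U T
    rw [one_smul, one_mul] at this
    rw [this]
    refine (Set.smul_set_mono ?_).trans (subset_iUnion_setPow _)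
    exact fun x hx => Or.inl (Or.inl (Or.inr hx))
  have hcT : c⁻¹ • T ⊆ c⁻¹ • W := Set.smul_set_mono fun x hx => Or.inl (Or.inl (Or.inl hx))
  have hcT' : c⁻¹ • T ⊆ W' := hcT.trans (subset_iUnion_setPow _)
  have hWT : W' * (c⁻¹ • T) ⊆ W' :=
    (Set.mul_subset_mul Subset.rfl hcT').trans (iUnion_setPow_mul_subset _)
  -- A word in both alphabets either has no letter from `T` and lies in `U`, or splits into blocks
  -- from `c⁻¹ • W` and lies in `W'`. The induction appends one letter at a time.
  have hpow : ∀ n, setPow (P ∪ c⁻¹ • T) n ⊆ U ∪ W' := by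
    intro n
    induction n with
    | zero => exact union_subset_union hPU hcT'
    | succ n ih =>
      refine (Set.mul_subset_mul ih Subset.rfl).trans ?_
      rw [Set.union_mul, Set.mul_union, Set.mul_union]
      refine union_subset (union_subset ?_ ?_) (union_subset ?_ ?_)
      · exact hUU.trans subset_union_left
      · exact hUT.trans subset_union_right
      · exact hWP'.trans subset_union_right
      · exact hWT.trans subset_union_right
  obtain ⟨V, hV, hVV, hPV⟩ :=
    BornAlg.exists_multiplicative_disk ((hb.union hcb).subset (iUnion_subset hpow))
  -- Here `S ⊆ r' V` and `T ⊆ c V`, so `δT` contributes at most `δc ≤ (r - r') / 2`, and the sum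
  -- stays in the midpoint dilate.
  refine ⟨V, hV, hVV, (r' + r) / 2, by positivity, by linarith, (r - r') / 2 / c,
    div_pos (by linarith) hc, ?_⟩
  rintro x hx δ hδ hδ' _ ⟨y, hy, rfl⟩
  have hx' : x ∈ r' • V.carrier := by
    rw [mem_real_smul_iff hr'.ne']
    exact hPV (Or.inl (Set.smul_mem_smul_set hx))
  have hy' : δ • y ∈ (δ * c) • V.carrier := by
    rw [mul_smul]
    refine Set.smul_mem_smul_set ?_
    rw [mem_real_smul_iff hc.ne']
    exact hPV (Or.inr (Set.smul_mem_smul_set hy))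
  rw [le_div_iff₀ hc] at hδ'
  exact V.smul_subset (by positivity) (by linarith) (V.add_mem hr'.le (by positivity) hx' hy')

end SpectralRadius

end BornAlg

namespace BornAlg

/-! ### Upper semicontinuity and compactness -/

section UpperSemicontinuity

theorem spectralRadius_inv_smul_lt_one {A : Type*} [NonUnitalRing A] [Module ℂ A] [Bornology A]
    {S : Set A} {r : ℝ} (hr : 0 < r)
    (h : spectralRadius S < ENNReal.ofReal r) : spectralRadius (r⁻¹ • S) < 1 := by
  obtain ⟨r', hr', hlt, hb⟩ := exists_of_spectralRadius_lt h
  rw [ENNReal.ofReal_lt_ofReal_iff hr] at hlt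
  refine (spectralRadius_le (r := r' / r) (by positivity) ?_).trans_lt
    (ENNReal.ofReal_lt_one.2 ((div_lt_one hr).2 hlt))
  rwa [smul_smul, inv_div, div_mul_eq_mul_div, mul_inv_cancel₀ hr.ne', one_div]

variable {A : Type*} [NonUnitalRing A] [Module ℂ A] [IsScalarTower ℂ A A] [SMulCommClass ℂ A A]
  [Bornology A] [IsCompleteConvexAlgebra A]

/-- The values at `y` are values at `x` perturbed by `w (y, x) • T`, and `w (y, x)` is small near
`x`. The perturbation principle then confines them to `q V` with `q` below the given bound. -/
theorem IsLocallyMultiplicative.upperSemicontinuous_spectralRadius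
    (hA : IsLocallyMultiplicative A) {X : Type*} [TopologicalSpace X] {S : Set (X → A)} {T : Set A}
    (hT : Bornology.IsBounded T) (w : C(X × X, ℝ≥0)) (hw : ∀ x, w (x, x) = 0)
    (h : ∀ f ∈ S, ∀ x y, f x - f y ∈ (w (x, y) : ℝ) • T) :
    UpperSemicontinuous fun x => spectralRadius ((fun f => f x) '' S) := by
  intro x ρ hρ
  obtain ⟨r, -, hr1, hr2⟩ := ENNReal.lt_iff_exists_real_btwn.1 hρ
  have hr0 : 0 < r := ENNReal.ofReal_pos.1 (bot_le.trans_lt hr1)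
  obtain ⟨V, hV, hVV, q, hq, hqr, ε, hε, hS⟩ := hA.exists_perturbation hT hr0 hr1
  have hcont : Continuous fun y => w (y, x) := w.continuous.comp (by fun_prop)
  have hnear : ∀ᶠ y in 𝓝 x, w (y, x) < ε.toNNReal :=
    hcont.continuousAt.eventually_lt continuousAt_const (by simpa [hw] using hε)
  filter_upwards [hnear] with y hy
  refine (V.spectralRadius_le hV hVV hq ?_).trans_lt
    (((ENNReal.ofReal_lt_ofReal_iff hr0).2 hqr).trans hr2)
  rintro _ ⟨f, hf, rfl⟩
  have := hS (f x) ⟨f, hf, rfl⟩ (w (y, x)) (by simp) ((Real.le_toNNReal_iff_coe_le hε.le).1 hy.le)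
    _ (h f hf y x)
  simpa using this

/-- If all `S x` have spectral radius less than `1`, then a power of all `S x` is uniformly small
in a multiplicatively closed disk. -/
theorem IsLocallyMultiplicative.exists_setPow_subset
    (hA : IsLocallyMultiplicative A) {X : Type*} [TopologicalSpace X] [CompactSpace X]
    {S : Set (X → A)} {T : Set A}
    (hT : Bornology.IsBounded T) (w : C(X × X, ℝ≥0)) (hw : ∀ x, w (x, x) = 0)
    (h : ∀ f ∈ S, ∀ x y, f x - f y ∈ (w (x, y) : ℝ) • T)
    (hρ : ∀ x, spectralRadius ((fun f => f x) '' S) < 1) {B : Set A}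
    (hB : Bornology.IsBounded B) :
    ∃ V : Disk A, Bornology.IsBounded V.carrier ∧ V.carrier * V.carrier ⊆ V.carrier ∧
      ∃ c : ℝ, 0 < c ∧ B ⊆ c • V.carrier ∧
        ∃ m, ∀ x, setPow ((fun f => f x) '' S) m ⊆ (1 / 2 : ℝ) • V.carrier := by
  choose V hV hVV q hq hq1 ε hε hS using fun x =>
    hA.exists_perturbation hT one_pos (by simpa using hρ x)
  have hnear : ∀ x, {y | w (y, x) < (ε x).toNNReal} ∈ 𝓝 x := fun x =>
    have hcont : Continuous fun y => w (y, x) := w.continuous.comp (by fun_prop)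
    hcont.continuousAt.eventually_lt continuousAt_const (by simpa [hw] using hε x)
  -- Each `x` has a neighbourhood on which all values lie in `q x • V x` with `q x < 1`; finitely
  -- many of these cover `X`.
  obtain ⟨t, ht⟩ := CompactSpace.elim_nhds_subcover _ hnear
  have hbdd : Bornology.IsBounded ((⋃ x ∈ t, (V x).carrier) ∪ B) :=
    ((Bornology.isBounded_biUnion_finset t).2 fun x _ => hV x).union hB
  -- A single multiplicatively closed disk absorbs the finitely many `V x` and `B`. The loss is the
  -- factor `c`, which high powers of `q x` outweigh.
  obtain ⟨V', hV', hVV', c, hc, hcV⟩ := hA.exists_multiplicative_disk hbdd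
  have hpow : ∀ᶠ m : ℕ in atTop, ∀ x ∈ t, q x ^ (m + 1) * c ≤ 1 / 2 := by
    rw [eventually_all_finset]
    intro x _
    have hlim : Tendsto (fun m : ℕ => q x ^ (m + 1) * c) atTop (𝓝 (0 * c)) :=
      ((tendsto_pow_atTop_nhds_zero_of_lt_one (hq x).le (hq1 x)).comp
        (tendsto_add_atTop_nat 1)).mul_const c
    rw [zero_mul] at hlim
    exact hlim.eventually_le_const (by norm_num)
  obtain ⟨m, hm⟩ := hpow.exists
  refine ⟨V', hV', hVV', c, hc, subset_union_right.trans hcV, m, fun y => ?_⟩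
  have hy : y ∈ ⋃ x ∈ t, {y | w (y, x) < (ε x).toNNReal} := ht ▸ mem_univ y
  obtain ⟨x, hxt, hxy⟩ := mem_iUnion₂.1 hy
  have hyV : (fun f => f y) '' S ⊆ q x • (V x).carrier := by
    rintro _ ⟨f, hf, rfl⟩
    have := hS x (f x) ⟨f, hf, rfl⟩ (w (y, x)) (by simp)
      ((Real.le_toNNReal_iff_coe_le (hε x).le).1 (le_of_lt hxy)) _ (h f hf y x)
    simpa using this
  refine ((V x).setPow_subset_smul (hVV x) hyV m).trans ?_
  have hVx : (V x).carrier ⊆ c • V'.carrier := fun z hz =>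
    hcV (Or.inl (mem_iUnion₂.2 ⟨x, hxt, hz⟩))
  refine (Set.smul_set_mono hVx).trans ?_
  rw [smul_smul]
  exact V'.smul_subset (mul_nonneg (pow_nonneg (hq x).le _) hc.le) (hm x hxt)

/-- Inclusion instead of equality also covers the empty set of values. The result is needed at
infinity. -/
theorem spectralRadius_zero_of_subset {S : Set A} (h : S ⊆ {0}) : spectralRadius S = 0 := by
  obtain ⟨V, hV, hVV, -⟩ := exists_multiplicative_disk (A := A) (S := {0})
    ((Bornology.isBounded_singleton (x := (0 : A))).subset
      (iUnion_subset fun n => setPow_subset_of_mul_subset Subset.rfl (by simp) n))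
  refine le_antisymm (le_of_forall_gt_imp_ge_of_dense fun ρ hρ => ?_) bot_le
  obtain ⟨r, -, hr1, hr2⟩ := ENNReal.lt_iff_exists_real_btwn.1 hρ
  have hr0 : 0 < r := ENNReal.ofReal_pos.1 hr1
  refine (V.spectralRadius_le hV hVV hr0 (h.trans ?_)).trans hr2.le
  rintro _ rfl
  exact ⟨0, V.zero_mem, smul_zero r⟩

end UpperSemicontinuity

/-- An upper semicontinuous function on a one-point compactification that vanishes at infinity
attains its supremum on the original space. -/
theorem _root_.UpperSemicontinuous.onePoint_properties {M : Type*} [TopologicalSpace M] [T2Space M]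
    {φ : OnePoint M → ℝ≥0∞} (hφ : UpperSemicontinuous φ) (h0 : φ OnePoint.infty = 0) {ρ : ℝ≥0∞}
    (hle : ∀ x : M, φ x ≤ ρ)
    (hge : ∀ r : ℝ, 0 < r → (∀ x, φ x < ENNReal.ofReal r) → ρ ≤ ENNReal.ofReal r) :
    UpperSemicontinuous (fun x : M => φ x) ∧ Tendsto (fun x : M => φ x) (cocompact M) (𝓝 0) ∧
      ρ = ⨆ x : M, φ x ∧ (Nonempty M → ∃ x : M, ρ = φ x) := by
  have hex : ∃ x, IsMaxOn φ univ x := by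
    obtain ⟨x, -, hx⟩ := UpperSemicontinuousOn.exists_isMaxOn (s := univ) univ_nonempty
      isCompact_univ (hφ.upperSemicontinuousOn univ)
    exact ⟨x, hx⟩
  obtain ⟨x, hx⟩ := hex
  have hmax : ∀ y, φ y ≤ φ x := fun y => hx (mem_univ y)
  -- `hge` asks for a strict bound at every point, so it is applied to reals above the maximum.
  have hρ : ρ ≤ φ x := by
    refine le_of_forall_gt_imp_ge_of_dense fun a ha => ?_
    obtain ⟨r, -, hr1, hr2⟩ := ENNReal.lt_iff_exists_real_btwn.1 ha
    exact (hge r (ENNReal.ofReal_pos.1 (bot_le.trans_lt hr1))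
      fun y => (hmax y).trans_lt hr1).trans hr2.le
  have hsup : ρ = ⨆ x : M, φ x := by
    refine le_antisymm (hρ.trans ?_) (iSup_le hle)
    -- A maximum attained at infinity is `0`, so it does not exceed the supremum over `M`, even if
    -- `M` is empty.
    induction x using OnePoint.rec with
    | infty => rw [h0]; exact bot_le
    | coe x => exact le_iSup (fun x : M => φ x) x
  refine ⟨fun x ρ hρ => OnePoint.continuous_coe.continuousAt.eventually (hφ x ρ hρ), ?_, hsup, ?_⟩
  -- Upper semicontinuity at infinity is the decay statement: neighbourhoods of infinity are
  -- complements of closed compact sets, and in a Hausdorff space every compact set is closed.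
  · refine ENNReal.tendsto_nhds_zero.2 fun ε hε => ?_
    have h := hφ OnePoint.infty ε (h0.trans_lt hε)
    rw [← coclosedCompact_eq_cocompact, ← OnePoint.comap_coe_nhds_infty]
    exact (tendsto_comap.eventually h).mono fun _ h => le_of_lt h
  · rintro ⟨y⟩
    induction x using OnePoint.rec with
    | infty =>
      rw [h0] at hmax hρ
      exact ⟨y, le_antisymm (hρ.trans bot_le) (hle y)⟩
    | coe x => exact ⟨x, le_antisymm hρ (hle x)⟩

/-! ### The algebra `C₀(M, A)` -/

section CZero

/-- The value at `x` of the extension by zero, as a linear map. -/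
def evalExtendZero {M : Type*} (F : Type*) [AddCommGroup F] [Module ℂ F] (x : OnePoint M) :
    (M → F) →ₗ[ℂ] F where
  toFun f := extendZero f x
  map_add' f g := by
    induction x using OnePoint.rec
    · exact (add_zero _).symm
    · rfl
  map_smul' c f := by
    induction x using OnePoint.rec
    · exact (smul_zero _).symm
    · rfl

theorem incl_extendZero {M A : Type*} [AddCommGroup A] [Module ℂ A] (T : Disk A) (g : M → T.Space) (x : OnePoint M) :
    T.incl (extendZero g x) = extendZero (fun x => T.incl (g x)) x := by
  induction x using OnePoint.rec
  · exact map_zero _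
  · rfl

theorem tendsto_extendZero {M F : Type*} [Zero F] [TopologicalSpace F] {g : ℕ → M → F} {h : M → F}
    (hg : ∀ x, Tendsto (fun n => g n x) atTop (𝓝 (h x))) (x : OnePoint M) :
    Tendsto (fun n => extendZero (g n) x) atTop (𝓝 (extendZero h x)) := by
  induction x using OnePoint.rec
  · exact tendsto_const_nhds
  · exact hg _

variable {M A : Type*} [TopologicalSpace M] [NonUnitalRing A] [Module ℂ A]
  [IsScalarTower ℂ A A] [SMulCommClass ℂ A A] [Bornology A] [IsCompleteConvexAlgebra A]

namespace CZero

/-- The value at `x` of the extension by zero, as a homomorphism. -/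
def eval (x : OnePoint M) : CZero M A →ₙₐ[ℂ] A where
  toFun f := extendZero (f : M → A) x
  map_zero' := (evalExtendZero A x).map_zero
  map_add' f g := (evalExtendZero A x).map_add (f : M → A) g
  map_smul' c f := (evalExtendZero A x).map_smul c (f : M → A)
  map_mul' f g := by
    induction x using OnePoint.rec
    · exact (mul_zero _).symm
    · rfl

theorem ext {f g : CZero M A} (h : ∀ x : M, f x = g x) : f = g := Subtype.ext (funext h)

theorem isBounded_of_disk {S : Set (CZero M A)} (T : Disk A) (hT : Bornology.IsBounded T.carrier)
    (w : C(OnePoint M × OnePoint M, ℝ≥0)) (hw : ∀ x, w (x, x) = 0)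
    (h : ∀ f ∈ S, ∀ x y, eval x f - eval y f ∈ (w (x, y) : ℝ) • T.carrier) :
    Bornology.IsBounded S := by
  rw [isBounded_iff]
  refine isBoundedCZero_of_disk T hT w hw ?_
  rintro _ ⟨f, hf, rfl⟩
  exact h f hf

theorem exists_disk {S : Set (CZero M A)} (hS : Bornology.IsBounded S) {B : Set A}
    (hB : Bornology.IsBounded B) :
    ∃ T : Disk A, Bornology.IsBounded T.carrier ∧ B ⊆ T.carrier ∧
      ∃ w : C(OnePoint M × OnePoint M, ℝ≥0), (∀ x, w (x, x) = 0) ∧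
        ∀ f ∈ S, ∀ x y, eval x f - eval y f ∈ (w (x, y) : ℝ) • T.carrier := by
  rw [isBounded_iff] at hS
  obtain ⟨T, hT, hBT, w, hw, h⟩ := hS.disk hB
  exact ⟨T, hT, hBT, w, hw, fun f hf => h _ (mem_image_of_mem _ hf)⟩

theorem eval_infty (f : CZero M A) : eval OnePoint.infty f = 0 := rfl

/-- Functions `M → A_T` that belong to `C₀(M, A)`. -/
def lifts (T : Disk A) : Submodule ℂ (M → T.Space) :=
  (cZeroSubalgebra M A).toSubmodule.comap (T.incl.compLeft M)

/-- The map `C₀(M, A) ∩ (M → A_T) → C₀(M, A)`. -/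
def ofLifts (T : Disk A) : lifts (M := M) T →ₗ[ℂ] CZero M A where
  toFun g := (⟨fun x => T.incl (g.1 x), g.2⟩ : cZeroSubalgebra M A)
  map_add' f g := ext fun x => T.incl.map_add (f.1 x) (g.1 x)
  map_smul' c g := ext fun x => T.incl.map_smul c (g.1 x)

theorem ofLifts_injective (T : Disk A) : Function.Injective (ofLifts (M := M) T) := by
  intro f g h
  refine Subtype.ext (funext fun x => T.incl_injective ?_)
  exact congrArg (fun f : CZero M A => f x) h

theorem eval_ofLifts (T : Disk A) (g : lifts (M := M) T) (x : OnePoint M) :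
    eval x (ofLifts T g) = T.incl (extendZero g.1 x) :=
  (incl_extendZero T g.1 x).symm

/-- The seminorms `‖g x - g y‖`. -/
def diffSeminorm (T : Disk A) (i : OnePoint M × OnePoint M) : Seminorm ℂ (lifts (M := M) T) :=
  (normSeminorm ℂ T.Space).comp
    ((evalExtendZero T.Space i.1 - evalExtendZero T.Space i.2).comp (lifts (M := M) T).subtype)

theorem diffSeminorm_apply (T : Disk A) (x y : OnePoint M) (g : lifts (M := M) T) :
    diffSeminorm T (x, y) g = ‖extendZero g.1 x - extendZero g.1 y‖ := rfl

theorem eq_zero_of_diffSeminorm (T : Disk A) (g : lifts (M := M) T)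
    (h : ∀ i, diffSeminorm T i g = 0) : g = 0 := by
  refine Subtype.ext (funext fun x => ?_)
  have := h (x, OnePoint.infty)
  rw [diffSeminorm_apply, norm_eq_zero] at this
  exact sub_eq_zero.1 this

/-- The disk of functions with continuity estimator `w` with respect to `T`. -/
def estimatorDisk (T : Disk A) (w : C(OnePoint M × OnePoint M, ℝ≥0)) : Disk (CZero M A) :=
  Disk.ofSeminorms (ofLifts T) (ofLifts_injective T) (diffSeminorm T) (fun i => w i)
    (fun i => (w i).2) (eq_zero_of_diffSeminorm T)

/-- The disk is built from `A_T`-valued lifts, and this removes them. An estimator with respect to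
`T` already forces values in `A_T`, as seen by comparing with infinity, where `f` vanishes. -/
theorem mem_smul_estimatorDisk {T : Disk A} {w : C(OnePoint M × OnePoint M, ℝ≥0)} {r : ℝ}
    (hr : 0 < r) {f : CZero M A} : f ∈ r • (estimatorDisk T w).carrier ↔
      ∀ x y, eval x f - eval y f ∈ (r * w (x, y)) • T.carrier := by
  constructor
  · intro hf x y
    obtain ⟨g, rfl⟩ : ∃ g, ofLifts T g = f := by
      obtain ⟨_, ⟨g, -, rfl⟩, rfl⟩ := hf
      exact ⟨r • g, map_real_smul _ _ _⟩
    have h := (mem_smul_image_seminorm_le _ _ _ (ofLifts_injective T) hr).1 hf (x, y)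
    rw [diffSeminorm_apply] at h
    rw [eval_ofLifts, eval_ofLifts, ← map_sub]
    exact T.smul_subset (norm_nonneg _) h (T.mem_norm_smul _)
  · intro hf
    have hspan : ∀ x : M, f x ∈ Submodule.span ℂ T.carrier := fun x => by
      obtain ⟨t, ht, hx⟩ := hf x OnePoint.infty
      rw [eval_infty, sub_zero] at hx
      rw [show f x = eval (x : OnePoint M) f from rfl, ← hx]
      exact Submodule.smul_mem _ ((r * w (x, OnePoint.infty) : ℝ) : ℂ) (Submodule.subset_span ht)
    let g : lifts (M := M) T :=
      ⟨fun x => (⟨f x, hspan x⟩ : Submodule.span ℂ T.carrier), f.2⟩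
    have hg : ofLifts T g = f := rfl
    rw [← hg]
    refine (mem_smul_image_seminorm_le _ _ _ (ofLifts_injective T) hr).2 fun i => ?_
    refine T.norm_le_of_mem (by positivity) ?_
    have h := hf i.1 i.2
    rw [← hg, eval_ofLifts, eval_ofLifts, ← map_sub] at h
    exact h

theorem mem_estimatorDisk {T : Disk A} {w : C(OnePoint M × OnePoint M, ℝ≥0)} {f : CZero M A} :
    f ∈ (estimatorDisk T w).carrier ↔
      ∀ x y, eval x f - eval y f ∈ (w (x, y) : ℝ) • T.carrier := by
  have := mem_smul_estimatorDisk (T := T) (w := w) (f := f) one_pos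
  simpa only [one_smul, one_mul] using this

theorem isBounded_estimatorDisk {T : Disk A} (hT : Bornology.IsBounded T.carrier)
    {w : C(OnePoint M × OnePoint M, ℝ≥0)} (hw : ∀ x, w (x, x) = 0) :
    Bornology.IsBounded (estimatorDisk T w).carrier :=
  isBounded_of_disk T hT w hw fun _ hf => mem_estimatorDisk.1 hf

/-- Comparison with infinity makes a controlled sequence pointwise Cauchy in the Banach space `A_T`,
and the estimates survive the pointwise limit `h`. In particular `g 0 - h` has estimator `w`, so `h`
belongs to `C₀(M, A)` because `g 0` does. -/
theorem completeSpace_estimatorDisk {T : Disk A} (hT : Bornology.IsBounded T.carrier)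
    [CompleteSpace T.Space] {w : C(OnePoint M × OnePoint M, ℝ≥0)} (hw : ∀ x, w (x, x) = 0) :
    CompleteSpace (estimatorDisk T w).Space := by
  refine Disk.completeSpace_ofSeminorms _ _ _ _ _ _ fun g hg => ?_
  have hcauchy : ∀ x : M, CauchySeq fun n => (g n).1 x := fun x => by
    refine cauchySeq_of_le_tendsto_0 (fun n => (1 / 2 : ℝ) ^ n * w (x, OnePoint.infty) * 2) ?_ ?_
    · intro n m N hn hm
      have h1 := hg N n hn (x, OnePoint.infty)
      have h2 := hg N m hm (x, OnePoint.infty)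
      have e : ∀ k, diffSeminorm T ((x : OnePoint M), OnePoint.infty) (g N - g k) =
          dist ((g N).1 x) ((g k).1 x) := fun k => by
        rw [diffSeminorm_apply, dist_eq_norm]
        exact congrArg _ (sub_zero _)
      rw [e] at h1 h2
      linarith [dist_triangle_left ((g n).1 x) ((g m).1 x) ((g N).1 x)]
    · have h := (tendsto_pow_atTop_nhds_zero_of_lt_one (by norm_num)
        (by norm_num : (1 / 2 : ℝ) < 1)).mul_const ((w (x, OnePoint.infty) : ℝ) * 2)
      simpa only [zero_mul, mul_assoc] using h
  choose h hh using fun x => cauchySeq_tendsto_of_complete (hcauchy x)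
  have hbound : ∀ n x y, ‖extendZero ((g n).1 - h) x - extendZero ((g n).1 - h) y‖ ≤
      (1 / 2 : ℝ) ^ n * w (x, y) := by
    intro n x y
    have hlim : ∀ x, Tendsto (fun m => extendZero ((g n).1 - (g m).1) x) atTop
        (𝓝 (extendZero ((g n).1 - h) x)) :=
      tendsto_extendZero fun x => tendsto_const_nhds.sub (hh x)
    refine le_of_tendsto ((hlim x).sub (hlim y)).norm ?_
    filter_upwards [eventually_ge_atTop n] with m hm
    exact hg n m hm (x, y)
  have hmem : (g 0).1 - h ∈ lifts (M := M) T := by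
    change IsBoundedCZero {_}
    refine isBoundedCZero_of_disk T hT w hw ?_
    rintro _ rfl x y
    have := hbound 0 x y
    rw [pow_zero, one_mul] at this
    have e := fun x => incl_extendZero T ((g 0).1 - h) x
    change extendZero (fun x => T.incl (((g 0).1 - h) x)) x -
      extendZero (fun x => T.incl (((g 0).1 - h) x)) y ∈ _
    rw [← e, ← e, ← map_sub]
    exact T.smul_subset (norm_nonneg _) this (T.mem_norm_smul _)
  have hmem' : h ∈ lifts (M := M) T := by
    have := Submodule.sub_mem _ (g 0).2 hmem
    rwa [sub_sub_cancel] at this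
  exact ⟨⟨h, hmem'⟩, fun n i => hbound n i.1 i.2⟩

theorem isBounded_image_eval {S : Set (CZero M A)} (hS : Bornology.IsBounded S) (x : OnePoint M) :
    Bornology.IsBounded (eval x '' S) := by
  obtain ⟨T, hT, -, w, hw, h⟩ := exists_disk hS Bornology.isBounded_empty
  refine (isBounded_real_smul (w (x, OnePoint.infty)) hT).subset ?_
  rintro _ ⟨f, hf, rfl⟩
  have := h f hf x OnePoint.infty
  rwa [eval_infty, sub_zero] at this

/-- The Leibniz rule for differences of values of a product. -/
theorem eval_mul_sub_mem {T T' U : Disk A} (hU : T.carrier * T'.carrier ⊆ U.carrier)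
    {f f' : CZero M A} {a a' b b' : ℝ} (ha : 0 ≤ a) (ha' : 0 ≤ a') (hb : 0 ≤ b) (hb' : 0 ≤ b')
    {x y : OnePoint M} (hf : eval y f ∈ a • T.carrier) (hf' : eval x f' ∈ a' • T'.carrier)
    (h : eval x f - eval y f ∈ b • T.carrier) (h' : eval x f' - eval y f' ∈ b' • T'.carrier) :
    eval x (f * f') - eval y (f * f') ∈ (b * a' + a * b') • U.carrier := by
  rw [map_mul, map_mul, show eval x f * eval x f' - eval y f * eval y f' =
    (eval x f - eval y f) * eval x f' + eval y f * (eval x f' - eval y f') by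
    rw [sub_mul, mul_sub]; abel]
  exact U.add_mem (by positivity) (by positivity) (mul_mem_smul hU h hf') (mul_mem_smul hU hf h')

theorem isCompleteConvexAlgebra : IsCompleteConvexAlgebra (CZero M A) where
  toIsCompleteConvex := by
    refine .of_exists_complete_disk (fun r T hr hT => ?_) fun S hS => ?_
    · obtain ⟨U, hU, -, w, hw, h⟩ := exists_disk hT Bornology.isBounded_empty
      refine isBounded_of_disk U hU (ContinuousMap.const _ r.toNNReal * w) (fun x => by simp [hw]) ?_
      rintro _ ⟨f, hf, rfl⟩ x y
      have e : ∀ x, eval x (r • f) = r • eval x f :=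
        fun x => (eval x).map_smul (r : ℂ) f
      simp only [e, ← smul_sub]
      rw [ContinuousMap.mul_apply, ContinuousMap.const_apply, NNReal.coe_mul,
        Real.coe_toNNReal r hr.le, mul_smul]
      exact Set.smul_mem_smul_set (h f hf x y)
    · obtain ⟨U, hU, -, w, hw, h⟩ := exists_disk hS Bornology.isBounded_empty
      obtain ⟨T, hT, hUT, hTc⟩ := IsCompleteConvex.exists_complete_disk _ hU
      exact ⟨estimatorDisk T w, isBounded_estimatorDisk hT hw, fun f hf => mem_estimatorDisk.2
        fun x y => Set.smul_set_mono hUT (h f hf x y), completeSpace_estimatorDisk hT hw⟩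
  isBounded_mul S S' hS hS' := by
    obtain ⟨T, hT, -, w, hw, h⟩ := exists_disk hS Bornology.isBounded_empty
    obtain ⟨T', hT', -, w', hw', h'⟩ := exists_disk hS' Bornology.isBounded_empty
    obtain ⟨U, hU, hTU⟩ := BornAlg.exists_disk (IsCompleteConvexAlgebra.isBounded_mul _ _ hT hT')
    obtain ⟨c, hc⟩ := (isCompact_range w.continuous).bddAbove
    obtain ⟨c', hc'⟩ := (isCompact_range w'.continuous).bddAbove
    refine isBounded_of_disk U hU
      (w * ContinuousMap.const _ c' + ContinuousMap.const _ c * w') (fun x => by simp [hw, hw']) ?_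
    rintro _ ⟨f, hf, g, hg, rfl⟩ x y
    refine eval_mul_sub_mem hTU c.2 c'.2 (w _).2 (w' _).2 ?_ ?_ (h f hf x y) (h' g hg x y)
    · have := h f hf y OnePoint.infty
      rw [eval_infty, sub_zero] at this
      exact T.smul_subset (by simp) (by exact_mod_cast hc (mem_range_self _)) this
    · have := h' g hg x OnePoint.infty
      rw [eval_infty, sub_zero] at this
      exact T'.smul_subset (by simp) (by exact_mod_cast hc' (mem_range_self _)) this

instance : IsCompleteConvexAlgebra (CZero M A) := isCompleteConvexAlgebra

theorem image_extendZero_eq (S : Set (CZero M A)) (x : OnePoint M) :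
    (fun f => f x) '' ((fun f : CZero M A => extendZero (f : M → A)) '' S) = eval x '' S := by
  rw [image_image]
  rfl

theorem upperSemicontinuous_spectralRadius (hA : IsLocallyMultiplicative A) {S : Set (CZero M A)}
    (hS : Bornology.IsBounded S) :
    UpperSemicontinuous fun x => spectralRadius (eval x '' S) := by
  obtain ⟨T, hT, -, w, hw, h⟩ := exists_disk hS Bornology.isBounded_empty
  simp only [← image_extendZero_eq]
  refine hA.upperSemicontinuous_spectralRadius hT w hw ?_
  rintro _ ⟨f, hf, rfl⟩
  exact h f hf

/-- For a bounded subset of `C₀(M, A)` whose values at every point have spectral radius less than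
`1`, some power is uniformly small in a multiplicatively closed disk. -/
theorem exists_setPow_subset (hA : IsLocallyMultiplicative A) {S : Set (CZero M A)}
    (hS : Bornology.IsBounded S) (hρ : ∀ x, spectralRadius (eval x '' S) < 1) {B : Set A}
    (hB : Bornology.IsBounded B) :
    ∃ V : Disk A, Bornology.IsBounded V.carrier ∧ V.carrier * V.carrier ⊆ V.carrier ∧
      ∃ c : ℝ, 0 < c ∧ B ⊆ c • V.carrier ∧
        ∃ m, ∀ x, eval x '' setPow S m ⊆ (1 / 2 : ℝ) • V.carrier := by
  obtain ⟨T, hT, -, w, hw, h⟩ := exists_disk hS Bornology.isBounded_empty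
  simp only [image_setPow]
  simp only [← image_extendZero_eq] at hρ ⊢
  refine hA.exists_setPow_subset hT w hw ?_ hρ hB
  rintro _ ⟨f, hf, rfl⟩
  exact h f hf

/-- A power of `S` has values in `V/2`, and such functions with a fixed estimator are closed under
multiplication. The bounded set so obtained contains all powers of that power. -/
theorem isBounded_iUnion_setPow (hA : IsLocallyMultiplicative A) {S : Set (CZero M A)}
    (hS : Bornology.IsBounded S) (hρ : ∀ x, spectralRadius (eval x '' S) < 1) :
    Bornology.IsBounded (⋃ n, setPow S n) := by
  obtain ⟨T, hT, -, w, hw, h⟩ := exists_disk hS Bornology.isBounded_empty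
  obtain ⟨V, hV, hVV, c, hc, hcV, m, hm⟩ := exists_setPow_subset hA hS hρ hT
  obtain ⟨K, hK⟩ := (isCompact_range w.continuous).bddAbove
  -- Each single power has a multiple of the same `w` as estimator. The constants may grow with `n`;
  -- only those for `m` are used.
  have hpow : ∀ n, ∃ a b : ℝ≥0, ∀ f ∈ setPow S n, (∀ x, eval x f ∈ (a : ℝ) • V.carrier) ∧
      ∀ x y, eval x f - eval y f ∈ ((b * w (x, y) : ℝ≥0) : ℝ) • V.carrier := by
    have hbase : ∀ f ∈ S, ∀ x y, eval x f - eval y f ∈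
        ((c.toNNReal * w (x, y) : ℝ≥0) : ℝ) • V.carrier := fun f hf x y => by
      have := Set.smul_set_mono hcV (h f hf x y)
      rwa [smul_smul, mul_comm, ← Real.coe_toNNReal c hc.le, ← NNReal.coe_mul] at this
    have hval : ∀ f ∈ S, ∀ x, eval x f ∈ ((c.toNNReal * K : ℝ≥0) : ℝ) • V.carrier := by
      intro f hf x
      have := hbase f hf x OnePoint.infty
      rw [eval_infty, sub_zero] at this
      exact V.smul_subset NNReal.zero_le_coe
        (NNReal.coe_le_coe.2 (mul_le_mul_right (hK (mem_range_self _)) _)) this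
    intro n
    induction n with
    | zero => exact ⟨_, _, fun f hf => ⟨hval f hf, hbase f hf⟩⟩
    | succ n ih =>
      obtain ⟨a, b, hab⟩ := ih
      refine ⟨a * (c.toNNReal * K), b * (c.toNNReal * K) + a * c.toNNReal, ?_⟩
      rintro _ ⟨f, hf, g, hg, rfl⟩
      refine ⟨fun x => ?_, fun x y => ?_⟩
      · simp only [map_mul, NNReal.coe_mul]
        have := mul_mem_smul hVV ((hab f hf).1 x) (hval g hg x)
        rwa [NNReal.coe_mul] at this
      · have := eval_mul_sub_mem hVV NNReal.zero_le_coe NNReal.zero_le_coe NNReal.zero_le_coe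
          NNReal.zero_le_coe ((hab f hf).1 y) (hval g hg x) ((hab f hf).2 x y) (hbase g hg x y)
        convert this using 2
        push_cast
        ring
  obtain ⟨a, b, hab⟩ := hpow m
  -- The bound `1 / 2` on values balances the two Leibniz terms: `b · 1/2 + 1/2 · b = b`.
  let N : Set (CZero M A) := {f | (∀ x, eval x f ∈ (1 / 2 : ℝ) • V.carrier) ∧
      ∀ x y, eval x f - eval y f ∈ ((b * w (x, y) : ℝ≥0) : ℝ) • V.carrier}
  have hNN : N * N ⊆ N := by
    rintro _ ⟨f, hf, g, hg, rfl⟩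
    refine ⟨fun x => ?_, fun x y => ?_⟩
    · simp only [map_mul]
      exact V.smul_subset (by norm_num) (by norm_num) (mul_mem_smul hVV (hf.1 x) (hg.1 x))
    · have := eval_mul_sub_mem hVV (by norm_num) (by norm_num) NNReal.zero_le_coe
          NNReal.zero_le_coe (hf.1 y) (hg.1 x) (hf.2 x y) (hg.2 x y)
      convert this using 2
      ring
  have hNb : Bornology.IsBounded N :=
    isBounded_of_disk V hV (ContinuousMap.const _ b * w) (fun x => by simp [hw])
      fun f hf x y => hf.2 x y
  have hSN : setPow S m ⊆ N := fun f hf =>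
    ⟨fun x => hm x (mem_image_of_mem _ hf), (hab f hf).2⟩
  exact isBounded_iUnion_setPow_of_setPow hS m
    (hNb.subset (iUnion_subset fun n => setPow_subset_of_mul_subset hSN hNN n))

end CZero

end CZero

end BornAlg

namespace BornAlg

/-! ### Limits of smooth functions and submultiplicative jet norms -/

section Calculus

variable {E F F' F'' : Type*} [NormedAddCommGroup E] [NormedSpace ℝ E]
  [NormedAddCommGroup F] [NormedSpace ℝ F] [NormedAddCommGroup F'] [NormedSpace ℝ F']
  [NormedAddCommGroup F''] [NormedSpace ℝ F'']

/-- A sequence of smooth functions on an open set that converges pointwise and whose derivatives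
of all orders are uniformly Cauchy has a smooth limit. -/
theorem contDiffOn_of_iteratedFDeriv_cauchy [CompleteSpace F] {f : ℕ → E → F} {g : E → F}
    {s : Set E} (hs : IsOpen s) (hf : ∀ n, ContDiffOn ℝ ∞ (f n) s)
    (hc : ∀ k : ℕ, ∃ C : ℝ, ∀ n m, n ≤ m → ∀ x ∈ s,
      ‖iteratedFDeriv ℝ k (f n) x - iteratedFDeriv ℝ k (f m) x‖ ≤ (1 / 2) ^ n * C)
    (hg : ∀ x ∈ s, Tendsto (fun n => f n x) atTop (𝓝 (g x))) :
    ContDiffOn ℝ ∞ g s ∧ ∀ k : ℕ, ∀ x ∈ s,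
      Tendsto (fun n => iteratedFDeriv ℝ k (f n) x) atTop (𝓝 (iteratedFDeriv ℝ k g x)) := by
  choose C hC using hc
  have hpow : ∀ a : ℝ, Tendsto (fun n : ℕ => (1 / 2 : ℝ) ^ n * a) atTop (𝓝 0) := fun a => by
    simpa using (tendsto_pow_atTop_nhds_zero_of_lt_one (by norm_num)
      (by norm_num : (1 / 2 : ℝ) < 1)).mul_const a
  have hcauchy : ∀ k : ℕ, ∀ x, x ∈ s → CauchySeq fun n => iteratedFDeriv ℝ k (f n) x := by
    intro k x hx
    refine cauchySeq_of_le_tendsto_0' _ (fun n m hnm => ?_) (hpow (C k))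
    rw [dist_eq_norm]
    exact hC k n m hnm x hx
  -- The limits are chosen as total functions; their values off `s` are irrelevant.
  have hex : ∀ (x : E) (k : ℕ), ∃ p : ContinuousMultilinearMap ℝ (fun _ : Fin k => E) F,
      x ∈ s → Tendsto (fun n => iteratedFDeriv ℝ k (f n) x) atTop (𝓝 p) := fun x k => by
    by_cases hx : x ∈ s
    · obtain ⟨p, hp⟩ := cauchySeq_tendsto_of_complete (hcauchy k x hx)
      exact ⟨p, fun _ => hp⟩
    · exact ⟨0, fun h => (hx h).elim⟩
  choose p hp using hex
  have hbound : ∀ (k n : ℕ), ∀ x ∈ s, ‖iteratedFDeriv ℝ k (f n) x - p x k‖ ≤ (1 / 2) ^ n * C k := by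
    intro k n x hx
    refine le_of_tendsto ((tendsto_const_nhds.sub (hp x k hx)).norm) ?_
    filter_upwards [eventually_ge_atTop n] with m hm
    exact hC k n m hm x hx
  have hunif : ∀ k : ℕ, TendstoUniformlyOn (fun n x => iteratedFDeriv ℝ k (f n) x)
      (fun x => p x k) atTop s := by
    intro k
    rw [Metric.tendstoUniformlyOn_iff]
    intro ε hε
    filter_upwards [(hpow (C k)).eventually_lt_const hε] with n hn x hx
    rw [dist_comm, dist_eq_norm]
    exact (hbound k n x hx).trans_lt hn
  have hT : ∀ n, HasFTaylorSeriesUpToOn ∞ (f n) (ftaylorSeriesWithin ℝ (f n) s) s := fun n =>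
    (hf n).ftaylorSeriesWithin hs.uniqueDiffOn
  have hw : ∀ (n k : ℕ), ∀ x ∈ s, ftaylorSeriesWithin ℝ (f n) s x k = iteratedFDeriv ℝ k (f n) x :=
    fun n k x hx => iteratedFDerivWithin_of_isOpen k hs hx
  have hcont : ∀ n k, ContinuousOn (fun x => iteratedFDeriv ℝ k (f n) x) s := fun n k =>
    ((hT n).cont k (by exact_mod_cast le_top)).congr fun x hx => (hw n k x hx).symm
  -- The limits of the derivatives form a Taylor series of `g`: uniform convergence of order `m + 1`
  -- permits differentiating the limit of order `m`.
  have key : HasFTaylorSeriesUpToOn ∞ g p s := by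
    refine ⟨fun x hx => ?_, fun m _ x hx => ?_, fun m _ => ?_⟩
    · refine tendsto_nhds_unique ?_ (hg x hx)
      have h := ((continuousMultilinearCurryFin0 ℝ E F).continuous.tendsto _).comp (hp x 0 hx)
      refine h.congr fun n => ?_
      simp [iteratedFDeriv_zero_eq_comp]
    · have hderiv : ∀ n, ∀ x ∈ s, HasFDerivAt (fun x => iteratedFDeriv ℝ m (f n) x)
          (iteratedFDeriv ℝ m.succ (f n) x).curryLeft x := by
        intro n x hx
        have h := ((hT n).fderivWithin m (by exact_mod_cast ENat.natCast_lt_top m) x hx).hasFDerivAt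
          (hs.mem_nhds hx)
        rw [hw n m.succ x hx] at h
        refine h.congr_of_eventuallyEq ?_
        filter_upwards [hs.mem_nhds hx] with y hy
        exact (hw n m y hy).symm
      have hunif' : TendstoUniformlyOn
          (fun n x => (iteratedFDeriv ℝ m.succ (f n) x).curryLeft)
          (fun x => (p x m.succ).curryLeft) atTop s :=
        (continuousMultilinearCurryLeftEquiv ℝ (fun _ : Fin m.succ => E)
          F).isometry.uniformContinuous.comp_tendstoUniformlyOn (hunif m.succ)
      exact (hasFDerivAt_of_tendstoUniformlyOn hs hunif' hderiv (fun x hx => hp x m hx)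
        hx).hasFDerivWithinAt
    · exact (hunif m).continuousOn (Frequently.of_forall fun n => hcont n m)
  have hg' : ContDiffOn ℝ ∞ g s := key.contDiffOn
  refine ⟨hg', fun k x hx => ?_⟩
  have h := key.eq_iteratedFDerivWithin_of_uniqueDiffOn (m := k) (by exact_mod_cast le_top)
    hs.uniqueDiffOn hx
  rw [iteratedFDerivWithin_of_isOpen k hs hx] at h
  rw [← h]
  exact hp x k hx

theorem norm_iteratedFDeriv_bilinear_le (B : F →L[ℝ] F' →L[ℝ] F'') {f : E → F} {g : E → F'}
    {s : Set E} (hs : IsOpen s) (hf : ContDiffOn ℝ ∞ f s) (hg : ContDiffOn ℝ ∞ g s) {x : E}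
    (hx : x ∈ s) (k : ℕ) :
    ‖iteratedFDeriv ℝ k (fun y => B (f y) (g y)) x‖ ≤ ‖B‖ * ∑ i ∈ Finset.range (k + 1),
      (k.choose i : ℝ) * ‖iteratedFDeriv ℝ i f x‖ * ‖iteratedFDeriv ℝ (k - i) g x‖ := by
  have h := B.norm_iteratedFDerivWithin_le_of_bilinear hf hg hs.uniqueDiffOn hx (n := k)
    (by exact_mod_cast le_top)
  simpa only [iteratedFDerivWithin_of_isOpen _ hs hx] using h

/-- The norms `∑ j ≤ k, λ ^ j / j! ‖D ^ j f x‖`. -/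
def jetNorm (k : ℕ) (l : ℝ) (f : E → F) (x : E) : ℝ :=
  ∑ j ∈ Finset.range (k + 1), l ^ j / (j.factorial : ℝ) * ‖iteratedFDeriv ℝ j f x‖

/-- The norms `jetNorm` are submultiplicative. -/
theorem jetNorm_bilinear_le (B : F →L[ℝ] F' →L[ℝ] F'') (hB : ‖B‖ ≤ 1) {f : E → F} {g : E → F'}
    {s : Set E} (hs : IsOpen s) (hf : ContDiffOn ℝ ∞ f s) (hg : ContDiffOn ℝ ∞ g s) {x : E}
    (hx : x ∈ s) (k : ℕ) {l : ℝ} (hl : 0 ≤ l) :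
    jetNorm k l (fun y => B (f y) (g y)) x ≤ jetNorm k l f x * jetNorm k l g x := by
  let a : ℕ → ℝ := fun j => l ^ j / (j.factorial : ℝ) * ‖iteratedFDeriv ℝ j f x‖
  let b : ℕ → ℝ := fun j => l ^ j / (j.factorial : ℝ) * ‖iteratedFDeriv ℝ j g x‖
  have ha : ∀ j, 0 ≤ a j := fun j => by positivity
  have hb : ∀ j, 0 ≤ b j := fun j => by positivity
  -- The weights absorb the binomial coefficients, `(j choose i) / j! = 1 / (i! (j - i)!)`. The
  -- Leibniz rule thus becomes a Cauchy product over a triangle, which is then enlarged to the full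
  -- square of nonnegative terms.
  calc jetNorm k l (fun y => B (f y) (g y)) x
      ≤ ∑ j ∈ Finset.range (k + 1), ∑ i ∈ Finset.range (j + 1), a i * b (j - i) := by
        refine Finset.sum_le_sum fun j _ => ?_
        have h := norm_iteratedFDeriv_bilinear_le B hs hf hg hx j
        have h' := h.trans (mul_le_of_le_one_left (by positivity) hB)
        refine (mul_le_mul_of_nonneg_left h' (by positivity)).trans_eq ?_
        rw [Finset.mul_sum]
        refine Finset.sum_congr rfl fun i hi => ?_
        have hij : i ≤ j := Nat.lt_succ_iff.1 (Finset.mem_range.1 hi)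
        have hl' : l ^ j = l ^ i * l ^ (j - i) := by rw [← pow_add, Nat.add_sub_cancel' hij]
        simp only [a, b]
        rw [Nat.cast_choose ℝ hij, hl']
        have h1 : (j.factorial : ℝ) ≠ 0 := by positivity
        have h2 : (i.factorial : ℝ) ≠ 0 := by positivity
        have h3 : ((j - i).factorial : ℝ) ≠ 0 := by positivity
        field_simp
    _ = ∑ i ∈ Finset.range (k + 1), ∑ j ∈ Finset.range (k + 1 - i), a i * b j :=
        Finset.sum_range_diag_flip (k + 1) fun i j => a i * b j
    _ ≤ ∑ i ∈ Finset.range (k + 1), ∑ j ∈ Finset.range (k + 1), a i * b j := by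
        refine Finset.sum_le_sum fun i _ => Finset.sum_le_sum_of_subset_of_nonneg
          (Finset.range_mono (Nat.sub_le _ _)) fun j _ _ => mul_nonneg (ha i) (hb j)
    _ = jetNorm k l f x * jetNorm k l g x := (Finset.sum_mul_sum _ _ _ _).symm

theorem norm_iteratedFDeriv_le_of_jetNorm {k : ℕ} {l : ℝ} (hl : 0 < l) {f : E → F} {x : E} {C : ℝ}
    (h : jetNorm k l f x ≤ C) : ‖iteratedFDeriv ℝ k f x‖ ≤ k.factorial / l ^ k * C := by
  have h1 : l ^ k / (k.factorial : ℝ) * ‖iteratedFDeriv ℝ k f x‖ ≤ C := by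
    refine le_trans ?_ h
    exact Finset.single_le_sum
      (f := fun j : ℕ => l ^ j / (j.factorial : ℝ) * ‖iteratedFDeriv ℝ j f x‖)
      (fun j _ => by positivity) (Finset.self_mem_range_succ k)
  have h2 : 0 < (k.factorial : ℝ) / l ^ k := by positivity
  refine le_trans (le_of_eq ?_) (mul_le_mul_of_nonneg_left h1 h2.le)
  field_simp

/-- If the value is at most `1 / 2` and the derivatives are bounded, then `jetNorm` is at most `1`
for small `λ`. -/
theorem exists_jetNorm_le_one (k : ℕ) (C : ℕ → ℝ) :
    ∃ l : ℝ, 0 < l ∧ ∀ (f : E → F) (x : E), ‖f x‖ ≤ 1 / 2 →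
      (∀ j, ‖iteratedFDeriv ℝ j f x‖ ≤ C j) → jetNorm k l f x ≤ 1 := by
  -- All terms of positive order carry a factor `l` and can be made at most `1 / 2` together. The
  -- choice of `l` uses only `k` and the constants `C`, so it is uniform in `f` and `x`.
  have hlim : Tendsto (fun l : ℝ => ∑ j ∈ Finset.range k,
      l ^ (j + 1) / ((j + 1).factorial : ℝ) * C (j + 1)) (𝓝[>] 0) (𝓝 0) := by
    have hcont : Continuous fun l : ℝ => ∑ j ∈ Finset.range k,
      l ^ (j + 1) / ((j + 1).factorial : ℝ) * C (j + 1) := by fun_prop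
    have := hcont.tendsto 0
    simp only [ne_eq, Nat.succ_ne_zero, not_false_eq_true, zero_pow, zero_div, zero_mul,
      Finset.sum_const_zero] at this
    exact this.mono_left nhdsWithin_le_nhds
  obtain ⟨l, hl, hl0⟩ := ((hlim.eventually_le_const (by norm_num : (0 : ℝ) < 1 / 2)).and
    self_mem_nhdsWithin).exists
  have hl0' : 0 < l := hl0
  refine ⟨l, hl0', fun f x hf h => ?_⟩
  rw [jetNorm, Finset.sum_range_succ']
  have h1 : ∑ j ∈ Finset.range k, l ^ (j + 1) / ((j + 1).factorial : ℝ) *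
      ‖iteratedFDeriv ℝ (j + 1) f x‖ ≤ 1 / 2 := by
    refine le_trans (Finset.sum_le_sum fun j _ => ?_) hl
    exact mul_le_mul_of_nonneg_left (h _) (by positivity)
  have h2 : l ^ 0 / (Nat.factorial 0 : ℝ) * ‖iteratedFDeriv ℝ 0 f x‖ ≤ 1 / 2 := by
    simpa using hf
  linarith

end Calculus

end BornAlg

namespace BornAlg

/-- The map `V_T → V_U` for `T ⊆ c U`. -/
def Disk.inclusionSMul {V : Type*} [AddCommGroup V] [Module ℂ V] {T U : Disk V} {c : ℝ}
    (hc : 0 ≤ c) (h : T.carrier ⊆ c • U.carrier) : T.Space →L[ℝ] U.Space :=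
  have hmem (x : T.Space) : T.incl x ∈ Submodule.span ℂ U.carrier := by
    have h1 : Submodule.span ℂ T.carrier ≤ Submodule.span ℂ U.carrier := by
      rw [Submodule.span_le]
      intro y hy
      obtain ⟨u, hu, rfl⟩ := h hy
      exact Submodule.smul_mem _ (c : ℂ) (Submodule.subset_span hu)
    exact h1 x.2
  LinearMap.mkContinuous
    { toFun := fun x => ((⟨T.incl x, hmem x⟩ : Submodule.span ℂ U.carrier) : U.Space)
      map_add' := fun _ _ => rfl
      map_smul' := fun _ _ => rfl } c
    (fun x => by
      refine U.norm_le_of_mem (by positivity) ?_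
      rw [mul_comm, mul_smul]
      exact Set.smul_set_mono h (T.mem_norm_smul x))

theorem Disk.incl_inclusionSMul {V : Type*} [AddCommGroup V] [Module ℂ V] {T U : Disk V} {c : ℝ}
    (hc : 0 ≤ c) (h : T.carrier ⊆ c • U.carrier) (x : T.Space) :
    U.incl (Disk.inclusionSMul hc h x) = T.incl x := rfl

theorem Disk.norm_mulMap_le {A : Type*} [NonUnitalRing A] [Module ℂ A] [IsScalarTower ℂ A A]
    [SMulCommClass ℂ A A] {T T' U : Disk A} (h : T.carrier * T'.carrier ⊆ U.carrier) :
    ‖Disk.mulMap h‖ ≤ 1 :=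
  (Disk.mulMap h).opNorm_le_bound₂ zero_le_one fun x y => by
    rw [one_mul]
    exact U.norm_le_of_mem (by positivity)
      (mul_mem_smul h (T.mem_norm_smul x) (T'.mem_norm_smul y))

/-! ### Smooth functions in charts -/

section Manifold

/-- Closed balls are compact in finite dimension, so bounds on compact subsets of chart domains give
uniform bounds near each point. -/
theorem exists_closedBall_subset_target {E M : Type*} [NormedAddCommGroup E] [NormedSpace ℝ E]
    [FiniteDimensional ℝ E] [TopologicalSpace M] {e : OpenPartialHomeomorph M E}
    {x : M} (hx : x ∈ e.source) : ∃ r : ℝ, 0 < r ∧ Metric.closedBall (e x) r ⊆ e.target ∧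
      IsCompact (e.symm '' Metric.closedBall (e x) r) ∧
      e.symm '' Metric.closedBall (e x) r ⊆ e.source := by
  have : ProperSpace E := FiniteDimensional.proper_real E
  obtain ⟨r, hr, h⟩ := Metric.nhds_basis_closedBall.mem_iff.1
    (e.open_target.mem_nhds (e.map_source hx))
  refine ⟨r, hr, h, (isCompact_closedBall _ _).image_of_continuousOn
    (e.continuousOn_symm.mono h), ?_⟩
  rintro _ ⟨y, hy, rfl⟩
  exact e.map_target (h hy)

variable {E : Type*} [NormedAddCommGroup E] [NormedSpace ℝ E]
  {M : Type*} [TopologicalSpace M] [ChartedSpace E M] [IsManifold 𝓘(ℝ, E) ∞ M]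
  {F F' F'' : Type*} [NormedAddCommGroup F] [NormedSpace ℝ F] [NormedAddCommGroup F']
  [NormedSpace ℝ F'] [NormedAddCommGroup F''] [NormedSpace ℝ F'']

theorem contDiffOn_of_mem_atlas {g : M → F} (hg : ContMDiff 𝓘(ℝ, E) 𝓘(ℝ, F) ∞ g)
    {e : OpenPartialHomeomorph M E} (he : e ∈ atlas E M) :
    ContDiffOn ℝ ∞ (g ∘ e.symm) e.target :=
  fun _ hy => (contDiffAt_of_mem_atlas hg he hy).contDiffWithinAt

theorem contMDiff_of_contDiffAt_chartAt {g : M → F}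
    (h : ∀ x, ContDiffAt ℝ ∞ (g ∘ (chartAt E x).symm) (chartAt E x x)) :
    ContMDiff 𝓘(ℝ, E) 𝓘(ℝ, F) ∞ g := by
  intro x
  have h1 : ContMDiffAt 𝓘(ℝ, E) 𝓘(ℝ, E) ∞ (chartAt E x) x :=
    contMDiffAt_of_mem_maximalAtlas (IsManifold.chart_mem_maximalAtlas x) (mem_chart_source E x)
  have h2 := (h x).contMDiffAt.comp x h1
  refine h2.congr_of_eventuallyEq ?_
  filter_upwards [(chartAt E x).open_source.mem_nhds (mem_chart_source E x)] with y hy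
  simp [(chartAt E x).left_inv hy]

theorem IsBoundedSmooth.bilinear (B : F →L[ℝ] F' →L[ℝ] F'') {G : Set (M → F)} {G' : Set (M → F')}
    (hG : IsBoundedSmooth E G) (hG' : IsBoundedSmooth E G') :
    IsBoundedSmooth E (image2 (fun g g' x => B (g x) (g' x)) G G') := by
  refine ⟨?_, fun e he L hL hLe k => ?_⟩
  · rintro _ ⟨g, hg, g', hg', rfl⟩
    exact (B.contMDiff.comp (hG.1 g hg)).clm_apply (hG'.1 g' hg')
  · choose C hC using hG.2 e he L hL hLe
    choose C' hC' using hG'.2 e he L hL hLe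
    -- The chosen constants could be negative if there is nothing to bound, hence the absolute
    -- values.
    refine ⟨‖B‖ * ∑ i ∈ Finset.range (k + 1), (k.choose i : ℝ) * |C i| * |C' (k - i)|, ?_⟩
    rintro _ ⟨g, hg, g', hg', rfl⟩ x hx
    refine (norm_iteratedFDeriv_bilinear_le B e.open_target (contDiffOn_of_mem_atlas (hG.1 g hg) he)
      (contDiffOn_of_mem_atlas (hG'.1 g' hg') he) (e.map_source (hLe hx)) k).trans ?_
    gcongr with i hi
    · exact (hC i g hg x hx).trans (le_abs_self _)
    · exact (hC' (k - i) g' hg' x hx).trans (le_abs_self _)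

/-- Smooth functions on a manifold whose derivatives in charts are uniformly Cauchy on compact
subsets converge to a smooth function. -/
theorem exists_contMDiff_limit [FiniteDimensional ℝ E] [CompleteSpace F] {g : ℕ → M → F}
    (hg : ∀ n, ContMDiff 𝓘(ℝ, E) 𝓘(ℝ, F) ∞ (g n))
    {C : OpenPartialHomeomorph M E → Set M → ℕ → ℝ}
    (hC : ∀ e ∈ atlas E M, ∀ L : Set M, IsCompact L → L ⊆ e.source → ∀ k n m : ℕ, n ≤ m → ∀ x ∈ L,
      ‖iteratedFDeriv ℝ k (g n ∘ e.symm) (e x) - iteratedFDeriv ℝ k (g m ∘ e.symm) (e x)‖ ≤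
        (1 / 2) ^ n * C e L k) :
    ∃ h : M → F, ContMDiff 𝓘(ℝ, E) 𝓘(ℝ, F) ∞ h ∧
      (∀ x, Tendsto (fun n => g n x) atTop (𝓝 (h x))) ∧
      ∀ e ∈ atlas E M, ∀ x ∈ e.source, ∀ k : ℕ,
        Tendsto (fun n => iteratedFDeriv ℝ k (g n ∘ e.symm) (e x)) atTop
          (𝓝 (iteratedFDeriv ℝ k (h ∘ e.symm) (e x))) := by
  have hcauchy : ∀ x : M, CauchySeq fun n => g n x := fun x => by
    have he := chart_mem_atlas E x
    have hx := mem_chart_source E x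
    refine cauchySeq_of_le_tendsto_0' (fun n => (1 / 2 : ℝ) ^ n * C (chartAt E x) {x} 0) ?_ ?_
    · intro n m hnm
      have h := hC _ he {x} isCompact_singleton (by simp) 0 n m hnm x rfl
      have hs : ∀ n, ContDiffAt ℝ ((0 : ℕ) : ℕ∞ω) (g n ∘ (chartAt E x).symm) (chartAt E x x) :=
        fun n => (contDiffAt_of_mem_atlas (hg n) he ((chartAt E x).map_source hx)).of_le
          (by exact_mod_cast le_top)
      rw [← iteratedFDeriv_sub_apply (hs n) (hs m), norm_iteratedFDeriv_zero] at h
      simpa [dist_eq_norm, (chartAt E x).left_inv hx] using h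
    · rw [← zero_mul (C (chartAt E x) {x} 0)]
      exact (tendsto_pow_atTop_nhds_zero_of_lt_one (by norm_num)
        (by norm_num : (1 / 2 : ℝ) < 1)).mul_const _
  choose h hh using fun x => cauchySeq_tendsto_of_complete (hcauchy x)
  have key : ∀ e ∈ atlas E M, ∀ x ∈ e.source, ContDiffAt ℝ ∞ (h ∘ e.symm) (e x) ∧ ∀ k : ℕ,
      Tendsto (fun n => iteratedFDeriv ℝ k (g n ∘ e.symm) (e x)) atTop
        (𝓝 (iteratedFDeriv ℝ k (h ∘ e.symm) (e x))) := by
    intro e he x hx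
    obtain ⟨r, hr, hrt, hcomp, hrs⟩ := exists_closedBall_subset_target hx
    have hsub : Metric.ball (e x) r ⊆ e.target := Metric.ball_subset_closedBall.trans hrt
    obtain ⟨h1, h2⟩ := contDiffOn_of_iteratedFDeriv_cauchy (f := fun n => g n ∘ e.symm)
      (g := h ∘ e.symm) (s := Metric.ball (e x) r) Metric.isOpen_ball
      (fun n => (contDiffOn_of_mem_atlas (hg n) he).mono hsub)
      (fun k => ⟨C e (e.symm '' Metric.closedBall (e x) r) k, fun n m hnm y hy => by
        have := hC e he _ hcomp hrs k n m hnm (e.symm y)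
          ⟨y, Metric.ball_subset_closedBall hy, rfl⟩
        rwa [e.right_inv (hsub hy)] at this⟩)
      (fun y _ => hh (e.symm y))
    have hxb : e x ∈ Metric.ball (e x) r := Metric.mem_ball_self hr
    exact ⟨h1.contDiffAt (Metric.isOpen_ball.mem_nhds hxb), fun k => h2 k _ hxb⟩
  exact ⟨h, contMDiff_of_contDiffAt_chartAt fun x =>
    (key _ (chart_mem_atlas E x) x (mem_chart_source E x)).1, hh,
    fun e he x hx => (key e he x hx).2⟩

end Manifold

/-! ### The algebra `D(M, A)` -/

namespace SmoothCompact

variable {E : Type*} [NormedAddCommGroup E] [NormedSpace ℝ E]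
  {M : Type*} [TopologicalSpace M] [ChartedSpace E M]
  {A : Type*} [NonUnitalRing A] [Module ℂ A]

/-- Smooth functions `M → A_T` that vanish outside `K`. -/
def lifts (E : Type*) [NormedAddCommGroup E] [NormedSpace ℝ E] [ChartedSpace E M] (K : Set M)
    (T : Disk A) : Submodule ℂ (M → T.Space) where
  carrier := {g | ContMDiff 𝓘(ℝ, E) 𝓘(ℝ, T.Space) ∞ g ∧ ∀ x ∉ K, g x = 0}
  zero_mem' := ⟨contMDiff_const, fun _ _ => rfl⟩
  add_mem' hf hg := ⟨hf.1.add hg.1, fun x hx => by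
    rw [Pi.add_apply, hf.2 x hx, hg.2 x hx, add_zero]⟩
  smul_mem' c g hg := ⟨((ContinuousLinearMap.restrictScalars ℝ
      (c • ContinuousLinearMap.id ℂ T.Space)).contMDiff).comp hg.1, fun x hx => by
    rw [Pi.smul_apply, hg.2 x hx, smul_zero]⟩

/-- Charts `e`, compact subsets `L` of their domains, orders `k` and points `x ∈ L`. -/
def ChartIndex (E M : Type*) [NormedAddCommGroup E] [TopologicalSpace M] [ChartedSpace E M] :
    Type _ :=
  {i : OpenPartialHomeomorph M E × Set M × ℕ × M //
    i.1 ∈ atlas E M ∧ IsCompact i.2.1 ∧ i.2.1 ⊆ i.1.source ∧ i.2.2.2 ∈ i.2.1}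

section

variable [IsManifold 𝓘(ℝ, E) ∞ M]

/-- The seminorms `‖D ^ k (g ∘ e⁻¹) (e x)‖`. -/
def derivSeminorm (K : Set M) (T : Disk A) (i : ChartIndex E M) : Seminorm ℂ (lifts E K T) :=
  have h (g : lifts E K T) : ContDiffAt ℝ (i.1.2.2.1 : ℕ∞ω) (g.1 ∘ i.1.1.symm)
      (i.1.1 i.1.2.2.2) :=
    (contDiffAt_of_mem_atlas g.2.1 i.2.1 (i.1.1.map_source (i.2.2.2.1 i.2.2.2.2))).of_le
      (by exact_mod_cast le_top)
  Seminorm.of (fun g => ‖iteratedFDeriv ℝ i.1.2.2.1 (g.1 ∘ i.1.1.symm) (i.1.1 i.1.2.2.2)‖)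
    (fun f g => by
      have := iteratedFDeriv_add_apply (h f) (h g)
      exact (congrArg norm this).trans_le (norm_add_le _ _))
    (fun c g => by
      have := iteratedFDeriv_const_smul_apply (a := c) (h g)
      exact (congrArg norm this).trans (norm_smul _ _))

theorem eq_zero_of_derivSeminorm (K : Set M) (T : Disk A) (g : lifts E K T)
    (h : ∀ i, derivSeminorm K T i g = 0) : g = 0 := by
  refine Subtype.ext (funext fun x => ?_)
  have h0 := h ⟨(chartAt E x, {x}, 0, x), chart_mem_atlas E x, isCompact_singleton,
    by simp, rfl⟩
  change ‖iteratedFDeriv ℝ 0 (g.1 ∘ (chartAt E x).symm) (chartAt E x x)‖ = 0 at h0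
  rw [norm_iteratedFDeriv_zero, norm_eq_zero] at h0
  simpa using h0

end

variable [IsScalarTower ℂ A A] [SMulCommClass ℂ A A] [Bornology A] [IsCompleteConvexAlgebra A]

theorem ext {f g : SmoothCompact E M A} (h : ∀ x : M, f x = g x) : f = g := Subtype.ext (funext h)

/-- The map from smooth functions `M → A_T` that vanish outside `K` to `D(M, A)`. -/
def ofLifts {K : Set M} (hK : IsCompact K) {T : Disk A} (hT : Bornology.IsBounded T.carrier) :
    lifts E K T →ₗ[ℂ] SmoothCompact E M A where
  toFun g := (⟨fun x => T.incl (g.1 x), K, hK, T, hT, g.1, g.2.1, fun _ => rfl, fun x hx => by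
    change T.incl (g.1 x) = 0
    rw [g.2.2 x hx, map_zero]⟩ : smoothCompactSubalgebra E M A)
  map_add' f g := ext fun x => T.incl.map_add (f.1 x) (g.1 x)
  map_smul' c g := ext fun x => T.incl.map_smul c (g.1 x)

theorem ofLifts_apply {K : Set M} (hK : IsCompact K) {T : Disk A}
    (hT : Bornology.IsBounded T.carrier) (g : lifts E K T) (x : M) :
    ofLifts hK hT g x = T.incl (g.1 x) := rfl

theorem ofLifts_injective {K : Set M} (hK : IsCompact K) {T : Disk A}
    (hT : Bornology.IsBounded T.carrier) : Function.Injective (ofLifts (E := E) hK hT) := by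
  intro f g h
  refine Subtype.ext (funext fun x => T.incl_injective ?_)
  exact congrArg (fun f : SmoothCompact E M A => f x) h

variable [IsManifold 𝓘(ℝ, E) ∞ M]

/-- The family `G` may contain more than the lifts of `S`, and functions not supported in `K`.
Discarding the latter and passing to a subset reaches the definition of the bornology. -/
theorem isBounded_of_lifts {S : Set (SmoothCompact E M A)} {K : Set M} (hK : IsCompact K)
    {T : Disk A} (hT : Bornology.IsBounded T.carrier) {G : Set (M → T.Space)}
    (hG : IsBoundedSmooth E G)
    (h : ∀ f ∈ S, (∃ g ∈ G, ∀ x, T.incl (g x) = f x) ∧ ∀ x ∉ K, f x = 0) :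
    Bornology.IsBounded S := by
  rw [isBounded_iff]
  refine IsBoundedSmoothCompact.subset (S' := (fun g x => T.incl (g x)) ''
    (G ∩ {g | ∀ x ∉ K, T.incl (g x) = 0})) ⟨K, hK, T, hT, _, ⟨fun g hg => hG.1 g hg.1,
      fun e he L hL hLe k => ?_⟩, rfl, ?_⟩ ?_
  · obtain ⟨C, hC⟩ := hG.2 e he L hL hLe k
    exact ⟨C, fun g hg => hC g hg.1⟩
  · rintro _ ⟨g, hg, rfl⟩
    exact hg.2
  · rintro _ ⟨f, hf, rfl⟩
    obtain ⟨⟨g, hg, hgf⟩, h0⟩ := h f hf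
    exact ⟨g, ⟨hg, fun x hx => (hgf x).trans (h0 x hx)⟩, funext hgf⟩

/-- Enlarging the disk to a complete one costs nothing, because the inclusion of normed spaces is
linear and continuous and hence preserves derivative bounds. -/
theorem exists_lifts {S : Set (SmoothCompact E M A)} (hS : Bornology.IsBounded S) :
    ∃ K : Set M, IsCompact K ∧ ∃ T : Disk A, Bornology.IsBounded T.carrier ∧
      CompleteSpace T.Space ∧ ∃ G : Set (M → T.Space), IsBoundedSmooth E G ∧
        ∀ f ∈ S, (∃ g ∈ G, ∀ x, T.incl (g x) = f x) ∧ ∀ x ∉ K, f x = 0 := by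
  rw [isBounded_iff] at hS
  obtain ⟨K, hK, T, hT, G, hG, hSG, h⟩ := hS
  obtain ⟨U, hU, hTU, hUc⟩ := IsCompleteConvex.exists_complete_disk _ hT
  refine ⟨K, hK, U, hU, hUc, _, hG.comp (Disk.inclusion hTU), fun f hf => ?_⟩
  have hf' : (f : M → A) ∈ (fun f : SmoothCompact E M A => (f : M → A)) '' S :=
    mem_image_of_mem _ hf
  refine ⟨?_, h _ hf'⟩
  rw [hSG] at hf'
  obtain ⟨g, hg, hgf⟩ := hf'
  exact ⟨_, mem_image_of_mem _ hg, fun x => congrFun hgf x⟩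

/-- The disk of all smooth functions `M → A_T` that vanish outside `K` and whose derivatives
satisfy given bounds. -/
def derivDisk {K : Set M} (hK : IsCompact K) {T : Disk A} (hT : Bornology.IsBounded T.carrier)
    (C : OpenPartialHomeomorph M E → Set M → ℕ → ℝ≥0) : Disk (SmoothCompact E M A) :=
  Disk.ofSeminorms (ofLifts hK hT) (ofLifts_injective hK hT) (derivSeminorm K T)
    (fun i => C i.1.1 i.1.2.1 i.1.2.2.1) (fun _ => (C _ _ _).2) (eq_zero_of_derivSeminorm K T)

theorem isBounded_derivDisk {K : Set M} (hK : IsCompact K) {T : Disk A}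
    (hT : Bornology.IsBounded T.carrier) (C : OpenPartialHomeomorph M E → Set M → ℕ → ℝ≥0) :
    Bornology.IsBounded (derivDisk hK hT C).carrier := by
  refine isBounded_of_lifts (G := {g | ∃ h : g ∈ lifts E K T, ∀ i, derivSeminorm K T i ⟨g, h⟩ ≤
    C i.1.1 i.1.2.1 i.1.2.2.1}) hK hT ⟨fun g hg => hg.1.1, fun e he L hL hLe k => ?_⟩ ?_
  · refine ⟨C e L k, ?_⟩
    rintro g ⟨hg, hgC⟩ x hx
    exact hgC ⟨(e, L, k, x), he, hL, hLe, hx⟩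
  · rintro _ ⟨g, hg, rfl⟩
    refine ⟨⟨g.1, ⟨g.2, hg⟩, fun x => rfl⟩, fun x hx => ?_⟩
    rw [ofLifts_apply, g.2.2 x hx, map_zero]

/-- Control in the disk makes all chart derivatives uniformly Cauchy on compact sets, so the limit
is smooth. Its support condition and the derivative bounds follow pointwise. -/
theorem completeSpace_derivDisk [FiniteDimensional ℝ E] {K : Set M} (hK : IsCompact K) {T : Disk A}
    (hT : Bornology.IsBounded T.carrier) [CompleteSpace T.Space]
    (C : OpenPartialHomeomorph M E → Set M → ℕ → ℝ≥0) :
    CompleteSpace (derivDisk hK hT C).Space := by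
  refine Disk.completeSpace_ofSeminorms _ _ _ _ _ _ fun g hg => ?_
  have hsub : ∀ (f f' : lifts E K T) (e : OpenPartialHomeomorph M E), e ∈ atlas E M →
      ∀ (x : M), x ∈ e.source → ∀ k : ℕ, iteratedFDeriv ℝ k ((f - f').1 ∘ e.symm) (e x) =
        iteratedFDeriv ℝ k (f.1 ∘ e.symm) (e x) - iteratedFDeriv ℝ k (f'.1 ∘ e.symm) (e x) := by
    intro f f' e he x hx k
    have h : ∀ f : lifts E K T, ContDiffAt ℝ (k : ℕ∞ω) (f.1 ∘ e.symm) (e x) := fun f =>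
      (contDiffAt_of_mem_atlas f.2.1 he (e.map_source hx)).of_le (by exact_mod_cast le_top)
    exact iteratedFDeriv_sub_apply (h f) (h f')
  obtain ⟨h, hsm, hlim, hderiv⟩ := exists_contMDiff_limit (g := fun n => (g n).1)
    (C := fun e L k => C e L k) (fun n => (g n).2.1) fun e he L hL hLe k n m hnm x hx => by
      rw [← hsub _ _ e he x (hLe hx)]
      exact hg n m hnm ⟨(e, L, k, x), he, hL, hLe, hx⟩
  have hK0 : ∀ x ∉ K, h x = 0 := fun x hx =>
    tendsto_nhds_unique (hlim x) (tendsto_const_nhds.congr fun n => ((g n).2.2 x hx).symm)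
  refine ⟨⟨h, hsm, hK0⟩, ?_⟩
  rintro n ⟨⟨e, L, k, x⟩, he, hL, hLe, hx⟩
  change ‖iteratedFDeriv ℝ k ((g n - ⟨h, hsm, hK0⟩ : lifts E K T).1 ∘ e.symm) (e x)‖ ≤ _
  rw [hsub _ _ e he x (hLe hx)]
  refine le_of_tendsto ((tendsto_const_nhds.sub (hderiv e he x (hLe hx) k)).norm) ?_
  filter_upwards [eventually_ge_atTop n] with m hm
  rw [← hsub _ _ e he x (hLe hx)]
  exact hg n m hm ⟨(e, L, k, x), he, hL, hLe, hx⟩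

theorem exists_complete_disk [FiniteDimensional ℝ E] {S : Set (SmoothCompact E M A)}
    (hS : Bornology.IsBounded S) : ∃ T : Disk (SmoothCompact E M A),
      Bornology.IsBounded T.carrier ∧ S ⊆ T.carrier ∧ CompleteSpace T.Space := by
  obtain ⟨K, hK, T, hT, hTc, G, hG, h⟩ := exists_lifts hS
  -- `derivDisk` wants bounds for all triples; those that are not a chart with a compact subset of
  -- its domain get the dummy value `0`.
  have hex : ∀ (e : OpenPartialHomeomorph M E) (L : Set M) (k : ℕ), ∃ C : ℝ≥0, e ∈ atlas E M →
      IsCompact L → L ⊆ e.source → ∀ g ∈ G, ∀ x ∈ L,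
        ‖iteratedFDeriv ℝ k (g ∘ e.symm) (e x)‖ ≤ C := by
    intro e L k
    by_cases he : e ∈ atlas E M ∧ IsCompact L ∧ L ⊆ e.source
    · obtain ⟨C, hC⟩ := hG.2 e he.1 L he.2.1 he.2.2 k
      exact ⟨C.toNNReal, fun _ _ _ g hg x hx => (hC g hg x hx).trans (Real.le_coe_toNNReal C)⟩
    · exact ⟨0, fun h1 h2 h3 => (he ⟨h1, h2, h3⟩).elim⟩
  choose C hC using hex
  refine ⟨derivDisk hK hT C, isBounded_derivDisk hK hT C, fun f hf => ?_,
    completeSpace_derivDisk hK hT C⟩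
  obtain ⟨⟨g, hg, hgf⟩, hfK⟩ := h f hf
  have hgK : ∀ x ∉ K, g x = 0 := fun x hx =>
    T.incl_injective (by rw [hgf, hfK x hx, map_zero])
  refine ⟨⟨g, hG.1 g hg, hgK⟩, ?_, ext hgf⟩
  rintro ⟨⟨e, L, k, x⟩, he, hL, hLe, hx⟩
  exact hC e L k he hL hLe g hg x hx

theorem isCompleteConvexAlgebra [FiniteDimensional ℝ E] :
    IsCompleteConvexAlgebra (SmoothCompact E M A) where
  toIsCompleteConvex := by
    refine .of_exists_complete_disk (fun r D _ hD => ?_) fun S hS => exists_complete_disk hS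
    obtain ⟨K, hK, T, hT, -, G, hG, h⟩ := exists_lifts hD
    refine isBounded_of_lifts hK hT (hG.comp (r • ContinuousLinearMap.id ℝ T.Space)) ?_
    rintro _ ⟨f, hf, rfl⟩
    obtain ⟨⟨g, hg, hgf⟩, hfK⟩ := h f hf
    refine ⟨⟨_, mem_image_of_mem _ hg, fun x => ?_⟩, fun x hx => ?_⟩
    · refine (T.incl_real_smul r (g x)).trans ?_
      rw [hgf]
      rfl
    · change r • f x = 0
      rw [hfK x hx, smul_zero]
  isBounded_mul S S' hS hS' := by
    obtain ⟨K, hK, T, hT, -, G, hG, h⟩ := exists_lifts hS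
    obtain ⟨K', hK', T', hT', -, G', hG', h'⟩ := exists_lifts hS'
    obtain ⟨U, hU, hTU⟩ := BornAlg.exists_disk (IsCompleteConvexAlgebra.isBounded_mul _ _ hT hT')
    refine isBounded_of_lifts hK hU (hG.bilinear (Disk.mulMap hTU) hG') ?_
    rintro _ ⟨f, hf, f', hf', rfl⟩
    obtain ⟨⟨g, hg, hgf⟩, hfK⟩ := h f hf
    obtain ⟨⟨g', hg', hgf'⟩, -⟩ := h' f' hf'
    refine ⟨⟨_, mem_image2_of_mem hg hg', fun x => ?_⟩, fun x hx => ?_⟩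
    · rw [Disk.incl_mulMap, hgf, hgf']
      rfl
    · change f x * f' x = 0
      rw [hfK x hx, zero_mul]

instance [FiniteDimensional ℝ E] : IsCompleteConvexAlgebra (SmoothCompact E M A) :=
  isCompleteConvexAlgebra

/-- If the values of a power of a bounded subset of `D(M, A)` are small with respect to a
multiplicatively closed disk, then all powers are uniformly bounded. -/
theorem isBounded_iUnion_setPow [FiniteDimensional ℝ E] {S : Set (SmoothCompact E M A)}
    (hS : Bornology.IsBounded S)
    (h : ∀ B : Set A, Bornology.IsBounded B → ∃ V : Disk A, Bornology.IsBounded V.carrier ∧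
      V.carrier * V.carrier ⊆ V.carrier ∧ ∃ c : ℝ, 0 < c ∧ B ⊆ c • V.carrier ∧
        ∃ m, ∀ f ∈ setPow S m, ∀ x, f x ∈ (1 / 2 : ℝ) • V.carrier) :
    Bornology.IsBounded (⋃ n, setPow S n) := by
  obtain ⟨K, hK, T, hT, -, G, hG, hSG⟩ := exists_lifts hS
  obtain ⟨V, hV, hVV, c, hc, hTV, m, hm⟩ := h _ hT
  -- Since `V` is closed under multiplication, all powers take values in the same normed space
  -- `A_V`, and the disk need not grow with `n`.
  have hpow : ∀ n, ∃ H : Set (M → V.Space), IsBoundedSmooth E H ∧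
      ∀ f ∈ setPow S n, (∃ g ∈ H, ∀ x, V.incl (g x) = f x) ∧ ∀ x ∉ K, f x = 0 := by
    intro n
    induction n with
    | zero =>
      refine ⟨_, hG.comp (Disk.inclusionSMul hc.le hTV), fun f hf => ?_⟩
      obtain ⟨⟨g, hg, hgf⟩, hfK⟩ := hSG f hf
      exact ⟨⟨_, mem_image_of_mem _ hg, hgf⟩, hfK⟩
    | succ n ih =>
      obtain ⟨H, hH, hSH⟩ := ih
      refine ⟨_, hH.bilinear (Disk.mulMap hVV) (hG.comp (Disk.inclusionSMul hc.le hTV)), ?_⟩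
      rintro _ ⟨f, hf, f', hf', rfl⟩
      obtain ⟨⟨g, hg, hgf⟩, hfK⟩ := hSH f hf
      obtain ⟨⟨g', hg', hgf'⟩, -⟩ := hSG f' hf'
      refine ⟨⟨_, mem_image2_of_mem hg (mem_image_of_mem _ hg'), fun x => ?_⟩, fun x hx => ?_⟩
      · rw [Disk.incl_mulMap, hgf, Function.comp_apply, Disk.incl_inclusionSMul, hgf']
        rfl
      · change f x * f' x = 0
        rw [hfK x hx, zero_mul]
  obtain ⟨H, hH, hSH⟩ := hpow m
  -- The scale `l` may depend on the chart, the compact set and the order: multiplicative closure is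
  -- checked separately for each jet norm.
  have hex : ∀ (e : OpenPartialHomeomorph M E) (L : Set M) (k : ℕ), ∃ l : ℝ, 0 < l ∧
      (e ∈ atlas E M → IsCompact L → L ⊆ e.source → ∀ g ∈ H, (∀ x, ‖g x‖ ≤ 1 / 2) → ∀ x ∈ L,
        jetNorm k l (g ∘ e.symm) (e x) ≤ 1) := by
    intro e L k
    by_cases he : e ∈ atlas E M ∧ IsCompact L ∧ L ⊆ e.source
    · choose C hC using hH.2 e he.1 L he.2.1 he.2.2
      obtain ⟨l, hl, hlC⟩ := exists_jetNorm_le_one (E := E) (F := V.Space) k C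
      exact ⟨l, hl, fun _ _ _ g hg hg2 x hx => hlC _ _ (hg2 _) fun j => hC j g hg x hx⟩
    · exact ⟨1, one_pos, fun h1 h2 h3 => (he ⟨h1, h2, h3⟩).elim⟩
  choose l hl hlH using hex
  -- The common unit ball of all jet norms is closed under products by submultiplicativity, and it
  -- bounds every derivative because each `l` is positive.
  let N : Set (M → V.Space) := {g | ContMDiff 𝓘(ℝ, E) 𝓘(ℝ, V.Space) ∞ g ∧
    ∀ e ∈ atlas E M, ∀ L, IsCompact L → L ⊆ e.source → ∀ k, ∀ x ∈ L,
      jetNorm k (l e L k) (g ∘ e.symm) (e x) ≤ 1}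
  have hN : IsBoundedSmooth E N := ⟨fun g hg => hg.1, fun e he L hL hLe k => ⟨_, fun g hg x hx =>
    norm_iteratedFDeriv_le_of_jetNorm (hl e L k) (hg.2 e he L hL hLe k x hx)⟩⟩
  let N' : Set (SmoothCompact E M A) :=
    {f | (∃ g ∈ N, ∀ x, V.incl (g x) = f x) ∧ ∀ x ∉ K, f x = 0}
  have hN' : Bornology.IsBounded N' := isBounded_of_lifts hK hV hN fun f hf => hf
  have hNN : N' * N' ⊆ N' := by
    rintro _ ⟨f, ⟨⟨g, hg, hgf⟩, hfK⟩, f', ⟨⟨g', hg', hgf'⟩, -⟩, rfl⟩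
    refine ⟨⟨fun x => Disk.mulMap hVV (g x) (g' x), ⟨?_, fun e he L hL hLe k x hx => ?_⟩,
      fun x => ?_⟩, fun x hx => ?_⟩
    · exact ((Disk.mulMap hVV).contMDiff.comp hg.1).clm_apply hg'.1
    · refine (jetNorm_bilinear_le (Disk.mulMap hVV) (Disk.norm_mulMap_le hVV) e.open_target
        (contDiffOn_of_mem_atlas hg.1 he) (contDiffOn_of_mem_atlas hg'.1 he)
        (e.map_source (hLe hx)) k (hl e L k).le).trans ?_
      refine mul_le_one₀ (hg.2 e he L hL hLe k x hx) ?_ (hg'.2 e he L hL hLe k x hx)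
      have := (hl e L k).le
      exact Finset.sum_nonneg fun j _ => by positivity
    · rw [Disk.incl_mulMap, hgf, hgf']
      rfl
    · change f x * f' x = 0
      rw [hfK x hx, zero_mul]
  have hSN : setPow S m ⊆ N' := by
    intro f hf
    obtain ⟨⟨g, hg, hgf⟩, hfK⟩ := hSH f hf
    refine ⟨⟨g, ⟨hH.1 g hg, fun e he L hL hLe k x hx => ?_⟩, hgf⟩, hfK⟩
    refine hlH e L k he hL hLe g hg (fun x => V.norm_le_of_mem (by norm_num) ?_) x hx
    rw [hgf]
    exact hm f hf x
  exact isBounded_iUnion_setPow_of_setPow hS m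
    (hN'.subset (iUnion_subset fun n => setPow_subset_of_mul_subset hSN hNN n))

end SmoothCompact

end BornAlg

/-! ### Continuity estimators and fine partitions of unity -/

namespace BornAlg

/-- An equicontinuous and pointwise bounded family of functions has a continuity estimator. -/
theorem exists_estimator {X F ι : Type*} [TopologicalSpace X] [NormedAddCommGroup F] (g : ι → X → F)
    (hbdd : ∀ x, ∃ C : ℝ, ∀ i, ‖g i x‖ ≤ C)
    (hcont : ∀ x, ∀ ε : ℝ, 0 < ε → ∀ᶠ y in 𝓝 x, ∀ i, ‖g i y - g i x‖ ≤ ε) :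
    ∃ w : C(X × X, ℝ≥0), (∀ x, w (x, x) = 0) ∧ ∀ i x y, ‖g i x - g i y‖ ≤ w (x, y) := by
  -- With `ι` discrete, a pointwise bounded family is a map `Φ` from `X` to bounded functions on
  -- `ι`. Equicontinuity is continuity of `Φ`, and the pulled back distance is the estimator.
  let _ : TopologicalSpace ι := ⊥
  have : DiscreteTopology ι := ⟨rfl⟩
  choose C hC using hbdd
  let Φ : X → BoundedContinuousFunction ι F := fun x =>
    BoundedContinuousFunction.ofNormedAddCommGroupDiscrete (fun i => g i x) (C x) (hC x)
  have hΦ : Continuous Φ := by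
    rw [continuous_iff_continuousAt]
    intro x
    rw [ContinuousAt, Metric.tendsto_nhds]
    intro ε hε
    filter_upwards [hcont x (ε / 2) (by positivity)] with y hy
    refine lt_of_le_of_lt ((BoundedContinuousFunction.dist_le (by positivity)).2 fun i => ?_)
      (half_lt_self hε)
    rw [dist_eq_norm]
    exact hy i
  refine ⟨⟨fun z => nndist (Φ z.1) (Φ z.2), by fun_prop⟩, fun x => nndist_self _, fun i x y => ?_⟩
  have := BoundedContinuousFunction.dist_coe_le_dist (f := Φ x) (g := Φ y) i
  rwa [dist_eq_norm] at this

/-- The error of the approximation by a fine partition. -/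
theorem norm_sum_smul_sub_le {M F : Type*} [TopologicalSpace M]
    [NormedAddCommGroup F] [NormedSpace ℝ F] {w : C(OnePoint M × OnePoint M, ℝ≥0)} {ε : ℝ≥0} {t : Finset M}
    {χ : t → M → ℝ} (h0 : ∀ i x, 0 ≤ χ i x) (h1 : ∀ x, ∑ i, χ i x ≤ 1)
    (hfine : ∀ i x, χ i x ≠ 0 → w ((i : M), (x : OnePoint M)) ≤ ε)
    (hinf : ∀ x : M, ∑ i, χ i x ≠ 1 → w ((x : OnePoint M), OnePoint.infty) ≤ ε) {g : M → F}
    (hg : ∀ x y, ‖extendZero g x - extendZero g y‖ ≤ w (x, y)) (x : M) :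
    ‖∑ i, χ i x • g i - g x‖ ≤ ε := by
  -- The error splits into the oscillation of `g` on the supports and the missing mass, which
  -- matters only where `g` is small. The two weights add up to `1`.
  have e : ∑ i, χ i x • g i - g x = ∑ i, χ i x • (g i - g x) - (1 - ∑ i, χ i x) • g x := by
    simp only [smul_sub, Finset.sum_sub_distrib, sub_smul, one_smul, Finset.sum_smul]
    abel
  have h2 : ‖∑ i, χ i x • (g i - g x)‖ ≤ (∑ i, χ i x) * ε := by
    rw [Finset.sum_mul]
    refine norm_sum_le_of_le _ fun i _ => ?_
    rw [norm_smul, Real.norm_of_nonneg (h0 i x)]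
    by_cases hi : χ i x = 0
    · simp [hi]
    · exact mul_le_mul_of_nonneg_left ((hg i x).trans (NNReal.coe_le_coe.2 (hfine i x hi))) (h0 i x)
  have h3 : ‖(1 - ∑ i, χ i x) • g x‖ ≤ (1 - ∑ i, χ i x) * ε := by
    rw [norm_smul, Real.norm_of_nonneg (by linarith [h1 x])]
    by_cases hx : ∑ i, χ i x = 1
    · rw [hx, sub_self, zero_mul, zero_mul]
    · refine mul_le_mul_of_nonneg_left ?_ (by linarith [h1 x])
      have := hg x OnePoint.infty
      rw [show extendZero g OnePoint.infty = 0 from rfl, sub_zero] at this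
      exact this.trans (NNReal.coe_le_coe.2 (hinf x hx))
  rw [e]
  refine (norm_sub_le _ _).trans ((add_le_add h2 h3).trans_eq ?_)
  ring

section Estimators

variable {E : Type*} [NormedAddCommGroup E] [NormedSpace ℝ E] [FiniteDimensional ℝ E]
  {M : Type*} [TopologicalSpace M] [ChartedSpace E M] [IsManifold 𝓘(ℝ, E) ∞ M]
  {F : Type*} [NormedAddCommGroup F] [NormedSpace ℝ F]

/-- The mean value inequality on a ball in a chart, with a first derivative bound uniform over `G`,
gives a common Lipschitz constant and hence equicontinuity. -/
theorem IsBoundedSmooth.eventually_norm_sub_le {G : Set (M → F)} (hG : IsBoundedSmooth E G) (x : M)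
    {ε : ℝ} (hε : 0 < ε) : ∀ᶠ y in 𝓝 x, ∀ g ∈ G, ‖g y - g x‖ ≤ ε := by
  let e := chartAt E x
  have he : e ∈ atlas E M := chart_mem_atlas E x
  have hx : x ∈ e.source := mem_chart_source E x
  obtain ⟨r, hr, hrt, hcomp, hrs⟩ := exists_closedBall_subset_target hx
  obtain ⟨C, hC⟩ := hG.2 e he _ hcomp hrs 1
  have hlip : ∀ g ∈ G, ∀ y ∈ Metric.closedBall (e x) r,
      ‖(g ∘ e.symm) y - (g ∘ e.symm) (e x)‖ ≤ |C| * ‖y - e x‖ := by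
    intro g hg y hy
    refine (convex_closedBall (e x) r).norm_image_sub_le_of_norm_fderiv_le (𝕜 := ℝ)
      (fun z hz => ?_) (fun z hz => ?_) (Metric.mem_closedBall_self hr.le) hy
    · exact (contDiffAt_of_mem_atlas (hG.1 g hg) he (hrt hz)).differentiableAt (by simp)
    · have := hC g hg (e.symm z) ⟨z, hz, rfl⟩
      rw [e.right_inv (hrt hz), norm_iteratedFDeriv_one] at this
      exact this.trans (le_abs_self C)
  have h1 : ∀ᶠ y in 𝓝 x, y ∈ e.source := e.open_source.mem_nhds hx
  have h2 : ∀ᶠ y in 𝓝 x, e y ∈ Metric.closedBall (e x) r :=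
    (e.continuousAt hx).eventually (Metric.closedBall_mem_nhds _ hr)
  have h3 : ∀ᶠ y in 𝓝 x, |C| * ‖e y - e x‖ < ε := by
    have hlim : Tendsto (fun y => |C| * ‖e y - e x‖) (𝓝 x) (𝓝 (|C| * ‖e x - e x‖)) :=
      (((e.continuousAt hx).tendsto.sub_const (e x)).norm).const_mul |C|
    rw [sub_self, norm_zero, mul_zero] at hlim
    exact hlim.eventually_lt_const hε
  filter_upwards [h1, h2, h3] with y hy1 hy2 hy3 g hg
  have := hlip g hg (e y) hy2
  simp only [Function.comp_apply, e.left_inv hy1, e.left_inv hx] at this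
  exact this.trans hy3.le

variable [T2Space M]

/-- Bounded sets of smooth functions with a common compact support have a continuity estimator. -/
theorem IsBoundedSmooth.exists_estimator {G : Set (M → F)} (hG : IsBoundedSmooth E G) {K : Set M}
    (hK : IsCompact K) (hGK : ∀ g ∈ G, ∀ x ∉ K, g x = 0) :
    ∃ w : C(OnePoint M × OnePoint M, ℝ≥0), (∀ x, w (x, x) = 0) ∧
      ∀ g ∈ G, ∀ x y, ‖extendZero g x - extendZero g y‖ ≤ w (x, y) := by
  suffices h : ∃ w : C(OnePoint M × OnePoint M, ℝ≥0), (∀ x, w (x, x) = 0) ∧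
      ∀ (g : G) x y, ‖extendZero g.1 x - extendZero g.1 y‖ ≤ w (x, y) by
    obtain ⟨w, hw, h⟩ := h
    exact ⟨w, hw, fun g hg => h ⟨g, hg⟩⟩
  refine BornAlg.exists_estimator (fun (g : G) x => extendZero g.1 x) (fun x => ?_) fun x ε hε => ?_
  · induction x using OnePoint.rec with
    | infty => exact ⟨0, fun g => norm_zero.le⟩
    | coe x =>
      obtain ⟨C, hC⟩ := hG.2 _ (chart_mem_atlas E x) {x} isCompact_singleton (by simp) 0
      refine ⟨C, fun g => ?_⟩
      have := hC g.1 g.2 x rfl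
      rw [norm_iteratedFDeriv_zero, Function.comp_apply,
        (chartAt E x).left_inv (mem_chart_source E x)] at this
      exact this
  · induction x using OnePoint.rec with
    | infty =>
      -- On this neighbourhood of infinity all functions of the family vanish.
      have hopen : IsOpen ((fun x : M => (x : OnePoint M)) '' K)ᶜ :=
        OnePoint.isOpen_compl_image_coe.2 ⟨hK.isClosed, hK⟩
      filter_upwards [hopen.mem_nhds (by simp)] with y hy g
      have h0 : extendZero g.1 y = 0 := by
        induction y using OnePoint.rec with
        | infty => rfl
        | coe y => exact hGK g.1 g.2 y fun hyK => hy ⟨y, hyK, rfl⟩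
      rw [h0]
      change ‖(0 : F) - 0‖ ≤ ε
      simpa using hε.le
    | coe x =>
      rw [OnePoint.nhds_coe_eq, eventually_map]
      filter_upwards [hG.eventually_norm_sub_le x hε] with y hy g
      exact hy g.1 g.2

/-- Smooth partial partitions of unity that are fine with respect to a continuity estimator. -/
theorem exists_fine_partition [SecondCountableTopology M]
    (w : C(OnePoint M × OnePoint M, ℝ≥0)) (hw : ∀ x, w (x, x) = 0) {ε : ℝ≥0} (hε : 0 < ε) :
    ∃ (t : Finset M) (χ : t → M → ℝ) (L : Set M), IsCompact L ∧
      (∀ i, ContMDiff 𝓘(ℝ, E) 𝓘(ℝ, ℝ) ∞ (χ i)) ∧ (∀ i x, 0 ≤ χ i x) ∧ (∀ x, ∑ i, χ i x ≤ 1) ∧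
      (∀ i, ∀ x ∉ L, χ i x = 0) ∧ (∀ i x, χ i x ≠ 0 → w ((i : M), (x : OnePoint M)) ≤ ε) ∧
      ∀ x : M, ∑ i, χ i x ≠ 1 → w ((x : OnePoint M), OnePoint.infty) ≤ ε := by
  have : LocallyCompactSpace M := ChartedSpace.locallyCompactSpace E M
  have hcw : Continuous fun z : OnePoint M => w (z, OnePoint.infty) :=
    w.continuous.comp (by fun_prop)
  -- `Z` is closed and misses infinity, so its trace on `M` is compact. A full partition of unity is
  -- needed only there.
  let Z : Set (OnePoint M) := {z | ε ≤ w (z, OnePoint.infty)}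
  have hZ : IsClosed Z := isClosed_le continuous_const hcw
  have hZinf : OnePoint.infty ∉ Z := by
    simp only [Z, mem_ofPred_eq, hw, not_le]
    exact hε
  obtain ⟨hKc, hK⟩ := (OnePoint.isClosed_iff_of_notMem hZinf).1 hZ
  set K : Set M := (fun x : M => (x : OnePoint M)) ⁻¹' Z with hKdef
  choose N hN hNx using fun x : M => exists_compact_mem_nhds x
  have hcx : ∀ x : M, Continuous fun y : M => w ((x : OnePoint M), (y : OnePoint M)) := fun x =>
    w.continuous.comp (continuous_const.prodMk OnePoint.continuous_coe)
  -- The first factor makes the supports relatively compact, the second makes the partition fine.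
  let U : M → Set M := fun x => interior (N x) ∩ {y | w ((x : OnePoint M), (y : OnePoint M)) < ε}
  have hU : ∀ x, IsOpen (U x) := fun x =>
    isOpen_interior.inter (isOpen_lt (hcx x) continuous_const)
  have hxU : ∀ x, x ∈ U x := fun x =>
    ⟨mem_interior_iff_mem_nhds.2 (hNx x), by simpa [hw] using hε⟩
  obtain ⟨t, ht⟩ := hK.elim_finite_subcover U hU fun x _ => mem_iUnion.2 ⟨x, hxU x⟩
  obtain ⟨f, hf⟩ := SmoothPartitionOfUnity.exists_isSubordinate 𝓘(ℝ, E) hKc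
    (fun i : t => U i) (fun i => hU i) (fun x hx => by
      obtain ⟨i, hi, hxi⟩ := mem_iUnion₂.1 (ht hx)
      exact mem_iUnion.2 ⟨⟨i, hi⟩, hxi⟩)
  have hsupp : ∀ i x, f i x ≠ 0 → x ∈ U i := fun i x hx => hf i (subset_tsupport _ hx)
  refine ⟨t, fun i x => f i x, ⋃ i ∈ t, N i, t.isCompact_biUnion fun i _ => hN i,
    fun i => (f i).contMDiff, fun i x => f.nonneg i x, fun x => ?_, fun i x hx => ?_,
    fun i x hx => ?_, fun x hx => ?_⟩
  · have := f.sum_le_one x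
    rwa [finsum_eq_sum_of_fintype] at this
  · by_contra h
    exact hx (mem_iUnion₂.2 ⟨i, i.2, interior_subset (hsupp i x h).1⟩)
  · exact le_of_lt (hsupp i x hx).2
  · by_contra h
    have hxK : x ∈ K := le_of_lt (not_le.1 h)
    have := f.sum_eq_one hxK
    rw [finsum_eq_sum_of_fintype] at this
    exact hx this

end Estimators

end BornAlg

namespace BornAlg

/-! ### Smooth approximation and local density -/

section Approximation

variable {E : Type*} [NormedAddCommGroup E] [NormedSpace ℝ E] [FiniteDimensional ℝ E]
  {M : Type*} [TopologicalSpace M] [T2Space M] [SecondCountableTopology M] [ChartedSpace E M]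
  [IsManifold 𝓘(ℝ, E) ∞ M]

/-- Functions with continuity estimator `w` are uniform limits of smooth functions with compact
support that have a common continuity estimator. -/
theorem exists_smooth_approximation {F : Type*} [NormedAddCommGroup F] [NormedSpace ℝ F]
    (w : C(OnePoint M × OnePoint M, ℝ≥0)) (hw : ∀ x, w (x, x) = 0) :
    ∃ a : ℕ → (M → F) → M → F,
      (∀ n, ∃ L : Set M, IsCompact L ∧ ∀ g, ∀ x ∉ L, a n g x = 0) ∧
      (∀ n g, ContMDiff 𝓘(ℝ, E) 𝓘(ℝ, F) ∞ (a n g)) ∧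
      ∃ v : C(OnePoint M × OnePoint M, ℝ≥0), (∀ x, v (x, x) = 0) ∧
        ∀ g, (∀ x y, ‖extendZero g x - extendZero g y‖ ≤ w (x, y)) → ∀ n,
          (∀ x y, ‖extendZero (a n g) x - extendZero (a n g) y‖ ≤ v (x, y)) ∧
          ∀ x, ‖a n g x - g x‖ ≤ 1 / ((n : ℝ) + 1) := by
  have hpos : ∀ n : ℕ, (0 : ℝ≥0) < 1 / ((n : ℝ≥0) + 1) := fun n => by positivity
  choose t χ L hL hχ h0 h1 hχL hfine hinf using fun n : ℕ =>
    exists_fine_partition (E := E) w hw (hpos n)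
  let a : ℕ → (M → F) → M → F := fun n g x => ∑ i, χ n i x • g i
  let Γ : Set (M → F) := {g | ∀ x y, ‖extendZero g x - extendZero g y‖ ≤ w (x, y)}
  have hbound : ∀ g ∈ Γ, ∀ x : M, ‖g x‖ ≤ w ((x : OnePoint M), OnePoint.infty) := fun g hg x => by
    have := hg x OnePoint.infty
    rwa [show extendZero g OnePoint.infty = 0 from rfl, sub_zero] at this
  have herr : ∀ n, ∀ g ∈ Γ, ∀ x, ‖a n g x - g x‖ ≤ 1 / ((n : ℝ) + 1) := fun n g hg x => by
    have := norm_sum_smul_sub_le (h0 n) (h1 n) (hfine n) (hinf n) hg x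
    exact this.trans_eq (by push_cast; rfl)
  have herr' : ∀ n, ∀ g ∈ Γ, ∀ x : OnePoint M,
      ‖extendZero (a n g) x - extendZero g x‖ ≤ 1 / ((n : ℝ) + 1) := fun n g hg x => by
    induction x using OnePoint.rec with
    | infty =>
      change ‖(0 : F) - 0‖ ≤ _
      rw [sub_zero, norm_zero]
      positivity
    | coe x => exact herr n g hg x
  have hext : ∀ n g (x : OnePoint M), extendZero (a n g) x = ∑ i, extendZero (χ n i) x • g i := by
    intro n g x
    induction x using OnePoint.rec with
    | infty =>
      change (0 : F) = ∑ i : t n, (0 : ℝ) • g i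
      simp
    | coe x => rfl
  have hest : ∀ n, ∃ u : C(OnePoint M × OnePoint M, ℝ≥0), (∀ x, u (x, x) = 0) ∧
      ∀ g ∈ Γ, ∀ x y, ‖extendZero (a n g) x - extendZero (a n g) y‖ ≤ u (x, y) := by
    intro n
    choose u hu huχ using fun i => (isBoundedSmooth_singleton (hχ n i)).exists_estimator (hL n)
      (by rintro _ rfl; exact hχL n i)
    -- The coefficients satisfy `‖g i‖ ≤ w (i, ∞)`, so the estimators of the partition functions
    -- combine to one that is uniform in `g`.
    refine ⟨∑ i, u i * ContinuousMap.const _ (w (((i : M) : OnePoint M), OnePoint.infty)),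
      fun x => by simp [hu], fun g hg x y => ?_⟩
    rw [hext, hext, ← Finset.sum_sub_distrib, ContinuousMap.coe_sum, Finset.sum_apply,
      NNReal.coe_sum]
    refine norm_sum_le_of_le _ fun i _ => ?_
    rw [← sub_smul, norm_smul]
    exact mul_le_mul (huχ i _ rfl x y) (hbound g hg i) (norm_nonneg _) NNReal.zero_le_coe
  choose u hu hua using hest
  obtain ⟨v, hv, hva⟩ := exists_estimator
    (fun (i : ℕ × Γ) (x : OnePoint M) => extendZero (a i.1 i.2.1) x)
    (fun x => ⟨1 + w (x, OnePoint.infty), fun i => by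
      have e1 := herr' i.1 i.2.1 i.2.2 x
      have e2 := i.2.2 x OnePoint.infty
      rw [show extendZero i.2.1 OnePoint.infty = 0 from rfl, sub_zero] at e2
      have e3 : 1 / ((i.1 : ℝ) + 1) ≤ 1 := by
        rw [div_le_one (by positivity)]
        linarith [(Nat.cast_nonneg i.1 : (0 : ℝ) ≤ i.1)]
      linarith [norm_le_norm_sub_add (extendZero (a i.1 i.2.1) x) (extendZero i.2.1 x)]⟩)
    (fun x ε hε => by
      -- Equicontinuity over all `n` at once: the finitely many `n < N` have their own estimators `u
      -- n`. For `n ≥ N`, two approximation errors of `ε / 4` and `w ≤ ε / 2` add up to `ε`.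
      obtain ⟨N, hN⟩ := exists_nat_one_div_lt (show (0 : ℝ) < ε / 4 by positivity)
      have hnear : ∀ u : C(OnePoint M × OnePoint M, ℝ≥0), u (x, x) = 0 →
          ∀ δ : ℝ, 0 < δ → ∀ᶠ y in 𝓝 x, (u (y, x) : ℝ) ≤ δ := by
        intro u hu δ hδ
        have hc : Continuous fun y => (u (y, x) : ℝ) :=
          NNReal.continuous_coe.comp (u.continuous.comp (by fun_prop))
        exact hc.continuousAt.eventually_le_const (by simpa [hu] using hδ)
      have hfin : ∀ᶠ y in 𝓝 x, ∀ n ∈ Finset.range N, (u n (y, x) : ℝ) ≤ ε :=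
        (eventually_all_finset _).2 fun n _ => hnear (u n) (hu n x) ε hε
      filter_upwards [hfin, hnear w (hw x) (ε / 2) (by positivity)] with y hy1 hy2
      rintro ⟨n, g, hg⟩
      rcases lt_or_ge n N with hn | hn
      · exact (hua n g hg y x).trans (hy1 n (Finset.mem_range.2 hn))
      · have e1 := herr' n g hg y
        have e2 := herr' n g hg x
        have e3 := hg y x
        have e4 : 1 / ((n : ℝ) + 1) ≤ 1 / ((N : ℝ) + 1) :=
          one_div_le_one_div_of_le (by positivity) (by gcongr)
        have e5 : extendZero (a n g) y - extendZero (a n g) x =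
            (extendZero (a n g) y - extendZero g y) + (extendZero g y - extendZero g x) -
              (extendZero (a n g) x - extendZero g x) := by abel
        change ‖extendZero (a n g) y - extendZero (a n g) x‖ ≤ ε
        rw [e5]
        refine (norm_sub_le _ _).trans ?_
        linarith [norm_add_le (extendZero (a n g) y - extendZero g y)
          (extendZero g y - extendZero g x)])
  refine ⟨a, fun n => ⟨L n, hL n, fun g x hx => ?_⟩, fun n g => ?_, v, hv, fun g hg n =>
    ⟨hva (n, ⟨g, hg⟩), herr n g hg⟩⟩
  · exact Finset.sum_eq_zero fun i _ => by rw [hχL n i x hx, zero_smul]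
  · exact contMDiff_finsetSum fun i _ => (hχ n i).smul contMDiff_const

end Approximation

namespace SmoothCompact

variable {E : Type*} [NormedAddCommGroup E] [NormedSpace ℝ E] [FiniteDimensional ℝ E]
  {M : Type*} [TopologicalSpace M] [T2Space M] [ChartedSpace E M] [IsManifold 𝓘(ℝ, E) ∞ M]
  {A : Type*} [NonUnitalRing A] [Module ℂ A]
  [IsScalarTower ℂ A A] [SMulCommClass ℂ A A] [Bornology A] [IsCompleteConvexAlgebra A]

theorem isBoundedCZero {S : Set (SmoothCompact E M A)} (hS : Bornology.IsBounded S) :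
    IsBoundedCZero ((fun f : SmoothCompact E M A => (f : M → A)) '' S) := by
  obtain ⟨K, hK, T, hT, -, G, hG, h⟩ := exists_lifts hS
  have hG' : IsBoundedSmooth E (G ∩ {g | ∀ x ∉ K, g x = 0}) :=
    ⟨fun g hg => hG.1 g hg.1, fun e he L hL hLe k =>
      (hG.2 e he L hL hLe k).imp fun C hC g hg => hC g hg.1⟩
  obtain ⟨w, hw, hwG⟩ := hG'.exists_estimator hK fun g hg => hg.2
  refine isBoundedCZero_of_disk T hT w hw ?_
  rintro _ ⟨f, hf, rfl⟩ x y
  obtain ⟨⟨g, hg, hgf⟩, hfK⟩ := h f hf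
  have hgK : ∀ x ∉ K, g x = 0 := fun x hx =>
    T.incl_injective (by rw [hgf, hfK x hx, map_zero])
  have e : (f : M → A) = fun x => T.incl (g x) := funext fun x => (hgf x).symm
  simp only [e]
  rw [← incl_extendZero, ← incl_extendZero, ← map_sub]
  exact T.smul_subset (norm_nonneg _) (hwG g ⟨hg, hgK⟩ x y) (T.mem_norm_smul _)

/-- The inclusion `D(M, A) → C₀(M, A)`. -/
def toCZero : SmoothCompact E M A →ₙₐ[ℂ] CZero M A where
  toFun f := (⟨f, by
    have := isBoundedCZero (Bornology.isBounded_singleton (x := f))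
    rwa [image_singleton] at this⟩ : cZeroSubalgebra M A)
  map_smul' _ _ := rfl
  map_zero' := rfl
  map_add' _ _ := rfl
  map_mul' _ _ := rfl

theorem toCZero_apply (f : SmoothCompact E M A) (x : M) : toCZero f x = f x := rfl

theorem toCZero_injective : Function.Injective (toCZero : SmoothCompact E M A → CZero M A) :=
  fun _ _ h => ext fun x => congrArg (fun f : CZero M A => f x) h

theorem isBounded_image_toCZero {S : Set (SmoothCompact E M A)} (hS : Bornology.IsBounded S) :
    Bornology.IsBounded (toCZero '' S) := by
  rw [CZero.isBounded_iff, image_image]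
  exact isBoundedCZero hS

theorem eval_image_toCZero (S : Set (SmoothCompact E M A)) (x : M) :
    CZero.eval (x : OnePoint M) '' (toCZero '' S) = (fun f => f x) '' S := by
  rw [image_image]
  rfl

/-- Uniform convergence does not suffice, since the error must have a small multiple of a fixed
estimator as its estimator, also near the diagonal. Interpolating between the uniform error bound
and the common estimator repairs this. -/
theorem isLocallyDense_range_toCZero [SecondCountableTopology M] :
    IsLocallyDense (range (toCZero : SmoothCompact E M A → CZero M A)) := by
  intro S hS _
  obtain ⟨T, hT, -, w, hw, h⟩ := CZero.exists_disk hS Bornology.isBounded_empty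
  obtain ⟨a, haL, ha, v, hv, hav⟩ :=
    exists_smooth_approximation (E := E) (F := T.Space) w hw
  choose L hL haL using haL
  -- It dominates the estimators of limits and approximants, and the square root needed for the
  -- interpolation.
  let u : C(OnePoint M × OnePoint M, ℝ≥0) :=
    w + v + ⟨fun z => NNReal.sqrt (w z + v z), by fun_prop⟩
  have hu : ∀ x, u (x, x) = 0 := fun x => by simp [u, hw, hv]
  have hwu : ∀ z, w z ≤ u z := fun z => by
    simp only [u, ContinuousMap.add_apply, add_assoc]
    exact le_self_add
  have hvu : ∀ z, v z ≤ u z := fun z => by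
    simp only [u, ContinuousMap.add_apply]
    exact (le_add_self (b := w z)).trans le_self_add
  have hsqrt : ∀ z, Real.sqrt (w z + v z) ≤ u z := fun z => by
    have : NNReal.sqrt (w z + v z) ≤ u z := by
      simp only [u, ContinuousMap.add_apply, ContinuousMap.coe_mk]
      exact le_add_self
    have h2 := NNReal.coe_le_coe.2 this
    rwa [Real.coe_sqrt, NNReal.coe_add] at h2
  have hmono : ∀ {w' : C(OnePoint M × OnePoint M, ℝ≥0)}, (∀ z, w' z ≤ u z) → ∀ f : CZero M A,
      (∀ x y, CZero.eval x f - CZero.eval y f ∈ (w' (x, y) : ℝ) • T.carrier) →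
      f ∈ (CZero.estimatorDisk T u).carrier := fun hw' f hf => CZero.mem_estimatorDisk.2 fun x y =>
    T.smul_subset NNReal.zero_le_coe (NNReal.coe_le_coe.2 (hw' _)) (hf x y)
  refine ⟨(CZero.estimatorDisk T u).carrier, CZero.isBounded_estimatorDisk hT hu,
    (CZero.estimatorDisk T u).isCircled, fun f hf => ?_⟩
  obtain ⟨g, hg, rfl⟩ : f ∈ (CZero.estimatorDisk T w).carrier := CZero.mem_estimatorDisk.2 (h f hf)
  have hg' : ∀ x y, ‖extendZero g.1 x - extendZero g.1 y‖ ≤ w (x, y) := fun x y => hg (x, y)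
  let k : ℕ → SmoothCompact E M A := fun n => ofLifts (hL n) hT ⟨a n g.1, ha n g.1, haL n g.1⟩
  have hk : ∀ n x, CZero.eval x (toCZero (k n)) = T.incl (extendZero (a n g.1) x) := fun n x =>
    (incl_extendZero T (a n g.1) x).symm
  have hkT : ∀ n, toCZero (k n) ∈ (CZero.estimatorDisk T u).carrier := fun n =>
    hmono hvu _ fun x y => by
      rw [hk, hk, ← map_sub]
      exact T.smul_subset (norm_nonneg _) ((hav g.1 hg' n).1 x y) (T.mem_norm_smul _)
  refine ⟨fun n => toCZero (k n), fun n => ⟨mem_range_self _, hkT n⟩, hkT, hmono hwu _ (h _ hf),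
    fun n => Real.sqrt (2 * (1 / ((n : ℝ) + 1))), fun n => Real.sqrt_pos.2 (by positivity), ?_,
    fun n => ?_⟩
  · have hlim := (tendsto_one_div_add_atTop_nhds_zero_nat (𝕜 := ℝ)).const_mul 2
    rw [mul_zero] at hlim
    have := (Real.continuous_sqrt.tendsto 0).comp hlim
    rwa [Real.sqrt_zero] at this
  · refine (CZero.mem_smul_estimatorDisk (Real.sqrt_pos.2 (by positivity))).2 fun x y => ?_
    obtain ⟨h1, h2⟩ := hav g.1 hg' n
    have h2' : ∀ x : OnePoint M, ‖extendZero (a n g.1) x - extendZero g.1 x‖ ≤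
        1 / ((n : ℝ) + 1) := fun x => by
      induction x using OnePoint.rec with
      | infty =>
        change ‖(0 : T.Space) - 0‖ ≤ _
        rw [sub_zero, norm_zero]
        positivity
      | coe x => exact h2 x
    rw [map_sub, map_sub, hk, hk, CZero.eval_ofLifts, CZero.eval_ofLifts, ← map_sub, ← map_sub,
      ← map_sub]
    refine T.smul_subset (norm_nonneg _) ?_ (T.mem_norm_smul _)
    set d := (extendZero (a n g.1) x - extendZero g.1 x) -
      (extendZero (a n g.1) y - extendZero g.1 y) with hd
    have e1 : ‖d‖ ≤ 2 * (1 / ((n : ℝ) + 1)) := by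
      rw [two_mul]
      exact (norm_sub_le _ _).trans (add_le_add (h2' x) (h2' y))
    have e2 : ‖d‖ ≤ w (x, y) + v (x, y) := by
      have e : d = (extendZero (a n g.1) x - extendZero (a n g.1) y) -
          (extendZero g.1 x - extendZero g.1 y) := by rw [hd]; abel
      rw [e, add_comm]
      exact (norm_sub_le _ _).trans (add_le_add (h1 x y) (hg' x y))
    -- One square root is bounded by the uniform error and supplies the null sequence; the other is
    -- bounded by `w + v` and vanishes on the diagonal.
    calc ‖d‖ = Real.sqrt ‖d‖ * Real.sqrt ‖d‖ := (Real.mul_self_sqrt (norm_nonneg _)).symm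
      _ ≤ Real.sqrt (2 * (1 / ((n : ℝ) + 1))) * Real.sqrt (w (x, y) + v (x, y)) :=
        mul_le_mul (Real.sqrt_le_sqrt e1) (Real.sqrt_le_sqrt e2) (Real.sqrt_nonneg _)
          (Real.sqrt_nonneg _)
      _ ≤ _ := mul_le_mul_of_nonneg_left (hsqrt _) (Real.sqrt_nonneg _)

end SmoothCompact

/-! ### The spectral radius formula and isoradiality -/

section SpectralRadiusFormula

variable {E : Type*} [NormedAddCommGroup E] [NormedSpace ℝ E] [FiniteDimensional ℝ E]
  {M : Type*} [TopologicalSpace M] [T2Space M] [ChartedSpace E M] [IsManifold 𝓘(ℝ, E) ∞ M]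
  {A : Type*} [NonUnitalRing A] [Module ℂ A]
  [IsScalarTower ℂ A A] [SMulCommClass ℂ A A] [Bornology A] [IsCompleteConvexAlgebra A]

theorem CZero.spectralRadius_eval_infty {M : Type*} [TopologicalSpace M] (S : Set (CZero M A)) :
    spectralRadius (eval OnePoint.infty '' S) = 0 := by
  refine spectralRadius_zero_of_subset ?_
  rintro _ ⟨f, -, rfl⟩
  exact eval_infty f

theorem CZero.spectralRadius_le {M : Type*} [TopologicalSpace M] {S : Set (CZero M A)} (hA : IsLocallyMultiplicative A)
    (hS : Bornology.IsBounded S) {r : ℝ} (hr : 0 < r)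
    (h : ∀ x, spectralRadius (eval x '' S) < ENNReal.ofReal r) :
    spectralRadius S ≤ ENNReal.ofReal r := by
  refine BornAlg.spectralRadius_le hr
    (isBounded_iUnion_setPow hA (isBounded_real_smul r⁻¹ hS) fun x => ?_)
  rw [image_real_smul_set]
  exact spectralRadius_inv_smul_lt_one hr (h x)

/-- Smallness of the values of a power is a statement about `C₀(M, A)` and is taken from there; the
jet norms then control the derivatives. -/
theorem SmoothCompact.spectralRadius_le {S : Set (SmoothCompact E M A)}
    (hA : IsLocallyMultiplicative A) (hS : Bornology.IsBounded S) {r : ℝ} (hr : 0 < r)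
    (h : ∀ x, spectralRadius (CZero.eval x '' (toCZero '' S)) < ENNReal.ofReal r) :
    spectralRadius S ≤ ENNReal.ofReal r := by
  have hS' := isBounded_real_smul r⁻¹ hS
  refine BornAlg.spectralRadius_le hr (isBounded_iUnion_setPow hS' fun B hB => ?_)
  obtain ⟨V, hV, hVV, c, hc, hBV, m, hm⟩ := CZero.exists_setPow_subset hA
    (isBounded_image_toCZero hS') (fun x => by
      rw [image_real_smul_set, image_real_smul_set]
      exact spectralRadius_inv_smul_lt_one hr (h x)) hB
  refine ⟨V, hV, hVV, c, hc, hBV, m, fun f hf x => hm (x : OnePoint M) ⟨toCZero f, ?_, rfl⟩⟩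
  rw [← image_setPow]
  exact mem_image_of_mem _ hf

theorem CZero.spectralRadius_properties (hA : IsLocallyMultiplicative A) {S : Set (CZero M A)}
    (hS : Bornology.IsBounded S) :
    UpperSemicontinuous (fun x : M => spectralRadius ((fun f => f x) '' S)) ∧
      Tendsto (fun x : M => spectralRadius ((fun f => f x) '' S)) (cocompact M) (𝓝 0) ∧
      spectralRadius S = ⨆ x : M, spectralRadius ((fun f => f x) '' S) ∧
      (Nonempty M → ∃ x : M, spectralRadius S = spectralRadius ((fun f => f x) '' S)) :=
  (upperSemicontinuous_spectralRadius hA hS).onePoint_properties (spectralRadius_eval_infty S)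
    (fun x => spectralRadius_image_le (eval (x : OnePoint M))
      (fun _ hS => isBounded_image_eval hS x) S)
    fun _ hr h => CZero.spectralRadius_le hA hS hr h

theorem SmoothCompact.spectralRadius_properties (hA : IsLocallyMultiplicative A)
    {S : Set (SmoothCompact E M A)} (hS : Bornology.IsBounded S) :
    UpperSemicontinuous (fun x : M => spectralRadius ((fun f => f x) '' S)) ∧
      Tendsto (fun x : M => spectralRadius ((fun f => f x) '' S)) (cocompact M) (𝓝 0) ∧
      spectralRadius S = ⨆ x : M, spectralRadius ((fun f => f x) '' S) ∧
      (Nonempty M → ∃ x : M, spectralRadius S = spectralRadius ((fun f => f x) '' S)) := by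
  have hS' := isBounded_image_toCZero hS
  simp only [← eval_image_toCZero]
  exact (CZero.upperSemicontinuous_spectralRadius hA hS').onePoint_properties
    (CZero.spectralRadius_eval_infty _)
    (fun x => (spectralRadius_image_le (CZero.eval (x : OnePoint M))
      (fun _ hS => CZero.isBounded_image_eval hS x) _).trans
        (spectralRadius_image_le toCZero (fun _ hS => isBounded_image_toCZero hS) S))
    fun _ hr h => SmoothCompact.spectralRadius_le hA hS hr h

/-- A supremum of finite radii could be infinite; it is finite here because it is attained at a
point, or is empty. -/
theorem CZero.isLocallyMultiplicative (hA : IsLocallyMultiplicative A) :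
    IsLocallyMultiplicative (CZero M A) := by
  intro S hS
  obtain ⟨-, -, hsup, hmax⟩ := spectralRadius_properties hA hS
  rcases isEmpty_or_nonempty M with hM | hM
  · rw [hsup, iSup_of_empty]
    exact ENNReal.zero_lt_top
  · obtain ⟨x, hx⟩ := hmax hM
    rw [hx]
    exact hA _ (isBounded_image_eval hS (x : OnePoint M))

/-- Both radii are the supremum of the same pointwise radii. -/
theorem SmoothCompact.spectralRadius_toCZero (hA : IsLocallyMultiplicative A)
    {S : Set (SmoothCompact E M A)} (hS : Bornology.IsBounded S) :
    spectralRadius S = spectralRadius (toCZero '' S) := by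
  rw [(spectralRadius_properties hA hS).2.2.1,
    (CZero.spectralRadius_properties hA (isBounded_image_toCZero hS)).2.2.1]
  simp only [← eval_image_toCZero]
  rfl

theorem SmoothCompact.isIsoradial_toCZero [SecondCountableTopology M]
    (hA : IsLocallyMultiplicative A) :
    IsIsoradial (toCZero : SmoothCompact E M A →ₙₐ[ℂ] CZero M A) where
  source_complete := isCompleteConvexAlgebra
  source_locallyMultiplicative S hS := by
    rw [spectralRadius_toCZero hA hS]
    exact CZero.isLocallyMultiplicative hA _ (isBounded_image_toCZero hS)
  target_complete := CZero.isCompleteConvexAlgebra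
  target_locallyMultiplicative := CZero.isLocallyMultiplicative hA
  bounded _ hS := isBounded_image_toCZero hS
  locallyDense := isLocallyDense_range_toCZero
  spectralRadius_eq _ hS := spectralRadius_toCZero hA hS

end SpectralRadiusFormula

end BornAlg

end

theorem mainTheorem11
    {E : Type*} [NormedAddCommGroup E] [NormedSpace ℝ E] [FiniteDimensional ℝ E]
    {M : Type*} [TopologicalSpace M] [T2Space M] [SecondCountableTopology M]
    [ChartedSpace E M] [IsManifold 𝓘(ℝ, E) ∞ M]
    {A : Type*} [NonUnitalRing A] [Module ℂ A] [IsScalarTower ℂ A A] [SMulCommClass ℂ A A]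
    [Bornology A] [BornAlg.IsCompleteConvexAlgebra A]
    (hA : BornAlg.IsLocallyMultiplicative A) :
    (∃ ι : BornAlg.SmoothCompact E M A →ₙₐ[ℂ] BornAlg.CZero M A,
      (∀ (f : BornAlg.SmoothCompact E M A) (x : M), ι f x = f x) ∧
      Function.Injective ι ∧ BornAlg.IsIsoradial ι) ∧
    (∀ S : Set (BornAlg.CZero M A), Bornology.IsBounded S →
      UpperSemicontinuous (fun x : M => BornAlg.spectralRadius ((fun f => f x) '' S)) ∧
      Tendsto (fun x : M => BornAlg.spectralRadius ((fun f => f x) '' S)) (cocompact M) (𝓝 0) ∧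
      BornAlg.spectralRadius S = ⨆ x : M, BornAlg.spectralRadius ((fun f => f x) '' S) ∧
      (Nonempty M → ∃ x : M,
        BornAlg.spectralRadius S = BornAlg.spectralRadius ((fun f => f x) '' S))) ∧
    (∀ S : Set (BornAlg.SmoothCompact E M A), Bornology.IsBounded S →
      UpperSemicontinuous (fun x : M => BornAlg.spectralRadius ((fun f => f x) '' S)) ∧
      Tendsto (fun x : M => BornAlg.spectralRadius ((fun f => f x) '' S)) (cocompact M) (𝓝 0) ∧
      BornAlg.spectralRadius S = ⨆ x : M, BornAlg.spectralRadius ((fun f => f x) '' S) ∧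
      (Nonempty M → ∃ x : M,
        BornAlg.spectralRadius S = BornAlg.spectralRadius ((fun f => f x) '' S))) :=
  ⟨⟨BornAlg.SmoothCompact.toCZero, BornAlg.SmoothCompact.toCZero_apply,
    BornAlg.SmoothCompact.toCZero_injective, BornAlg.SmoothCompact.isIsoradial_toCZero hA⟩,
    fun _ hS => BornAlg.CZero.spectralRadius_properties hA hS,
    fun _ hS => BornAlg.SmoothCompact.spectralRadius_properties hA hS⟩
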